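/- **Setting.** A random overlap structure (ROSt) is a random pair $(\xi,Q)$ where $\xi=(\xi_i)_{i\in\mathbb N}$ satisfies $\xi_1\ge\xi_2\ge\dots\ge0$, $\sum_i\xi_i\le1$, and $Q=(q_{ij})_{i,j\in\mathbb N}$ is a symmetric positive semi-definite real matrix with $q_{ii}=1$ for all $i$. Let $\Omega_{os}$ be the space of such pairs, with the $\sigma$-algebra inherited from the product one. Fix an integer $r\ge1$. Let $\mathbb P_r$ be the law of $(\xi,Q,(\kappa(t))_{t\ge0})$ where, given $(\xi,Q)$, the fields $\kappa(t)=(\kappa_i(t))_{i\in\mathbb N}$ are i.i.d. centered gaussian with covariance $Q^{*r}=(q_{ij}^r)_{i,j}$. For $\lambda\in\mathbb R$ and $\kappa\in\mathbb R^{\mathbb N}$, the evolution $\Phi_{\lambda\kappa}$ replaces the weight $\xi_i$ by $\xi_ie^{\lambda\kappa_i}/\sum_j\xi_je^{\lambda\kappa_j}$ and then relabels the particles by the permutation $\pi$ which puts the new weights in decreasing order (ties are broken by the labels), so that $Q$ becomes $(q_{\pi(i)\pi(j)})_{i,j}$. The ROSt is *quasi-stationary for $\lambda$* if $0<\sum_j\xi_je^{\lambda\kappa_j(0)}<\infty$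 almost surely and $\Phi_{\lambda\kappa(0)}(\xi,Q)$ has under $\mathbb P_r$ the same law as $(\xi,Q)$. It is *ergodic for $\lambda$* if every bounded measurable $f:\Omega_{os}\to\mathbb R$ with $\mathbb E_r[f(\Phi_{\lambda\kappa(0)}(\xi,Q))\mid\xi,Q]=f(\xi,Q)$ a.s. is a.s. constant. Let $\Lambda$ be the map on $\Omega_{os}\times(\mathbb R^{\mathbb N})^{\mathbb Z}$ given by $\Lambda(\xi,Q,(\kappa(t))_{t\in\mathbb Z})=(\Phi_{\lambda\kappa(0)}(\xi,Q),((\kappa_{\pi(i)}(t+1))_{i})_{t\in\mathbb Z})$, with $\pi$ the permutation induced by $\Phi_{\lambda\kappa(0)}$. Finally put $$\mathcal P_r(\lambda)=\mathbb E_r\Big[\log\sum_i\xi_ie^{\lambda\kappa_i(0)}\Big],$$ and let $dx$ be the measure on $[-1,1]$ with distribution function $x(q)=\mathbb E\big[\sum_{i,j}\xi_i\xi_j\,\mathbf 1_{\{q_{ij}\le q\}}\big]$. **Lemma 2.5.** Let $U\subseteq\mathbb R$ be open and let $(\xi,Q)$ be a ROSt which is quasi-stationary for every $\lambda\in U$.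 Then for every $\lambda\in U$ the following hold. 1. The random variable $\log\sum_i\xi_ie^{\lambda\kappa_i(0)}$ is integrable, and $$\mathcal P_r(\lambda)=\frac{\lambda^2}{2}\int_{-1}^1(1-q^r)\,dx(q).$$ 2. There is exactly one $\Lambda$-invariant probability measure on $\Omega_{os}\times(\mathbb R^{\mathbb N})^{\mathbb Z}$ under which $(\xi,Q,(\kappa(t))_{t\ge0})$ has law $\mathbb P_r$; denote it again by $\mathbb P_r$. If $(\xi,Q)$ is ergodic for $\lambda$, then $\mathbb P_r$-almost surely, for every $i\in\mathbb N$, the past velocity $v_i=\lim_{T\to\infty}\frac1T\sum_{t=1}^T\kappa_i(-t)$ of the $i$-th particle exists, and all particles have the common velocity $$v_i=v=\lambda\int_{-1}^1(1-q^r)\,dx(q).$$ -/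

import Mathlib

open MeasureTheory ProbabilityTheory Filter Topology
open scoped ENNReal

noncomputable section

namespace ROSt

/-! ## Random overlap structures -/

/-- Pairs `(ξ, Q)` of a real sequence and an infinite real matrix, with the product `σ`-algebra. -/
abbrev Config : Type := (ℕ → ℝ) × (ℕ → ℕ → ℝ)

/-- The space `Ω_os = P_m × 𝒬`: non-increasing non-negative sequences with total mass at most `1`,
together with a positive semi-definite symmetric matrix with `1` on the diagonal.
(On this set the Borel `σ`-algebra of the uniform topology on the sequences and of the product
topology on the matrices is the trace of the product `σ`-algebra.) -/
def overlapSpace : Set Config :=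
  {ω | Antitone ω.1 ∧ (∀ i, 0 ≤ ω.1 i) ∧ Summable ω.1 ∧ ∑' i, ω.1 i ≤ 1 ∧
    (Matrix.of ω.2).PosSemidef ∧ ∀ i, ω.2 i i = 1}

/-- `P` is the law of a random overlap structure (ROSt): a probability measure carried by
`Ω_os`. -/
structure IsROSt (P : Measure Config) : Prop where
  isProbabilityMeasure : IsProbabilityMeasure P
  ae_mem : ∀ᵐ ω ∂P, ω ∈ overlapSpace

/-- The entry-wise power `Q^{*r}`. -/
def entryPow (r : ℕ) (Q : ℕ → ℕ → ℝ) : ℕ → ℕ → ℝ := fun i j => Q i j ^ r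

/-! ## The centered gaussian field with a given covariance

The field with covariance `C` is built from independent standard gaussian variables `g_0, g_1, …`
as `κ_i = ∑_{k ≤ i} L_{ik} g_k`, where `L` is the (lower triangular) Cholesky factor of `C`. The
columns of `L` come from successive Schur complements. When a pivot vanishes, the corresponding
column is zero (division by zero gives zero), as it must be for a positive semi-definite `C`. -/

/-- The `k`-th successive Schur complement of `C`, after elimination of the indices `< k`. -/
def schurCompl (C : ℕ → ℕ → ℝ) : ℕ → ℕ → ℕ → ℝ
  | 0 => C
  | k + 1 => fun i j =>
      schurCompl C k i j - schurCompl C k i k * schurCompl C k j k / schurCompl C k k k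

/-- The Cholesky factor `L` of `C`. -/
def cholesky (C : ℕ → ℕ → ℝ) (i k : ℕ) : ℝ :=
  schurCompl C k i k / √(schurCompl C k k k)

/-- The field `κ_i = ∑_{k ≤ i} L_{ik} g_k` as a function of the noise `g`. -/
def fieldOfNoise (C : ℕ → ℕ → ℝ) (g : ℕ → ℝ) : ℕ → ℝ :=
  fun i => ∑ k ∈ Finset.range (i + 1), cholesky C i k * g k

/-- The law of a sequence of independent standard gaussian variables. -/
def noiseLaw : Measure (ℕ → ℝ) := Measure.infinitePi fun _ : ℕ => gaussianReal 0 1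

instance : IsProbabilityMeasure noiseLaw := by unfold noiseLaw; infer_instance

/-! ## The competitive evolution -/

/-- Particle `j` stands before particle `i` when it has larger weight, or the same weight and a
smaller label. -/
def Precedes (w : ℕ → ℝ) (j i : ℕ) : Prop := w i < w j ∨ (w i = w j ∧ j < i)

/-- The reordering `π`: `order w n` is the label of the particle which has exactly `n` particles
before it, so that `w ∘ order w` is the decreasing rearrangement of the weights `w`. -/
def order (w : ℕ → ℝ) (n : ℕ) : ℕ := sInf {i | {j | Precedes w j i}.encard = n}

/-- The total weight `∑_j ξ_j e^{ψ(κ_j)}` after the increments and before normalization. -/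
def mass (ψ : ℝ → ℝ) (ω : Config) (κ : ℕ → ℝ) : ℝ≥0∞ :=
  ∑' j, ENNReal.ofReal (ω.1 j * Real.exp (ψ (κ j)))

/-- The normalized weights `ξ_i e^{ψ(κ_i)} / ∑_j ξ_j e^{ψ(κ_j)}`, not yet reordered. -/
def newWeight (ψ : ℝ → ℝ) (ω : Config) (κ : ℕ → ℝ) (i : ℕ) : ℝ :=
  ω.1 i * Real.exp (ψ (κ i)) / (mass ψ ω κ).toReal

/-- The reordering `π` induced by the evolution with increments `ψ(κ_i)`. -/
def reorder (ψ : ℝ → ℝ) (ω : Config) (κ : ℕ → ℝ) : ℕ → ℕ := order (newWeight ψ ω κ)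

/-- The evolution `Φ_{ψ(κ)}`: the weights are multiplied by `e^{ψ(κ_i)}`, normalized and put back
in decreasing order, and the overlaps are permuted accordingly. -/
def evolve (ψ : ℝ → ℝ) (ω : Config) (κ : ℕ → ℝ) : Config :=
  (fun n => newWeight ψ ω κ (reorder ψ ω κ n),
   fun m n => ω.2 (reorder ψ ω κ m) (reorder ψ ω κ n))

/-- The measure `ℙ_r`: the law of `(ξ, Q, (κ(t))_{t ≥ 0})` where `(ξ, Q)` has law `P` and, given
`(ξ, Q)`, the fields `κ(t)` are independent centered gaussian fields with covariance `Q^{*r}`. -/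
def forwardLaw (P : Measure Config) (r : ℕ) : Measure (Config × (ℕ → ℕ → ℝ)) :=
  (P.prod (Measure.infinitePi fun _ : ℕ => noiseLaw)).map
    fun x => (x.1, fun t => fieldOfNoise (entryPow r x.1.2) (x.2 t))

/-- Quasi-stationarity under `Φ_r` with the function `ψ`: the evolution is almost surely
non-singular (the normalization is neither zero nor infinite), and it preserves the law of
`(ξ, Q)`. -/
structure IsQuasiStationary (P : Measure Config) (ψ : ℝ → ℝ) (r : ℕ) : Prop where
  nonsingular : ∀ᵐ x ∂forwardLaw P r, mass ψ x.1 (x.2 0) ≠ 0 ∧ mass ψ x.1 (x.2 0) ≠ ∞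
  map_eq : (forwardLaw P r).map (fun x => evolve ψ x.1 (x.2 0)) = P

/-- Ergodicity under `Φ_r` with the function `ψ`: a bounded measurable `f` with
`𝔼_r[f(Φ_r(ξ, Q)) | ξ, Q] = f(ξ, Q)` almost surely is almost surely constant. -/
def IsErgodic (P : Measure Config) (ψ : ℝ → ℝ) (r : ℕ) : Prop :=
  ∀ f : Config → ℝ, Measurable f → (∃ M, ∀ ω, |f ω| ≤ M) →
    (forwardLaw P r)[fun x => f (evolve ψ x.1 (x.2 0)) |
        MeasurableSpace.comap Prod.fst inferInstance] =ᵐ[forwardLaw P r] (fun x => f x.1) →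
    ∃ c, ∀ᵐ ω ∂P, f ω = c

/-- The generating function `𝓟_r(λ) = 𝔼_r[log ∑_i ξ_i e^{λ ψ(κ_i(0))}]` for `ψ(κ) = κ`. -/
def generating (P : Measure Config) (r : ℕ) (l : ℝ) : ℝ :=
  ∫ x, Real.log (mass (fun k => l * k) x.1 (x.2 0)).toReal ∂forwardLaw P r

/-! ## The measure on the overlaps -/

/-- The measure `dx` on the overlaps, `A ↦ 𝔼[∑_{i,j} ξ_i ξ_j 1_{q_ij ∈ A}]`. -/
def overlapMeasure (P : Measure Config) : Measure ℝ :=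
  Measure.sum fun p : ℕ × ℕ =>
    (P.withDensity fun ω => ENNReal.ofReal (ω.1 p.1 * ω.1 p.2)).map fun ω => ω.2 p.1 p.2

/-! ## The two-sided evolution and the past increments -/

/-- The space `Ω = Ω_os × ∏_{t ∈ ℤ} ℝ^ℕ`. -/
abbrev Path : Type := Config × (ℤ → ℕ → ℝ)

/-- The map `Λ`: evolve `(ξ, Q)` by `Φ_{ψ(κ(0))}`, shift the fields in time, and reindex all of them
according to the new order of the particles. -/
def shiftEvolve (ψ : ℝ → ℝ) (x : Path) : Path :=
  (evolve ψ x.1 (x.2 0), fun t n => x.2 (t + 1) (reorder ψ x.1 (x.2 0) n))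

/-- `μ` is an extension of `ℙ_r` to `Ω` for the evolution with function `ψ`: a probability measure
on `Ω` which is invariant under `Λ` and under which `(ξ, Q, (κ(t))_{t ≥ 0})` has law `ℙ_r`. -/
structure IsExtension (P : Measure Config) (ψ : ℝ → ℝ) (r : ℕ) (μ : Measure Path) : Prop where
  isProbabilityMeasure : IsProbabilityMeasure μ
  invariant : MeasurePreserving (shiftEvolve ψ) μ μ
  forward : μ.map (fun x => (x.1, fun t : ℕ => x.2 (t : ℤ))) = forwardLaw P r

/-- The time-average `T⁻¹ ∑_{t=1}^T ψ(κ_i(-t))` of the past increments of the `i`-th particle. The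
past velocity of that particle is its limit as `T → ∞`. -/
def pastAverage (ψ : ℝ → ℝ) (x : Path) (i T : ℕ) : ℝ :=
  (T : ℝ)⁻¹ * ∑ t ∈ Finset.Icc 1 T, ψ (x.2 (-(t : ℤ)) i)

/-! ## Checks of the definitions -/

/-! ### Measurability -/

lemma measurable_schurCompl (k i j : ℕ) :
    Measurable fun C : ℕ → ℕ → ℝ => schurCompl C k i j := by
  induction k generalizing i j with
  | zero => simp only [schurCompl]; fun_prop
  | succ k ih =>
    simp only [schurCompl]
    exact (ih i j).sub (((ih i k).mul (ih j k)).div (ih k k))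

lemma measurable_fieldOfNoise :
    Measurable fun x : (ℕ → ℕ → ℝ) × (ℕ → ℝ) => fieldOfNoise x.1 x.2 := by
  refine measurable_pi_lambda _ fun i => ?_
  unfold fieldOfNoise cholesky
  refine Finset.measurable_sum _ fun k _ => ?_
  refine Measurable.mul ?_ (by fun_prop)
  exact ((measurable_schurCompl k i k).comp measurable_fst).div
    ((measurable_schurCompl k k k).comp measurable_fst).sqrt

lemma measurable_forward (r : ℕ) :
    Measurable fun x : Config × (ℕ → ℕ → ℝ) =>
      ((x.1, fun t => fieldOfNoise (entryPow r x.1.2) (x.2 t)) : Config × (ℕ → ℕ → ℝ)) := by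
  refine measurable_fst.prodMk (measurable_pi_lambda _ fun t => ?_)
  have h : Measurable fun x : Config × (ℕ → ℕ → ℝ) => (entryPow r x.1.2, x.2 t) := by
    unfold entryPow; fun_prop
  exact measurable_fieldOfNoise.comp h

lemma measurable_order (n : ℕ) : Measurable fun w : ℕ → ℝ => order w n := by
  have hprec : ∀ i, Measurable fun w : ℕ → ℝ => {j | Precedes w j i}.encard := by
    intro i
    refine measurable_encard.comp (measurable_set_iff.2 fun j => ?_)
    simp only [Set.mem_ofPred_eq, Precedes]
    refine Measurable.or ?_ (Measurable.and ?_ measurable_const)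
    · exact measurableSet_setOfPred.1 (measurableSet_lt (measurable_pi_apply i) (measurable_pi_apply j))
    · exact measurableSet_setOfPred.1 (measurableSet_eq_fun (measurable_pi_apply i)
        (measurable_pi_apply j))
  have hset : Measurable fun w : ℕ → ℝ => {i | {j | Precedes w j i}.encard = n} := by
    refine measurable_set_iff.2 fun i => ?_
    simp only [Set.mem_ofPred_eq]
    exact measurableSet_setOfPred.1 (hprec i (MeasurableSet.singleton _))
  refine measurable_to_countable' fun m => ?_
  have : (fun w : ℕ → ℝ => order w n) ⁻¹' {m} =
      {w | (m ∈ {i | {j | Precedes w j i}.encard = n} ∧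
          ∀ k < m, k ∉ {i | {j | Precedes w j i}.encard = n}) ∨
        (m = 0 ∧ ∀ k, k ∉ {i | {j | Precedes w j i}.encard = n})} := by
    ext w
    simp only [Set.mem_preimage, Set.mem_singleton_iff, order]
    rw [Set.mem_ofPred_eq (p := fun w => _)]
    generalize {i | {j | Precedes w j i}.encard = n} = S
    constructor
    · rintro rfl
      by_cases hS : S.Nonempty
      · exact Or.inl ⟨Nat.sInf_mem hS, fun k hk => Nat.notMem_of_lt_sInf hk⟩
      · rw [Set.not_nonempty_iff_eq_empty] at hS
        subst hS
        right; simp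
    · rintro (⟨h1, h2⟩ | ⟨rfl, h⟩)
      · refine le_antisymm (Nat.sInf_le h1) ?_
        by_contra! hlt
        exact h2 _ hlt (Nat.sInf_mem ⟨m, h1⟩)
      · have : S = ∅ := Set.eq_empty_of_forall_notMem h
        simp [this]
  rw [this]
  have hm := measurable_set_iff.1 hset
  have hm' : ∀ k, MeasurableSet {w : ℕ → ℝ | k ∈ {i | {j | Precedes w j i}.encard = n}} :=
    fun k => measurableSet_setOfPred.2 (hm k)
  refine MeasurableSet.union ((hm' m).inter ?_) ?_
  · exact measurableSet_setOfPred.2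
      (Measurable.forall fun k => Measurable.imp measurable_const (hm k).not)
  · exact measurableSet_setOfPred.2
      (Measurable.and measurable_const (Measurable.forall fun k => (hm k).not))

lemma measurable_mass {ψ : ℝ → ℝ} (hψ : Measurable ψ) :
    Measurable fun x : Config × (ℕ → ℝ) => mass ψ x.1 x.2 := by
  unfold mass
  exact Measurable.tsum fun j => by fun_prop

lemma measurable_newWeight {ψ : ℝ → ℝ} (hψ : Measurable ψ) :
    Measurable fun x : Config × (ℕ → ℝ) => newWeight ψ x.1 x.2 := by
  refine measurable_pi_lambda _ fun i => ?_
  unfold newWeight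
  exact Measurable.div (by fun_prop) (measurable_mass hψ).ennreal_toReal

lemma measurable_reorder {ψ : ℝ → ℝ} (hψ : Measurable ψ) (n : ℕ) :
    Measurable fun x : Config × (ℕ → ℝ) => reorder ψ x.1 x.2 n :=
  (measurable_order n).comp (measurable_newWeight hψ)

lemma measurable_evolve {ψ : ℝ → ℝ} (hψ : Measurable ψ) :
    Measurable fun x : Config × (ℕ → ℝ) => evolve ψ x.1 x.2 := by
  refine Measurable.prodMk (measurable_pi_lambda _ fun n => ?_)
    (measurable_pi_lambda _ fun m => measurable_pi_lambda _ fun n => ?_)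
  · have h : Measurable fun p : (ℕ → ℝ) × ℕ => p.1 p.2 :=
      measurable_from_prod_countable_left fun i => measurable_pi_apply i
    exact h.comp ((measurable_newWeight hψ).prodMk (measurable_reorder hψ n))
  · have h : Measurable fun p : (ℕ → ℕ → ℝ) × (ℕ × ℕ) => p.1 p.2.1 p.2.2 :=
      measurable_from_prod_countable_left fun i =>
        (measurable_pi_apply i.2).comp (measurable_pi_apply i.1)
    exact h.comp ((measurable_snd.comp measurable_fst).prodMk
      ((measurable_reorder hψ m).prodMk (measurable_reorder hψ n)))

lemma measurable_shiftEvolve {ψ : ℝ → ℝ} (hψ : Measurable ψ) :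
    Measurable (shiftEvolve ψ) := by
  have h0 : Measurable fun x : Path => ((x.1, x.2 0) : Config × (ℕ → ℝ)) := by fun_prop
  refine Measurable.prodMk ((measurable_evolve hψ).comp h0)
    (measurable_pi_lambda _ fun t => measurable_pi_lambda _ fun n => ?_)
  have h : Measurable fun p : (ℕ → ℝ) × ℕ => p.1 p.2 :=
    measurable_from_prod_countable_left fun i => measurable_pi_apply i
  exact h.comp (Measurable.prodMk (by fun_prop) ((measurable_reorder hψ n).comp h0))

/-! ### The reordering, the Cholesky factor and the overlap distribution -/

lemma Precedes.trans {w : ℕ → ℝ} {i j k : ℕ} (h1 : Precedes w i j) (h2 : Precedes w j k) :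
    Precedes w i k := by
  unfold Precedes at *
  rcases h1 with h1 | ⟨h1, h1'⟩ <;> rcases h2 with h2 | ⟨h2, h2'⟩
  · exact Or.inl (h2.trans h1)
  · exact Or.inl (h2 ▸ h1)
  · exact Or.inl (h1 ▸ h2)
  · exact Or.inr ⟨h2.trans h1, h1'.trans h2'⟩

lemma Precedes.irrefl {w : ℕ → ℝ} (i : ℕ) : ¬ Precedes w i i := by
  simp [Precedes]

lemma Precedes.total {w : ℕ → ℝ} {i j : ℕ} (h : i ≠ j) : Precedes w i j ∨ Precedes w j i := by
  unfold Precedes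
  rcases lt_trichotomy (w i) (w j) with h' | h' | h'
  · exact Or.inr (Or.inl h')
  · rcases lt_or_gt_of_ne h with h | h
    · exact Or.inl (Or.inr ⟨h'.symm, h⟩)
    · exact Or.inr (Or.inr ⟨h', h⟩)
  · exact Or.inl (Or.inl h')

lemma rank_lt {w : ℕ → ℝ} (hw : ∀ i, {j | Precedes w j i}.Finite) {i j : ℕ}
    (h : Precedes w i j) : {k | Precedes w k i}.ncard < {k | Precedes w k j}.ncard :=
  Set.ncard_lt_ncard ⟨fun _ hk => Precedes.trans hk h,
    fun hs => Precedes.irrefl i (hs (show i ∈ {k | Precedes w k j} from h))⟩ (hw j)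

lemma rank_order {w : ℕ → ℝ} (hw : ∀ i, {j | Precedes w j i}.Finite) :
    Function.Injective (fun i => {k | Precedes w k i}.ncard) ∧
      ∀ n, {k | Precedes w k (order w n)}.ncard = n := by
  have hinj : Function.Injective fun i => {k | Precedes w k i}.ncard := by
    intro i j hij
    by_contra hne
    rcases Precedes.total (w := w) hne with h | h
    · exact absurd hij (rank_lt hw h).ne
    · exact absurd hij (rank_lt hw h).ne'
  refine ⟨hinj, fun n => ?_⟩
  have hex : ∃ i, {k | Precedes w k i}.ncard = n := by
    obtain ⟨i, hi⟩ : ∃ i, n < {k | Precedes w k i}.ncard := by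
      by_contra! hle
      exact Set.infinite_range_of_injective hinj
        ((Set.finite_Iic n).subset (Set.range_subset_iff.2 hle))
    have himg : (fun i => {k | Precedes w k i}.ncard) '' {k | Precedes w k i} =
        Set.Iio ({k | Precedes w k i}.ncard) := by
      refine Set.eq_of_subset_of_ncard_le ?_ ?_ (Set.finite_Iio _)
      · rintro _ ⟨k, hk, rfl⟩
        exact rank_lt hw hk
      · rw [Set.ncard_image_of_injective _ hinj]
        simp [Set.ncard_eq_toFinset_card']
    have hn : n ∈ Set.Iio ({k | Precedes w k i}.ncard) := hi
    rw [← himg] at hn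
    obtain ⟨k, -, hk⟩ := hn
    exact ⟨k, hk⟩
  have hne : {i | {j | Precedes w j i}.encard = n}.Nonempty := by
    obtain ⟨i, hi⟩ := hex
    exact ⟨i, by rw [Set.mem_ofPred_eq, ← (hw i).cast_ncard_eq, hi]⟩
  have h := Nat.sInf_mem hne
  rw [Set.mem_ofPred_eq, ← (hw _).cast_ncard_eq] at h
  exact_mod_cast h

/-- When every particle has finitely many particles before it, `order w` is a permutation of the
labels. -/
lemma bijective_order {w : ℕ → ℝ} (hw : ∀ i, {j | Precedes w j i}.Finite) :
    Function.Bijective (order w) := by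
  obtain ⟨hinj, hr⟩ := rank_order hw
  refine ⟨fun m n hmn => ?_, fun i => ⟨{k | Precedes w k i}.ncard, hinj (hr _)⟩⟩
  rw [← hr m, ← hr n, hmn]

/-- When every particle has finitely many particles before it, `w ∘ order w` is non-increasing. -/
lemma antitone_order {w : ℕ → ℝ} (hw : ∀ i, {j | Precedes w j i}.Finite) :
    Antitone (w ∘ order w) := by
  obtain ⟨-, hr⟩ := rank_order hw
  intro m n hmn
  by_contra! hlt
  have h := rank_lt hw (show Precedes w (order w n) (order w m) from Or.inl hlt)
  rw [hr, hr] at h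
  omega

lemma quadForm_eq (A : ℕ → ℕ → ℝ) (x : ℕ →₀ ℝ) {S : Finset ℕ} (hS : x.support ⊆ S) :
    (x.sum fun i xi => x.sum fun j xj => star xi * Matrix.of A i j * xj) =
      ∑ i ∈ S, ∑ j ∈ S, x i * A i j * x j := by
  unfold Finsupp.sum
  rw [Finset.sum_subset hS]
  · refine Finset.sum_congr rfl fun i _ => Finset.sum_subset hS fun j _ hj => ?_
    simp [Finsupp.notMem_support_iff.1 hj]
  · intro i _ hi
    simp [Finsupp.notMem_support_iff.1 hi]

lemma quadForm_nonneg {A : ℕ → ℕ → ℝ} (hA : (Matrix.of A).PosSemidef) (S : Finset ℕ)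
    (x : ℕ → ℝ) : 0 ≤ ∑ i ∈ S, ∑ j ∈ S, x i * A i j * x j := by
  have h := hA.2 (Finsupp.indicator S fun i _ => x i)
  rw [quadForm_eq A _ (Finsupp.support_indicator_subset ..)] at h
  refine h.trans_eq (Finset.sum_congr rfl fun i hi => Finset.sum_congr rfl fun j hj => ?_)
  simp [Finsupp.indicator_apply, hi, hj]

lemma posSemidef_of_quadForm {A : ℕ → ℕ → ℝ} (hs : ∀ i j, A i j = A j i) (k : ℕ)
    (h : ∀ S : Finset ℕ, k ∈ S → ∀ x : ℕ → ℝ, 0 ≤ ∑ i ∈ S, ∑ j ∈ S, x i * A i j * x j) :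
    (Matrix.of A).PosSemidef := by
  refine ⟨Matrix.IsHermitian.ext fun i j => by simp [hs i j], fun x => ?_⟩
  rw [quadForm_eq A x (Finset.subset_insert k _)]
  exact h _ (Finset.mem_insert_self _ _) x

lemma symm_of_posSemidef {A : ℕ → ℕ → ℝ} (hA : (Matrix.of A).PosSemidef) (i j : ℕ) :
    A i j = A j i := by
  simpa using hA.1.apply j i

lemma eq_zero_of_pivot {A : ℕ → ℕ → ℝ} (hA : (Matrix.of A).PosSemidef) {k : ℕ}
    (hk : A k k = 0) (i : ℕ) : A i k = 0 := by
  by_cases hik : i = k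
  · rw [hik, hk]
  by_contra hne
  have h := quadForm_nonneg hA {i, k}
    (fun m => if m = i then 1 else -(A i i + 1) / (2 * A i k))
  simp only [Finset.sum_pair hik, if_true, if_neg (Ne.symm hik), hk, symm_of_posSemidef hA k i] at h
  have e : -(A i i + 1) / (2 * A i k) * A i k = -(A i i + 1) / 2 := by field_simp
  have e' : A i k * (-(A i i + 1) / (2 * A i k)) = -(A i i + 1) / 2 := by field_simp
  simp only [one_mul, mul_one, mul_zero, zero_mul, add_zero, e, e'] at h
  linarith

lemma posSemidef_schurCompl {C : ℕ → ℕ → ℝ} (hC : (Matrix.of C).PosSemidef) (k : ℕ) :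
    (Matrix.of (schurCompl C k)).PosSemidef := by
  induction k with
  | zero => exact hC
  | succ k ih =>
    set A := schurCompl C k with hAdef
    have hsymm := symm_of_posSemidef ih
    refine posSemidef_of_quadForm (fun i j => ?_) k (fun S hkS x => ?_)
    · simp only [schurCompl, ← hAdef]
      rw [hsymm j i, mul_comm]
    · simp only [schurCompl, ← hAdef]
      by_cases hk : A k k = 0
      · simpa [hk] using quadForm_nonneg ih S x
      set s := ∑ i ∈ S, x i * A i k with hs
      set v : ℕ → ℝ := fun i => if i = k then s / A k k else 0 with hv
      have h := quadForm_nonneg ih S (fun i => x i - v i)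
      have e1 : ∑ i ∈ S, ∑ j ∈ S, (x i - v i) * A i j * (x j - v j) =
          ∑ i ∈ S, ∑ j ∈ S, x i * A i j * x j - ∑ i ∈ S, ∑ j ∈ S, x i * A i j * v j -
            ∑ i ∈ S, ∑ j ∈ S, v i * A i j * x j + ∑ i ∈ S, ∑ j ∈ S, v i * A i j * v j := by
        simp only [← Finset.sum_sub_distrib, ← Finset.sum_add_distrib]
        exact Finset.sum_congr rfl fun i _ => Finset.sum_congr rfl fun j _ => by ring
      have e2 : ∑ i ∈ S, ∑ j ∈ S, x i * A i j * v j = s * (s / A k k) := by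
        simp [hv, hkS, hs, Finset.sum_mul]
      have e3 : ∑ i ∈ S, ∑ j ∈ S, v i * A i j * x j = s * (s / A k k) := by
        rw [Finset.sum_comm, ← e2]
        exact Finset.sum_congr rfl fun i _ => Finset.sum_congr rfl fun j _ => by
          rw [hsymm j i]; ring
      have e4 : ∑ i ∈ S, ∑ j ∈ S, v i * A i j * v j = s * (s / A k k) := by
        have hsk : s / A k k * A k k = s := by field_simp
        simp [hv, hkS, hsk]
      have e5 : ∑ i ∈ S, ∑ j ∈ S, x i * (A i j - A i k * A j k / A k k) * x j =
          (∑ i ∈ S, ∑ j ∈ S, x i * A i j * x j) - s * (s / A k k) := by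
        have : s * (s / A k k) = ∑ i ∈ S, ∑ j ∈ S, x i * (A i k * A j k / A k k) * x j := by
          rw [← mul_div_assoc, hs, Finset.sum_mul_sum, Finset.sum_div]
          refine Finset.sum_congr rfl fun i _ => ?_
          rw [Finset.sum_div]
          exact Finset.sum_congr rfl fun j _ => by ring
        rw [this, ← Finset.sum_sub_distrib]
        refine Finset.sum_congr rfl fun i _ => ?_
        rw [← Finset.sum_sub_distrib]
        exact Finset.sum_congr rfl fun j _ => by ring
      rw [e1, e2, e3, e4] at h
      rw [e5]
      linarith

lemma schurCompl_eq_zero {C : ℕ → ℕ → ℝ} (hC : (Matrix.of C).PosSemidef) (k i j : ℕ)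
    (hi : i < k) : schurCompl C k i j = 0 := by
  induction k generalizing i j with
  | zero => omega
  | succ k ih =>
    have hA := posSemidef_schurCompl hC k
    simp only [schurCompl]
    rcases Nat.lt_succ_iff_lt_or_eq.1 hi with h | rfl
    · simp [ih i _ h]
    · by_cases h0 : schurCompl C i i i = 0
      · rw [symm_of_posSemidef hA i j, eq_zero_of_pivot hA h0 j]
        simp
      · rw [symm_of_posSemidef hA i j]
        field_simp
        ring

/-- The Cholesky factor of a positive semi-definite matrix satisfies `L Lᵀ = C`: the field
`fieldOfNoise C` has covariance `C`. -/
lemma cholesky_mul_transpose {C : ℕ → ℕ → ℝ} (hC : (Matrix.of C).PosSemidef) (i j : ℕ) :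
    ∑ k ∈ Finset.range (min i j + 1), cholesky C i k * cholesky C j k = C i j := by
  have key : ∀ m, ∑ k ∈ Finset.range m, cholesky C i k * cholesky C j k =
      C i j - schurCompl C m i j := by
    intro m
    induction m with
    | zero => simp [schurCompl]
    | succ m ih =>
      have h0 : 0 ≤ schurCompl C m m m := by
        simpa using (posSemidef_schurCompl hC m).diag_nonneg (i := m)
      rw [Finset.sum_range_succ, ih]
      simp only [schurCompl, cholesky]
      rw [div_mul_div_comm, Real.mul_self_sqrt h0]
      ring
  rw [key]
  have : schurCompl C (min i j + 1) i j = 0 := by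
    rcases min_choice i j with h | h <;> rw [h]
    · exact schurCompl_eq_zero hC _ _ _ (by omega)
    · rw [symm_of_posSemidef (posSemidef_schurCompl hC _)]
      exact schurCompl_eq_zero hC _ _ _ (by omega)
  rw [this, sub_zero]

/-- The distribution function of `dx` is `x(q) = 𝔼[∑_{i,j} ξ_i ξ_j 1_{q_ij ≤ q}]`. -/
lemma overlapMeasure_Iic (P : Measure Config) (q : ℝ) :
    overlapMeasure P (Set.Iic q) =
      ∫⁻ ω, ∑' p : ℕ × ℕ,
        ENNReal.ofReal (ω.1 p.1 * ω.1 p.2) * (Set.Iic q).indicator 1 (ω.2 p.1 p.2) ∂P := by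
  unfold overlapMeasure
  have hm : ∀ p : ℕ × ℕ, Measurable fun ω : Config => ω.2 p.1 p.2 := fun p => by fun_prop
  rw [Measure.sum_apply _ measurableSet_Iic, lintegral_tsum]
  · refine tsum_congr fun p => ?_
    rw [Measure.map_apply (hm p) measurableSet_Iic,
      withDensity_apply _ (hm p measurableSet_Iic),
      ← lintegral_indicator (hm p measurableSet_Iic)]
    refine lintegral_congr fun ω => ?_
    by_cases h : ω.2 p.1 p.2 ∈ Set.Iic q <;> simp [Set.indicator, h]
  · intro p
    refine (Measurable.mul (by fun_prop) ?_).aemeasurable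
    exact (measurable_one.indicator measurableSet_Iic).comp (hm p)

end ROSt

end

open MeasureTheory ProbabilityTheory Filter Topology
open scoped ENNReal

noncomputable section

namespace ROSt

/-! Write `lse w y` for log ∑ w_j e^{y_j}. Everything rests on a cocycle identity: `lse w (y + z)`
is `lse w y` plus the log-sum-exp of z under the weights tilted by y (`lse_add`). One evolution step
is such a tilt followed by a relabelling, and relabelling does not change a log-sum-exp. Hence the
log-sum-exps of successive steps add up along a path. The weights have total mass one almost surely,
because the evolution normalizes them and preserves their law.

Generating function. Let M(s) be the mean of the log-sum-exp when the field has covariance s Q^{*r}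
(`meanFree`). Splitting a field of variance l² + s into independent parts and applying
quasi-stationarity for l to the first part gives M(l² + s) = M(l²) + M(s). Since U is open, this
also holds with l² replaced by any slightly larger number. Comparing the two identities gives M(x +
s) = M(x) + M(s) for all x ≥ 0 and small s ≥ 0, so M is linear (`meanFree_eq`). The slope is the
derivative at 0. By symmetry of the field, log Z(y) may be replaced by half of log Z(y)Z(-y), where
Z(y)Z(-y) = ∑ w_i w_j cosh(y_i - y_j). The second order expansion gives half the mean of ∑ ξ_i ξ_j
(1 - q_ij^r) (`tendsto_free_div`).

Two-sided extension. The forward process is stationary, and its natural extension supplies a past,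
which is then rewritten in the current labels. Invariance makes the law of the path seen from time
-T on an image of the forward law, and these laws determine the measure
(`existsUnique_isExtension`).

Velocities. Given the configuration, the log-sum-exp of n steps concentrates exponentially around
its conditional mean, uniformly in the configuration (`exists_concentration`). With the pointwise
ergodic theorem, the energy per step has a limit that depends on the configuration alone and is
invariant under the evolution. Ergodicity makes it the constant m = l²c/2, with c the integral of 1
- q^r. Reading the same cocycle backwards gives the rate -m for the past. For the velocity, perturb
the past field by a small multiple e. Seen from T steps earlier, the log-sum-exp of e times the last
T fields is the difference of the forward energies with coefficients l + e and l. The first has the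
variance of about T' = T(l+e)²/l² steps with coefficient l, so it is at most the energy of these T'
steps plus a small error. Thus the past energy with coefficient e is at most about m(T' - T) = (lce
+ O(e²))T. Since log ξ_i + e ∑ κ_i is at most this energy, taking e of both signs forces the average
of κ_i to lc. A particle without weight never changes its label, so its average tends to 0 by
gaussian tails. In that case only finitely many particles carry weight, and the backward rate -m is
compatible with their common velocity lc only if lc = 0. -/

/-- The law of the centered gaussian field with covariance `C`. -/
def gaussField (C : ℕ → ℕ → ℝ) : Measure (ℕ → ℝ) := noiseLaw.map (fieldOfNoise C)

/-! ### Gaussian fields: characterization, scaling, relabelling, convolution -/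

lemma measurable_fieldOfNoise_right (C : ℕ → ℕ → ℝ) : Measurable (fieldOfNoise C) :=
  measurable_fieldOfNoise.comp measurable_prodMk_left

instance (C : ℕ → ℕ → ℝ) : IsProbabilityMeasure (gaussField C) :=
  Measure.isProbabilityMeasure_map (measurable_fieldOfNoise_right C).aemeasurable

lemma map_sum_noiseLaw (a : ℕ → ℝ) (N : ℕ) :
    noiseLaw.map (fun g => ∑ k ∈ Finset.range N, a k * g k) =
      gaussianReal 0 (Real.toNNReal (∑ k ∈ Finset.range N, a k ^ 2)) := by
  induction N with
  | zero => simp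
  | succ N ih =>
    have hind : iIndepFun (fun (k : ℕ) (g : ℕ → ℝ) => a k * g k) noiseLaw :=
      iIndepFun_infinitePi (P := fun _ : ℕ => gaussianReal 0 1)
        (X := fun k x => a k * x) (fun k => by fun_prop)
    have h2 := hind.indepFun_finsetSum_of_notMem (s := Finset.range N) (i := N)
      (fun k => by fun_prop) (by simp)
    have hN : noiseLaw.map (fun g : ℕ → ℝ => a N * g N) =
        gaussianReal 0 (Real.toNNReal (a N ^ 2)) := by
      have h := gaussianReal_map_const_mul (μ := 0) (v := 1) (a N)
      rw [← Measure.infinitePi_map_eval (μ := fun _ : ℕ => gaussianReal 0 1) N] at h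
      rw [Measure.map_map (by fun_prop) (by fun_prop)] at h
      unfold noiseLaw
      refine Eq.trans h ?_
      simp only [mul_zero, mul_one]
      congr 1
      ext
      simp [Real.coe_toNNReal _ (sq_nonneg _)]
    have h3 := gaussianReal_add_gaussianReal_of_indepFun (X := ∑ k ∈ Finset.range N,
      fun g : ℕ → ℝ => a k * g k) (Y := fun g : ℕ → ℝ => a N * g N) (m₁ := 0) (m₂ := 0)
      h2 (by convert ih using 2; ext g; simp) hN
    rw [← Real.toNNReal_add (Finset.sum_nonneg fun _ _ => sq_nonneg _) (sq_nonneg _)] at h3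
    simp_rw [Finset.sum_range_succ]
    convert h3 using 2
    · ext g; simp
    · simp

lemma cholesky_eq_zero {C : ℕ → ℕ → ℝ} (hC : (Matrix.of C).PosSemidef) {i k : ℕ} (h : i < k) :
    cholesky C i k = 0 := by
  simp [cholesky, schurCompl_eq_zero hC k i k h]

/-- The factor is lower triangular, so the terms beyond `min i j` vanish. One common range can
therefore serve for finitely many indices at once. -/
lemma sum_cholesky_mul {C : ℕ → ℕ → ℝ} (hC : (Matrix.of C).PosSemidef) {i j N : ℕ}
    (hi : i < N) :
    ∑ k ∈ Finset.range N, cholesky C i k * cholesky C j k = C i j := by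
  rw [← cholesky_mul_transpose hC i j]
  symm
  refine Finset.sum_subset (Finset.range_mono (by omega)) fun k _ hk => ?_
  rw [Finset.mem_range, not_lt] at hk
  rcases lt_or_ge i k with h | h
  · rw [cholesky_eq_zero hC h, zero_mul]
  · rw [cholesky_eq_zero hC (i := j) (by omega), mul_zero]

/-- The linear combinations of a gaussian field are gaussian. -/
lemma map_sum_gaussField {C : ℕ → ℕ → ℝ} (hC : (Matrix.of C).PosSemidef) (S : Finset ℕ)
    (t : ℕ → ℝ) (f : ℕ → ℕ) :
    (gaussField C).map (fun y => ∑ j ∈ S, t j * y (f j)) =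
      gaussianReal 0 (Real.toNNReal (∑ i ∈ S, ∑ j ∈ S, t i * C (f i) (f j) * t j)) := by
  obtain ⟨N, hN⟩ : ∃ N, ∀ j ∈ S, f j < N :=
    ⟨S.sup f + 1, fun j hj => Nat.lt_succ_of_le (Finset.le_sup hj)⟩
  unfold gaussField
  rw [Measure.map_map (by fun_prop) (measurable_fieldOfNoise_right C)]
  convert map_sum_noiseLaw (fun k => ∑ j ∈ S, t j * cholesky C (f j) k) N using 2
  · ext g
    simp only [Function.comp, fieldOfNoise, Finset.sum_mul]
    rw [Finset.sum_comm]
    refine Finset.sum_congr rfl fun j hj => ?_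
    rw [Finset.mul_sum]
    rw [← Finset.sum_subset (Finset.range_mono (Nat.succ_le_of_lt (hN j hj))) fun k _ hk => by
      rw [cholesky_eq_zero hC (by simpa using hk)]; simp]
    exact Finset.sum_congr rfl fun k _ => by ring
  · congr 1
    simp_rw [sq, Finset.sum_mul_sum]
    rw [Finset.sum_comm (s := Finset.range N)]
    refine Finset.sum_congr rfl fun i hi => ?_
    rw [Finset.sum_comm (s := Finset.range N)]
    refine Finset.sum_congr rfl fun j _ => ?_
    rw [← sum_cholesky_mul hC (hN i hi), Finset.mul_sum, Finset.sum_mul]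
    exact Finset.sum_congr rfl fun k _ => by ring

/-- A law on sequences is determined by the laws of the finite linear combinations. -/
lemma ext_of_map_sum {μ ν : Measure (ℕ → ℝ)} [IsFiniteMeasure μ] [IsFiniteMeasure ν]
    (h : ∀ (S : Finset ℕ) (t : ℕ → ℝ),
      μ.map (fun y => ∑ j ∈ S, t j * y j) = ν.map (fun y => ∑ j ∈ S, t j * y j)) : μ = ν := by
  have hproj : IsProjectiveLimit ν (fun I : Finset ℕ => μ.map I.restrict) := by
    intro I
    have hm : Measurable (fun y : ℕ → ℝ => WithLp.toLp 2 (I.restrict y)) := by fun_prop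
    -- Cramér–Wold: the characteristic function of a finite marginal at t only involves the law of
    -- the linear combination with coefficients t.
    have key : μ.map (fun y : ℕ → ℝ => WithLp.toLp 2 (I.restrict y)) =
        ν.map (fun y : ℕ → ℝ => WithLp.toLp 2 (I.restrict y)) := by
      refine Measure.ext_of_charFun (E := EuclideanSpace ℝ I) (funext fun t => ?_)
      rw [charFun_apply, charFun_apply, integral_map (by fun_prop) (by fun_prop),
        integral_map (by fun_prop) (by fun_prop)]
      obtain ⟨u, e⟩ : ∃ u : ℕ → ℝ, ∀ y : ℕ → ℝ, inner ℝ (WithLp.toLp 2 (I.restrict y)) t =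
          ∑ j ∈ I, u j * y j := by
        refine ⟨fun j => if hj : j ∈ I then t ⟨j, hj⟩ else 0, fun y => ?_⟩
        rw [PiLp.inner_apply, ← Finset.sum_coe_sort I]
        exact Finset.sum_congr rfl fun i _ => by simp
      simp_rw [e]
      have h' := h I u
      have hF : ∀ ρ : Measure (ℕ → ℝ), ∫ y, Complex.exp
          (((∑ j ∈ I, u j * y j : ℝ) : ℂ) * Complex.I) ∂ρ =
          ∫ x : ℝ, Complex.exp ((x : ℂ) * Complex.I)
            ∂(ρ.map (fun y => ∑ j ∈ I, u j * y j)) := by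
        intro ρ
        rw [integral_map (Measurable.aemeasurable (by fun_prop)) (by fun_prop)]
      rw [hF, hF, h']
    have h2 := congrArg (Measure.map (WithLp.ofLp (p := 2) (V := I → ℝ))) key
    rw [Measure.map_map (by fun_prop) hm, Measure.map_map (by fun_prop) hm] at h2
    exact h2.symm
  have hproj' : IsProjectiveLimit μ (fun I : Finset ℕ => μ.map I.restrict) := fun I => rfl
  exact hproj'.unique hproj

lemma gaussField_unique {C : ℕ → ℕ → ℝ} (hC : (Matrix.of C).PosSemidef) {μ : Measure (ℕ → ℝ)}
    [IsFiniteMeasure μ] (h : ∀ (S : Finset ℕ) (t : ℕ → ℝ),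
      μ.map (fun y => ∑ j ∈ S, t j * y j) =
        gaussianReal 0 (Real.toNNReal (∑ i ∈ S, ∑ j ∈ S, t i * C i j * t j))) :
    μ = gaussField C :=
  ext_of_map_sum fun S t => by rw [h, map_sum_gaussField hC S t (fun j => j)]

lemma posSemidef_comp {C : ℕ → ℕ → ℝ} (hC : (Matrix.of C).PosSemidef) (f : ℕ → ℕ) :
    (Matrix.of fun i j => C (f i) (f j)).PosSemidef :=
  hC.submatrix f

lemma posSemidef_smul {C : ℕ → ℕ → ℝ} (hC : (Matrix.of C).PosSemidef) {s : ℝ} (hs : 0 ≤ s) :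
    (Matrix.of fun i j => s * C i j).PosSemidef := by
  refine posSemidef_of_quadForm (fun i j => by rw [symm_of_posSemidef hC i j]) 0 fun S _ x => ?_
  have h := mul_nonneg hs (quadForm_nonneg hC S x)
  rw [Finset.mul_sum] at h
  refine h.trans_eq (Finset.sum_congr rfl fun i _ => ?_)
  rw [Finset.mul_sum]
  exact Finset.sum_congr rfl fun j _ => by ring

lemma gaussField_map_comp {C : ℕ → ℕ → ℝ} (hC : (Matrix.of C).PosSemidef) (f : ℕ → ℕ) :
    (gaussField C).map (fun y i => y (f i)) = gaussField fun i j => C (f i) (f j) := by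
  have hm : Measurable fun (y : ℕ → ℝ) i => y (f i) := by fun_prop
  have := Measure.isProbabilityMeasure_map (μ := gaussField C) hm.aemeasurable
  refine gaussField_unique (posSemidef_comp hC f) fun S t => ?_
  rw [Measure.map_map (by fun_prop) hm]
  exact map_sum_gaussField hC S t f

lemma gaussField_map_smul {C : ℕ → ℕ → ℝ} (hC : (Matrix.of C).PosSemidef) (b : ℝ) :
    (gaussField C).map (fun y i => b * y i) = gaussField fun i j => b ^ 2 * C i j := by
  have hm : Measurable fun (y : ℕ → ℝ) i => b * y i := by fun_prop
  have := Measure.isProbabilityMeasure_map (μ := gaussField C) hm.aemeasurable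
  refine gaussField_unique (posSemidef_smul hC (sq_nonneg b)) fun S t => ?_
  rw [Measure.map_map (by fun_prop) hm]
  convert map_sum_gaussField hC S (fun j => t j * b) (fun j => j) using 2
  · ext y
    simp [mul_assoc]
  · congr 1
    exact Finset.sum_congr rfl fun i _ => Finset.sum_congr rfl fun j _ => by ring

/-- Variances of independent fields add. Read from right to left, this splits a field into the part
that drives an evolution and the part that comes after it. -/
lemma gaussField_conv {C : ℕ → ℕ → ℝ} (hC : (Matrix.of C).PosSemidef) {s s' : ℝ} (hs : 0 ≤ s)
    (hs' : 0 ≤ s') :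
    ((gaussField fun i j => s * C i j).prod (gaussField fun i j => s' * C i j)).map
      (fun p i => p.1 i + p.2 i) = gaussField fun i j => (s + s') * C i j := by
  have hm : Measurable fun (p : (ℕ → ℝ) × (ℕ → ℝ)) i => p.1 i + p.2 i := by fun_prop
  have := Measure.isProbabilityMeasure_map
    (μ := (gaussField fun i j => s * C i j).prod (gaussField fun i j => s' * C i j)) hm.aemeasurable
  refine gaussField_unique (posSemidef_smul hC (add_nonneg hs hs')) fun S t => ?_
  rw [Measure.map_map (by fun_prop) hm]
  have hL : Measurable fun y : ℕ → ℝ => ∑ j ∈ S, t j * y j := by fun_prop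
  have h := indepFun_prod (μ := gaussField fun i j => s * C i j)
    (ν := gaussField fun i j => s' * C i j) hL hL
  have h1 := map_sum_gaussField (posSemidef_smul hC hs) S t (fun j => j)
  have h2 := map_sum_gaussField (posSemidef_smul hC hs') S t (fun j => j)
  have h3 := gaussianReal_add_gaussianReal_of_indepFun h (m₁ := 0) (m₂ := 0)
    (by refine (Measure.map_map hL measurable_fst).symm.trans ?_
        rw [Measure.map_fst_prod, measure_univ, one_smul, h1])
    (by refine (Measure.map_map hL measurable_snd).symm.trans ?_
        rw [Measure.map_snd_prod, measure_univ, one_smul, h2])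
  rw [← Real.toNNReal_add (quadForm_nonneg (posSemidef_smul hC hs) S t)
    (quadForm_nonneg (posSemidef_smul hC hs') S t)] at h3
  convert h3 using 2
  · ext p
    simp [mul_add, Finset.sum_add_distrib]
  · simp
  · congr 1
    simp_rw [← Finset.sum_add_distrib]
    exact Finset.sum_congr rfl fun i _ => Finset.sum_congr rfl fun j _ => by ring

lemma map_eval_gaussField {C : ℕ → ℕ → ℝ} (hC : (Matrix.of C).PosSemidef) (i : ℕ) :
    (gaussField C).map (fun y => y i) = gaussianReal 0 (Real.toNNReal (C i i)) := by
  simpa using map_sum_gaussField hC {i} (fun _ => 1) (fun j => j)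

lemma lintegral_exp_gaussianReal (b : ℝ) (v : NNReal) :
    ∫⁻ x, ENNReal.ofReal (Real.exp (b * x)) ∂gaussianReal 0 v =
      ENNReal.ofReal (Real.exp (b ^ 2 * v / 2)) := by
  rw [← ofReal_integral_eq_lintegral_ofReal (integrable_exp_mul_gaussianReal b)
    (ae_of_all _ fun x => (Real.exp_pos _).le)]
  have h := congrFun (mgf_id_gaussianReal (μ := 0) (v := v)) b
  simp only [mgf, id] at h
  rw [h]
  congr 2
  ring

lemma lintegral_exp_gaussField {C : ℕ → ℕ → ℝ} (hC : (Matrix.of C).PosSemidef) (b : ℝ) (i : ℕ) :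
    ∫⁻ y, ENNReal.ofReal (Real.exp (b * y i)) ∂gaussField C =
      ENNReal.ofReal (Real.exp (b ^ 2 * C i i / 2)) := by
  have h0 : 0 ≤ C i i := by simpa using hC.diag_nonneg (i := i)
  refine (lintegral_map (μ := gaussField C) (f := fun x : ℝ => ENNReal.ofReal (Real.exp (b * x)))
    (g := fun y => y i) (by fun_prop) (by fun_prop)).symm.trans ?_
  rw [map_eval_gaussField hC, lintegral_exp_gaussianReal, Real.coe_toNNReal _ h0]

lemma lintegral_sq_gaussianReal (v : NNReal) :
    ∫⁻ x, ENNReal.ofReal (x ^ 2) ∂gaussianReal 0 v = v := by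
  have h := variance_fun_id_gaussianReal (μ := 0) (v := v)
  rw [variance_eq_integral (by fun_prop), integral_id_gaussianReal] at h
  simp only [sub_zero] at h
  have h2 := (memLp_id_gaussianReal' (μ := 0) (v := v) 2 (by simp)).integrable_sq
  simp only [id] at h2
  rw [← ofReal_integral_eq_lintegral_ofReal h2 (ae_of_all _ fun x => sq_nonneg _), h]
  simp

lemma lintegral_sq_sub_gaussField {C : ℕ → ℕ → ℝ} (hC : (Matrix.of C).PosSemidef) (i j : ℕ) :
    ∫⁻ y, ENNReal.ofReal ((y i - y j) ^ 2) ∂gaussField C =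
      ENNReal.ofReal (C i i + C j j - 2 * C i j) := by
  by_cases hij : i = j
  · subst hij
    have : C i i + C i i - 2 * C i i = 0 := by ring
    simp [this]
  have h := map_sum_gaussField hC {i, j} (fun k => if k = i then 1 else -1) (fun j => j)
  simp only [Finset.sum_pair hij, if_true, if_neg (Ne.symm hij), one_mul, mul_one] at h
  refine (lintegral_map (μ := gaussField C) (f := fun x : ℝ => ENNReal.ofReal (x ^ 2))
    (g := fun y => y i - y j) (by fun_prop) (by fun_prop)).symm.trans ?_
  have e : (fun y : ℕ → ℝ => y i - y j) = fun y => y i + -1 * y j := by ext; ring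
  rw [e, h, lintegral_sq_gaussianReal, symm_of_posSemidef hC j i, ENNReal.ofReal]
  congr 2
  ring

/-! ### Log-sum-exp of a probability weight -/

/-- A probability weight on `ℕ`. -/
structure IsWeight (w : ℕ → ℝ) : Prop where
  nonneg : ∀ i, 0 ≤ w i
  hasSum : HasSum w 1

/-- The partition function `∑_j w_j e^{y_j}`. -/
def total (w y : ℕ → ℝ) : ℝ := (∑' j, ENNReal.ofReal (w j * Real.exp (y j))).toReal

/-- The log-sum-exp `log ∑_j w_j e^{y_j}`. -/
def lse (w y : ℕ → ℝ) : ℝ := Real.log (total w y)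

/-- The weights `w_i e^{y_i}`, normalized. -/
def tilt (w y : ℕ → ℝ) (i : ℕ) : ℝ := w i * Real.exp (y i) / total w y

/-- Finite exponential moments of `|y|` under the weight `w`. -/
def Good (w y : ℕ → ℝ) : Prop := Summable fun i => w i * Real.exp |y i|

@[fun_prop]
lemma measurable_total : Measurable fun p : (ℕ → ℝ) × (ℕ → ℝ) => total p.1 p.2 := by
  unfold total
  exact (Measurable.tsum fun j => by fun_prop).ennreal_toReal

lemma measurable_lse : Measurable fun p : (ℕ → ℝ) × (ℕ → ℝ) => lse p.1 p.2 :=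
  measurable_total.log

lemma measurable_lse_right (w : ℕ → ℝ) : Measurable (lse w) :=
  measurable_lse.comp measurable_prodMk_left

lemma measurable_tilt : Measurable fun p : (ℕ → ℝ) × (ℕ → ℝ) => tilt p.1 p.2 := by
  refine measurable_pi_lambda _ fun i => ?_
  exact Measurable.div (by fun_prop) measurable_total

/-- No summability is needed: for a divergent sum both sides take the default value 0. -/
lemma total_eq {w : ℕ → ℝ} (hw : ∀ i, 0 ≤ w i) (y : ℕ → ℝ) :
    total w y = ∑' j, w j * Real.exp (y j) := by
  unfold total
  rw [ENNReal.tsum_toReal_eq fun _ => ENNReal.ofReal_ne_top]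
  exact tsum_congr fun j => ENNReal.toReal_ofReal (mul_nonneg (hw j) (Real.exp_pos _).le)

lemma Good.mono {w y z : ℕ → ℝ} (hw : ∀ i, 0 ≤ w i) (h : Good w y) (hz : ∀ i, |z i| ≤ |y i|) :
    Good w z :=
  Summable.of_nonneg_of_le (fun i => mul_nonneg (hw i) (Real.exp_pos _).le)
    (fun i => mul_le_mul_of_nonneg_left (Real.exp_le_exp.2 (hz i)) (hw i)) h

lemma Good.neg {w y : ℕ → ℝ} (h : Good w y) : Good w fun i => -y i := by
  simpa [Good] using h

lemma Good.summable_exp {w y : ℕ → ℝ} (hw : ∀ i, 0 ≤ w i) (h : Good w y) :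
    Summable fun i => w i * Real.exp (y i) :=
  Summable.of_nonneg_of_le (fun i => mul_nonneg (hw i) (Real.exp_pos _).le)
    (fun i => mul_le_mul_of_nonneg_left (Real.exp_le_exp.2 (le_abs_self _)) (hw i)) h

lemma Good.summable_abs {w y : ℕ → ℝ} (hw : ∀ i, 0 ≤ w i) (h : Good w y) :
    Summable fun i => w i * |y i| :=
  Summable.of_nonneg_of_le (fun i => mul_nonneg (hw i) (abs_nonneg _))
    (fun i => mul_le_mul_of_nonneg_left
      (by linarith [Real.add_one_le_exp |y i|]) (hw i)) h

lemma Good.summable_mul {w y : ℕ → ℝ} (hw : ∀ i, 0 ≤ w i) (h : Good w y) :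
    Summable fun i => w i * y i := by
  refine Summable.of_abs ((h.summable_abs hw).congr fun i => ?_)
  rw [abs_mul, abs_of_nonneg (hw i)]

lemma IsWeight.exists_pos {w : ℕ → ℝ} (hw : IsWeight w) : ∃ i, 0 < w i := by
  by_contra! h
  have : w = 0 := funext fun i => le_antisymm (h i) (hw.nonneg i)
  have h1 := hw.hasSum.tsum_eq
  simp [this] at h1

lemma IsWeight.total_pos {w y : ℕ → ℝ} (hw : IsWeight w)
    (hy : Summable fun i => w i * Real.exp (y i)) : 0 < total w y := by
  obtain ⟨i, hi⟩ := hw.exists_pos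
  rw [total_eq hw.nonneg]
  exact hy.tsum_pos (fun j => mul_nonneg (hw.nonneg j) (Real.exp_pos _).le) i
    (mul_pos hi (Real.exp_pos _))

lemma IsWeight.exp_lse {w y : ℕ → ℝ} (hw : IsWeight w) (hy : Good w y) :
    Real.exp (lse w y) = ∑' i, w i * Real.exp (y i) := by
  rw [lse, Real.exp_log (hw.total_pos (hy.summable_exp hw.nonneg)), total_eq hw.nonneg]

lemma isWeight_tilt {w y : ℕ → ℝ} (hw : IsWeight w)
    (hy : Summable fun i => w i * Real.exp (y i)) : IsWeight (tilt w y) := by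
  have hpos := hw.total_pos hy
  refine ⟨fun i => div_nonneg (mul_nonneg (hw.nonneg i) (Real.exp_pos _).le) hpos.le, ?_⟩
  have h := hy.hasSum.div_const (total w y)
  rwa [← total_eq hw.nonneg, div_self hpos.ne'] at h

lemma tilt_tilt_summable {w y z : ℕ → ℝ}
    (hyz : Summable fun i => w i * Real.exp (y i + z i)) :
    Summable fun i => tilt w y i * Real.exp (z i) := by
  refine (hyz.div_const (total w y)).congr fun i => ?_
  rw [tilt, Real.exp_add]
  ring

/-- The cocycle identity behind all that follows: Z(y + z) factors as Z(y) times the partition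
function of z under the weights tilted by y. -/
lemma lse_add {w y z : ℕ → ℝ} (hw : IsWeight w)
    (hy : Summable fun i => w i * Real.exp (y i))
    (hyz : Summable fun i => w i * Real.exp (y i + z i)) :
    lse w (fun i => y i + z i) = lse w y + lse (tilt w y) z := by
  have hpos := hw.total_pos hy
  have ht := isWeight_tilt hw hy
  unfold lse
  rw [← Real.log_mul hpos.ne' (ht.total_pos (tilt_tilt_summable hyz)).ne']
  congr 1
  rw [total_eq hw.nonneg, total_eq ht.nonneg, ← tsum_mul_left]
  refine tsum_congr fun i => ?_
  rw [tilt, Real.exp_add]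
  field_simp

lemma lse_zero {w : ℕ → ℝ} (hw : IsWeight w) : lse w (fun _ => 0) = 0 := by
  rw [lse, total_eq hw.nonneg]
  simp [hw.hasSum.tsum_eq]

lemma good_zero {w : ℕ → ℝ} (hw : IsWeight w) : Good w (fun _ => 0) := by
  simpa [Good] using hw.hasSum.summable

lemma IsWeight.tsum_mul_le_lse {w y : ℕ → ℝ} (hw : IsWeight w) (hy : Good w y) :
    ∑' i, w i * y i ≤ lse w y := by
  have hs := hy.summable_exp hw.nonneg
  set m := ∑' i, w i * y i with hm
  rw [lse, Real.le_log_iff_exp_le (hw.total_pos hs), total_eq hw.nonneg]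
  -- Jensen through the tangent to exp at the mean m: the linear term averages to zero.
  have h1 : HasSum (fun i => Real.exp m * (w i + (w i * y i - m * w i))) (Real.exp m * 1) := by
    refine HasSum.mul_left _ ?_
    have h := hw.hasSum.add ((hy.summable_mul hw.nonneg).hasSum.sub (hw.hasSum.mul_left m))
    rwa [← hm, mul_one, sub_self, add_zero] at h
  rw [mul_one] at h1
  refine hasSum_le (fun i => ?_) h1 hs.hasSum
  have h2 := Real.add_one_le_exp (y i - m)
  have h3 : Real.exp (y i) = Real.exp m * Real.exp (y i - m) := by
    rw [← Real.exp_add]; congr 1; ring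
  rw [h3]
  have := mul_le_mul_of_nonneg_left (mul_le_mul_of_nonneg_left h2 (Real.exp_pos m).le) (hw.nonneg i)
  linarith

/-- Jensen for y and for -y: the two linear lower bounds cancel. So a very negative `lse w y` forces
a large `lse w (-y)`, which controls the lower tail. -/
lemma IsWeight.lse_add_lse_neg_nonneg {w y : ℕ → ℝ} (hw : IsWeight w) (hy : Good w y) :
    0 ≤ lse w y + lse w (fun i => -y i) := by
  have h1 := hw.tsum_mul_le_lse hy
  have h2 := hw.tsum_mul_le_lse hy.neg
  have h3 : ∑' i, w i * -y i = -∑' i, w i * y i := by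
    rw [← tsum_neg]; exact tsum_congr fun i => by ring
  linarith

lemma IsWeight.exp_abs_lse_le {w y : ℕ → ℝ} (hw : IsWeight w) (hy : Good w y) :
    Real.exp |lse w y| ≤ ∑' i, w i * Real.exp (y i) + ∑' i, w i * Real.exp (-y i) := by
  have h := hw.lse_add_lse_neg_nonneg hy
  rw [← hw.exp_lse hy, ← hw.exp_lse hy.neg]
  rcases abs_cases (lse w y) with ⟨h1, _⟩ | ⟨h1, _⟩ <;> rw [h1]
  · exact le_add_of_nonneg_right (Real.exp_pos _).le
  · exact (Real.exp_le_exp.2 (by linarith)).trans (le_add_of_nonneg_left (Real.exp_pos _).le)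

lemma total_comp (w y : ℕ → ℝ) {f : ℕ → ℕ} (hf : Function.Bijective f) :
    total (fun i => w (f i)) (fun i => y (f i)) = total w y := by
  unfold total
  rw [← (Equiv.ofBijective f hf).tsum_eq fun j => ENNReal.ofReal (w j * Real.exp (y j))]
  rfl

lemma lse_comp (w y : ℕ → ℝ) {f : ℕ → ℕ} (hf : Function.Bijective f) :
    lse (fun i => w (f i)) (fun i => y (f i)) = lse w y := by
  rw [lse, total_comp w y hf, lse]

lemma IsWeight.comp {w : ℕ → ℝ} (hw : IsWeight w) {f : ℕ → ℕ} (hf : Function.Bijective f) :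
    IsWeight fun i => w (f i) :=
  ⟨fun _ => hw.nonneg _, (Equiv.ofBijective f hf).hasSum_iff.2 hw.hasSum⟩

/-! ### The free energy of a gaussian field -/

/-- A correlation matrix: positive semi-definite with unit diagonal. -/
structure IsCorr (C : ℕ → ℕ → ℝ) : Prop where
  posSemidef : (Matrix.of C).PosSemidef
  diag : ∀ i, C i i = 1

/-- The law of the centered gaussian field with covariance `s C`. -/
abbrev field (C : ℕ → ℕ → ℝ) (s : ℝ) : Measure (ℕ → ℝ) := gaussField fun i j => s * C i j

/-- The mean of the log-sum-exp under the gaussian field of covariance `s C`. -/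
def free (C : ℕ → ℕ → ℝ) (w : ℕ → ℝ) (s : ℝ) : ℝ := ∫ y, lse w y ∂field C s

variable {C : ℕ → ℕ → ℝ} {w : ℕ → ℝ} {s s' : ℝ}

lemma IsCorr.comp (hC : IsCorr C) (f : ℕ → ℕ) : IsCorr fun i j => C (f i) (f j) :=
  ⟨posSemidef_comp hC.posSemidef f, fun _ => hC.diag _⟩

lemma ofReal_tsum_mul_exp {y : ℕ → ℝ} (hw : ∀ i, 0 ≤ w i)
    (hy : Summable fun i => w i * Real.exp (y i)) :
    ENNReal.ofReal (∑' i, w i * Real.exp (y i)) =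
      ∑' i, ENNReal.ofReal (w i * Real.exp (y i)) :=
  ENNReal.ofReal_tsum_of_nonneg (fun i => mul_nonneg (hw i) (Real.exp_pos _).le) hy

/-- The diagonal is constant, so every term has the same exponential moment and the weights sum out.
-/
lemma lintegral_tsum_exp (hC : IsCorr C) (hw : IsWeight w) (hs : 0 ≤ s) (b : ℝ) :
    ∫⁻ y, ∑' i, ENNReal.ofReal (w i * Real.exp (b * y i)) ∂field C s =
      ENNReal.ofReal (Real.exp (b ^ 2 * s / 2)) := by
  rw [lintegral_tsum fun i => Measurable.aemeasurable (by fun_prop)]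
  have h : ∀ i, ∫⁻ y, ENNReal.ofReal (w i * Real.exp (b * y i)) ∂field C s =
      ENNReal.ofReal (w i) * ENNReal.ofReal (Real.exp (b ^ 2 * s / 2)) := fun i => by
    simp_rw [ENNReal.ofReal_mul (hw.nonneg i)]
    rw [lintegral_const_mul _ (by fun_prop), lintegral_exp_gaussField
      (posSemidef_smul hC.posSemidef hs), hC.diag, mul_one]
  simp_rw [h]
  rw [ENNReal.tsum_mul_right, ← ENNReal.ofReal_tsum_of_nonneg hw.nonneg hw.hasSum.summable,
    hw.hasSum.tsum_eq, ENNReal.ofReal_one, one_mul]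

lemma summable_of_tsum_ofReal_ne_top {f : ℕ → ℝ} (hf : ∀ i, 0 ≤ f i)
    (h : ∑' i, ENNReal.ofReal (f i) ≠ ∞) : Summable f :=
  (ENNReal.summable_toReal h).congr fun i => ENNReal.toReal_ofReal (hf i)

lemma ae_summable_exp (hC : IsCorr C) (hw : IsWeight w) (hs : 0 ≤ s) (b : ℝ) :
    ∀ᵐ y ∂field C s, Summable fun i => w i * Real.exp (b * y i) := by
  have h := ae_lt_top (μ := field C s)
    (f := fun y => ∑' i, ENNReal.ofReal (w i * Real.exp (b * y i)))
    (Measurable.tsum fun i => by fun_prop)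
    (by rw [lintegral_tsum_exp hC hw hs b]; exact ENNReal.ofReal_ne_top)
  filter_upwards [h] with y hy
  exact summable_of_tsum_ofReal_ne_top (fun i => mul_nonneg (hw.nonneg i) (Real.exp_pos _).le) hy.ne

lemma ae_good_mul (hC : IsCorr C) (hw : IsWeight w) (hs : 0 ≤ s) (b : ℝ) :
    ∀ᵐ y ∂field C s, Good w fun i => b * y i := by
  filter_upwards [ae_summable_exp hC hw hs b, ae_summable_exp hC hw hs (-b)] with y h1 h2
  refine Summable.of_nonneg_of_le (fun i => mul_nonneg (hw.nonneg i) (Real.exp_pos _).le)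
    (fun i => ?_) (h1.add h2)
  rw [← mul_add]
  refine mul_le_mul_of_nonneg_left ?_ (hw.nonneg i)
  rcases abs_cases (b * y i) with ⟨h, _⟩ | ⟨h, _⟩ <;> rw [h]
  · exact le_add_of_nonneg_right (Real.exp_pos _).le
  · rw [← neg_mul]
    exact le_add_of_nonneg_left (Real.exp_pos _).le

lemma ae_good (hC : IsCorr C) (hw : IsWeight w) (hs : 0 ≤ s) : ∀ᵐ y ∂field C s, Good w y := by
  simpa using ae_good_mul hC hw hs 1

/-- The bound depends neither on the matrix nor on the weights. This uniformity is what survives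
tilting and yields concentration constants independent of the configuration. -/
lemma lintegral_exp_abs_lse_le (hC : IsCorr C) (hw : IsWeight w) (hs : 0 ≤ s) :
    ∫⁻ y, ENNReal.ofReal (Real.exp |lse w y|) ∂field C s ≤
      ENNReal.ofReal (2 * Real.exp (s / 2)) := by
  calc ∫⁻ y, ENNReal.ofReal (Real.exp |lse w y|) ∂field C s
      ≤ ∫⁻ y, (∑' i, ENNReal.ofReal (w i * Real.exp (1 * y i)) +
          ∑' i, ENNReal.ofReal (w i * Real.exp (-1 * y i))) ∂field C s := by
        refine lintegral_mono_ae ?_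
        filter_upwards [ae_good hC hw hs] with y hy
        simp only [one_mul, neg_mul]
        rw [← ofReal_tsum_mul_exp hw.nonneg (hy.summable_exp hw.nonneg),
          ← ofReal_tsum_mul_exp hw.nonneg (hy.neg.summable_exp hw.nonneg), ← ENNReal.ofReal_add
          (tsum_nonneg fun i => mul_nonneg (hw.nonneg i) (Real.exp_pos _).le)
          (tsum_nonneg fun i => mul_nonneg (hw.nonneg i) (Real.exp_pos _).le)]
        exact ENNReal.ofReal_le_ofReal (hw.exp_abs_lse_le hy)
    _ = _ := by
        rw [lintegral_add_left (Measurable.tsum fun i => by fun_prop),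
          lintegral_tsum_exp hC hw hs, lintegral_tsum_exp hC hw hs,
          ← ENNReal.ofReal_add (Real.exp_pos _).le (Real.exp_pos _).le]
        congr 1
        ring_nf

lemma integrable_of_lintegral_exp_abs {α : Type*} [MeasurableSpace α] {μ : Measure α} {f : α → ℝ}
    (hf : AEStronglyMeasurable f μ) (h : ∫⁻ x, ENNReal.ofReal (Real.exp |f x|) ∂μ ≠ ∞) :
    Integrable f μ := by
  refine ⟨hf, lt_of_le_of_lt (lintegral_mono fun x => ?_) (lt_top_iff_ne_top.2 h)⟩
  rw [← ofReal_norm, Real.norm_eq_abs]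
  exact ENNReal.ofReal_le_ofReal (by linarith [Real.add_one_le_exp |f x|])

lemma integrable_lse (hC : IsCorr C) (hw : IsWeight w) (hs : 0 ≤ s) :
    Integrable (lse w) (field C s) :=
  integrable_of_lintegral_exp_abs (measurable_lse_right w).aestronglyMeasurable
    ((lintegral_exp_abs_lse_le hC hw hs).trans_lt ENNReal.ofReal_lt_top).ne

lemma field_map_neg (hC : IsCorr C) (hs : 0 ≤ s) :
    (field C s).map (fun y i => -y i) = field C s := by
  have h := gaussField_map_smul (posSemidef_smul hC.posSemidef hs) (-1)
  simpa using h

/-- The field is symmetric, so twice the mean is the mean of `lse w y + lse w (-y)`. -/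
lemma free_nonneg (hC : IsCorr C) (hw : IsWeight w) (hs : 0 ≤ s) : 0 ≤ free C w s := by
  have hm : Measurable fun (y : ℕ → ℝ) i => -y i := by fun_prop
  have h1 : ∫ y, lse w (fun i => -y i) ∂field C s = free C w s := by
    conv_rhs => rw [free, ← field_map_neg hC hs]
    rw [integral_map hm.aemeasurable (measurable_lse_right w).aestronglyMeasurable]
  have h2 : Integrable (fun y => lse w (fun i => -y i)) (field C s) := by
    have := integrable_lse hC hw hs
    rw [← field_map_neg hC hs] at this
    exact this.comp_measurable hm
  have h3 : 0 ≤ ∫ y, (lse w y + lse w (fun i => -y i)) ∂field C s := by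
    refine integral_nonneg_of_ae ?_
    filter_upwards [ae_good hC hw hs] with y hy using hw.lse_add_lse_neg_nonneg hy
  rw [integral_add (integrable_lse hC hw hs) h2, h1] at h3
  unfold free at *
  linarith

lemma free_le (hC : IsCorr C) (hw : IsWeight w) (hs : 0 ≤ s) : free C w s ≤ s / 2 := by
  have hint : ∫⁻ y, ENNReal.ofReal (Real.exp (lse w y)) ∂field C s =
      ENNReal.ofReal (Real.exp (s / 2)) := by
    have h := lintegral_tsum_exp hC hw hs 1
    simp only [one_mul, one_pow] at h
    rw [← h]
    refine lintegral_congr_ae ?_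
    filter_upwards [ae_good hC hw hs] with y hy
    rw [hw.exp_lse hy, ofReal_tsum_mul_exp hw.nonneg (hy.summable_exp hw.nonneg)]
  have hm : Measurable fun y => Real.exp (lse w y) := (measurable_lse_right w).exp
  have hi : Integrable (fun y => Real.exp (lse w y)) (field C s) := by
    refine ⟨hm.aestronglyMeasurable, ?_⟩
    rw [hasFiniteIntegral_iff_ofReal (ae_of_all _ fun y => (Real.exp_pos _).le), hint]
    exact ENNReal.ofReal_lt_top
  have hv : ∫ y, Real.exp (lse w y) ∂field C s = Real.exp (s / 2) := by
    rw [integral_eq_lintegral_of_nonneg_ae (ae_of_all _ fun y => (Real.exp_pos _).le)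
      hm.aestronglyMeasurable, hint, ENNReal.toReal_ofReal (Real.exp_pos _).le]
  -- Jensen for the logarithm, through the tangent to exp at s/2, where e^{s/2} is the mean of the
  -- partition function.
  have h := integral_mono (integrable_lse hC hw hs)
    ((hi.const_mul (Real.exp (-(s / 2)))).add (integrable_const (s / 2 - 1))) fun y => by
      have := Real.add_one_le_exp (lse w y - s / 2)
      simp only [Pi.add_apply]
      rw [← Real.exp_add, show -(s / 2) + lse w y = lse w y - s / 2 by ring]
      linarith
  rw [integral_add' (hi.const_mul _) (integrable_const _), integral_const_mul, hv,
    ← Real.exp_add] at h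
  simpa [free] using h

lemma field_conv (hC : IsCorr C) (hs : 0 ≤ s) (hs' : 0 ≤ s') :
    ((field C s).prod (field C s')).map (fun p i => p.1 i + p.2 i) = field C (s + s') :=
  gaussField_conv hC.posSemidef hs hs'

lemma measurable_add_field :
    Measurable fun (p : (ℕ → ℝ) × (ℕ → ℝ)) i => p.1 i + p.2 i := by fun_prop

lemma ae_ae_good_add (hC : IsCorr C) (hw : IsWeight w) (hs : 0 ≤ s) (hs' : 0 ≤ s') :
    ∀ᵐ y ∂field C s, ∀ᵐ z ∂field C s', Good w fun i => y i + z i := by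
  have h := ae_good hC hw (add_nonneg hs hs')
  rw [← field_conv hC hs hs'] at h
  exact Measure.ae_ae_of_ae_prod (ae_of_ae_map measurable_add_field.aemeasurable h)

lemma ae_lse_add (hC : IsCorr C) (hw : IsWeight w) (hs : 0 ≤ s) (hs' : 0 ≤ s') :
    ∀ᵐ y ∂field C s, IsWeight (tilt w y) ∧ ∀ᵐ z ∂field C s',
      lse w (fun i => y i + z i) = lse w y + lse (tilt w y) z := by
  filter_upwards [ae_good hC hw hs, ae_ae_good_add hC hw hs hs'] with y hy h
  refine ⟨isWeight_tilt hw (hy.summable_exp hw.nonneg), ?_⟩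
  filter_upwards [h] with z hz
  exact lse_add hw (hy.summable_exp hw.nonneg) (hz.summable_exp hw.nonneg)

lemma integrable_lse_add (hC : IsCorr C) (hw : IsWeight w) (hs : 0 ≤ s) (hs' : 0 ≤ s') :
    Integrable (fun p : (ℕ → ℝ) × (ℕ → ℝ) => lse w fun i => p.1 i + p.2 i)
      ((field C s).prod (field C s')) := by
  have h := integrable_lse hC hw (add_nonneg hs hs')
  rw [← field_conv hC hs hs'] at h
  exact h.comp_measurable measurable_add_field

lemma free_add_eq (hC : IsCorr C) (hw : IsWeight w) (hs : 0 ≤ s) (hs' : 0 ≤ s') :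
    free C w (s + s') = ∫ y, ∫ z, lse w (fun i => y i + z i) ∂field C s' ∂field C s := by
  rw [free, ← field_conv hC hs hs', integral_map measurable_add_field.aemeasurable
    (measurable_lse_right w).aestronglyMeasurable, integral_prod _
    (integrable_lse_add hC hw hs hs')]

lemma ae_integral_lse_add (hC : IsCorr C) (hw : IsWeight w) (hs : 0 ≤ s) (hs' : 0 ≤ s') :
    ∀ᵐ y ∂field C s, ∫ z, lse w (fun i => y i + z i) ∂field C s' =
      lse w y + free C (tilt w y) s' := by
  filter_upwards [ae_lse_add hC hw hs hs'] with y hy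
  rw [integral_congr_ae hy.2, integral_add (integrable_const _) (integrable_lse hC hy.1 hs')]
  simp [free]

/-- By the cocycle this function is almost everywhere a partial integral minus `lse w`, which also
settles its measurability. -/
lemma integrable_free_tilt (hC : IsCorr C) (hw : IsWeight w) (hs : 0 ≤ s) (hs' : 0 ≤ s') :
    Integrable (fun y => free C (tilt w y) s') (field C s) := by
  have h := (integrable_lse_add hC hw hs hs').integral_prod_left.sub (integrable_lse hC hw hs)
  refine h.congr ?_
  filter_upwards [ae_integral_lse_add hC hw hs hs'] with y hy
  simp [hy]

/-- The mean of the cocycle identity. Averaged over a quasi-stationary law, the last term becomes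
the mean free energy at s'. -/
lemma free_add (hC : IsCorr C) (hw : IsWeight w) (hs : 0 ≤ s) (hs' : 0 ≤ s') :
    free C w (s + s') = free C w s + ∫ y, free C (tilt w y) s' ∂field C s := by
  rw [free_add_eq hC hw hs hs', integral_congr_ae (ae_integral_lse_add hC hw hs hs'),
    integral_add (integrable_lse hC hw hs) (integrable_free_tilt hC hw hs hs'), free]

lemma free_add_sub_mem (hC : IsCorr C) (hw : IsWeight w) (hs : 0 ≤ s) (hs' : 0 ≤ s') :
    free C w s ≤ free C w (s + s') ∧ free C w (s + s') ≤ free C w s + s' / 2 := by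
  rw [free_add hC hw hs hs']
  refine ⟨le_add_of_nonneg_right (integral_nonneg_of_ae ?_), add_le_add_right ?_ _⟩
  · filter_upwards [ae_lse_add hC hw hs hs'] with y hy using free_nonneg hC hy.1 hs'
  · have := integral_mono_ae (integrable_free_tilt hC hw hs hs') (integrable_const (s' / 2)) (by
      filter_upwards [ae_lse_add hC hw hs hs'] with y hy using free_le hC hy.1 hs')
    simpa using this

lemma free_mono (hC : IsCorr C) (hw : IsWeight w) (hs : 0 ≤ s) (h : s ≤ s') :
    free C w s ≤ free C w s' := by
  have := (free_add_sub_mem hC hw hs (sub_nonneg.2 h)).1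
  rwa [add_sub_cancel] at this

lemma free_comp (hC : IsCorr C) (hs : 0 ≤ s) {f : ℕ → ℕ} (hf : Function.Bijective f) :
    free (fun i j => C (f i) (f j)) (fun i => w (f i)) s = free C w s := by
  have hm : Measurable fun (y : ℕ → ℝ) i => y (f i) := by fun_prop
  have h := gaussField_map_comp (posSemidef_smul hC.posSemidef hs) f
  rw [free, field, ← h, integral_map hm.aemeasurable
    (measurable_lse_right _).aestronglyMeasurable, free]
  simp_rw [lse_comp w _ hf]

/-! ### Concentration of the log-sum-exp -/

variable {C : ℕ → ℕ → ℝ} {w : ℕ → ℝ} {a : ℝ}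

lemma ofReal_integral_le_lintegral {α : Type*} [MeasurableSpace α] {μ : Measure α} {f : α → ℝ}
    (hf : Integrable f μ) : ENNReal.ofReal (∫ x, f x ∂μ) ≤ ∫⁻ x, ENNReal.ofReal (f x) ∂μ := by
  calc ENNReal.ofReal (∫ x, f x ∂μ)
      ≤ ENNReal.ofReal (∫ x, max (f x) 0 ∂μ) :=
        ENNReal.ofReal_le_ofReal (integral_mono hf hf.pos_part fun x => le_max_left _ _)
    _ = ∫⁻ x, ENNReal.ofReal (max (f x) 0) ∂μ :=
        ofReal_integral_eq_lintegral_ofReal hf.pos_part (ae_of_all _ fun x => le_max_right _ _)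
    _ = _ := lintegral_congr fun x => by simp [ENNReal.ofReal_max]

/-- Jensen for exp, stated in `ℝ≥0∞` so that exp ∘ f need not be integrable. -/
lemma ofReal_exp_integral_le {α : Type*} [MeasurableSpace α] {μ : Measure α}
    [IsProbabilityMeasure μ] {f : α → ℝ} (hf : Integrable f μ) :
    ENNReal.ofReal (Real.exp (∫ x, f x ∂μ)) ≤ ∫⁻ x, ENNReal.ofReal (Real.exp (f x)) ∂μ := by
  set m := ∫ x, f x ∂μ with hm
  have hi : Integrable (fun x => Real.exp m * (f x - m + 1)) μ :=
    ((hf.sub (integrable_const m)).add (integrable_const 1)).const_mul _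
  have hv : ∫ x, Real.exp m * (f x - m + 1) ∂μ = Real.exp m := by
    have h1 : Integrable (fun x => f x - m) μ := hf.sub (integrable_const m)
    rw [integral_const_mul, integral_add h1 (integrable_const 1),
      integral_sub hf (integrable_const m)]
    simp [← hm]
  calc ENNReal.ofReal (Real.exp m)
      = ENNReal.ofReal (∫ x, Real.exp m * (f x - m + 1) ∂μ) := by rw [hv]
    _ ≤ ∫⁻ x, ENNReal.ofReal (Real.exp m * (f x - m + 1)) ∂μ := ofReal_integral_le_lintegral hi
    _ ≤ _ := lintegral_mono fun x => ENNReal.ofReal_le_ofReal (by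
        have h := mul_le_mul_of_nonneg_left (Real.add_one_le_exp (f x - m)) (Real.exp_pos m).le
        rwa [← Real.exp_add, add_sub_cancel] at h)

/-- Compare the power series from degree 2 on, where |t|^n ≤ t². -/
lemma exp_mul_le {t x : ℝ} (ht : |t| ≤ 1) :
    Real.exp (t * x) ≤ 1 + t * x + t ^ 2 * Real.exp |x| := by
  have hsum := NormedSpace.expSeries_div_hasSum_exp (t * x)
  have hsum' := NormedSpace.expSeries_div_hasSum_exp |x|
  rw [← Real.exp_eq_exp_ℝ] at hsum hsum'
  have h1 := (hasSum_nat_add_iff' 2).2 hsum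
  have h2 := ((hasSum_nat_add_iff' 2).2 hsum').mul_left (t ^ 2)
  have h := hasSum_le (fun n => ?_) h1 h2
  · simp only [Finset.sum_range_succ, Finset.sum_range_zero] at h
    simp at h
    nlinarith [mul_nonneg (sq_nonneg t) (abs_nonneg x), sq_nonneg t]
  · rw [← mul_div_assoc]
    refine div_le_div_of_nonneg_right ?_ (Nat.cast_nonneg _)
    refine (le_abs_self _).trans ?_
    rw [abs_pow, abs_mul, mul_pow, ← sq_abs t]
    refine mul_le_mul_of_nonneg_right ?_ (pow_nonneg (abs_nonneg _) _)
    exact pow_le_pow_of_le_one (abs_nonneg _) ht (by omega)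

/-- Centering kills the term of order t, so the mean is at most 1 + A t². -/
lemma lintegral_exp_mul_le {α : Type*} [MeasurableSpace α] {μ : Measure α}
    [IsProbabilityMeasure μ] {f : α → ℝ} (hf : Integrable f μ) (h0 : ∫ x, f x ∂μ = 0) {A t : ℝ}
    (hA0 : 0 ≤ A)
    (hA : ∫⁻ x, ENNReal.ofReal (Real.exp |f x|) ∂μ ≤ ENNReal.ofReal A) (ht : |t| ≤ 1) :
    ∫⁻ x, ENNReal.ofReal (Real.exp (t * f x)) ∂μ ≤ ENNReal.ofReal (Real.exp (A * t ^ 2)) := by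
  have hm : AEStronglyMeasurable (fun x => Real.exp |f x|) μ :=
    Real.continuous_exp.comp_aestronglyMeasurable hf.1.norm
  have hi : Integrable (fun x => Real.exp |f x|) μ := by
    refine ⟨hm, ?_⟩
    rw [hasFiniteIntegral_iff_ofReal (ae_of_all _ fun y => (Real.exp_pos _).le)]
    exact hA.trans_lt ENNReal.ofReal_lt_top
  have hv : ∫ x, Real.exp |f x| ∂μ ≤ A := by
    rw [integral_eq_lintegral_of_nonneg_ae (ae_of_all _ fun y => (Real.exp_pos _).le) hm]
    exact ENNReal.toReal_le_of_le_ofReal hA0 hA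
  have hi2 : Integrable (fun x => 1 + t * f x + t ^ 2 * Real.exp |f x|) μ :=
    ((integrable_const 1).add (hf.const_mul t)).add (hi.const_mul _)
  have hnn : ∀ x, 0 ≤ 1 + t * f x + t ^ 2 * Real.exp |f x| := fun x =>
    (Real.exp_pos _).le.trans (exp_mul_le ht)
  calc ∫⁻ x, ENNReal.ofReal (Real.exp (t * f x)) ∂μ
      ≤ ∫⁻ x, ENNReal.ofReal (1 + t * f x + t ^ 2 * Real.exp |f x|) ∂μ :=
        lintegral_mono fun x => ENNReal.ofReal_le_ofReal (exp_mul_le ht)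
    _ = ENNReal.ofReal (∫ x, (1 + t * f x + t ^ 2 * Real.exp |f x|) ∂μ) :=
        (ofReal_integral_eq_lintegral_ofReal hi2 (ae_of_all _ hnn)).symm
    _ ≤ _ := by
        refine ENNReal.ofReal_le_ofReal ?_
        have h1 : Integrable (fun x => 1 + t * f x) μ := (integrable_const 1).add (hf.const_mul t)
        rw [integral_add h1 (hi.const_mul _),
          integral_add (integrable_const 1) (hf.const_mul t), integral_const_mul,
          integral_const_mul, h0]
        simp only [integral_const, probReal_univ, smul_eq_mul, mul_one, mul_zero, add_zero]
        have := Real.add_one_le_exp (A * t ^ 2)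
        nlinarith [mul_le_mul_of_nonneg_left hv (sq_nonneg t)]

lemma measurable_integral_prod {α β : Type*} [MeasurableSpace α] [MeasurableSpace β]
    {μ : Measure β} [SFinite μ] {f : α → β → ℝ} (hf : Measurable (Function.uncurry f)) :
    Measurable fun x => ∫ y, f x y ∂μ :=
  (hf.stronglyMeasurable.integral_prod_right).measurable

/-- The increment of the conditional mean of the log-sum-exp when one step of the field is
revealed. -/
def revealed (C : ℕ → ℕ → ℝ) (w : ℕ → ℝ) (a s : ℝ) (y : ℕ → ℝ) : ℝ :=
  lse w y + free C (tilt w y) s - free C w (a + s)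

lemma integrable_revealed (hC : IsCorr C) (hw : IsWeight w) (ha : 0 ≤ a) {s : ℝ} (hs : 0 ≤ s) :
    Integrable (revealed C w a s) (field C a) :=
  ((integrable_lse hC hw ha).add (integrable_free_tilt hC hw ha hs)).sub (integrable_const _)

lemma integral_revealed (hC : IsCorr C) (hw : IsWeight w) (ha : 0 ≤ a) {s : ℝ} (hs : 0 ≤ s) :
    ∫ y, revealed C w a s y ∂field C a = 0 := by
  have h : Integrable (fun y => lse w y + free C (tilt w y) s) (field C a) :=
    (integrable_lse hC hw ha).add (integrable_free_tilt hC hw ha hs)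
  unfold revealed
  rw [integral_sub h (integrable_const _), integral_add (integrable_lse hC hw ha)
    (integrable_free_tilt hC hw ha hs), free_add hC hw ha hs]
  simp [free]

/-- Reveal the parts in the other order: up to a constant, the increment is the average over z of
`lse (tilt w z) y`. The variance of y is only a, so each of these has exponential moments bounded
uniformly in z and s. Jensen carries the bound over to the average. -/
lemma lintegral_exp_abs_revealed_le (hC : IsCorr C) (hw : IsWeight w) (ha : 0 ≤ a) {s : ℝ}
    (hs : 0 ≤ s) :
    ∫⁻ y, ENNReal.ofReal (Real.exp |revealed C w a s y|) ∂field C a ≤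
      ENNReal.ofReal (2 * Real.exp a) := by
  have hswap : ∀ᵐ p ∂(field C a).prod (field C s),
      lse w (fun i => p.1 i + p.2 i) = lse w p.2 + lse (tilt w p.2) p.1 := by
    have h1 := ae_good hC hw (add_nonneg ha hs)
    rw [← field_conv hC ha hs] at h1
    have h1 := ae_of_ae_map measurable_add_field.aemeasurable h1
    have h2 : ∀ᵐ p ∂(field C a).prod (field C s), Good w p.2 :=
      Measure.quasiMeasurePreserving_snd.ae (ae_good hC hw hs)
    filter_upwards [h1, h2] with p h1 h2
    simp_rw [add_comm (p.1 _)] at h1 ⊢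
    exact lse_add hw (h2.summable_exp hw.nonneg) (h1.summable_exp hw.nonneg)
  have hint : Integrable (fun p : (ℕ → ℝ) × (ℕ → ℝ) => lse (tilt w p.2) p.1)
      ((field C a).prod (field C s)) := by
    refine ((integrable_lse_add hC hw ha hs).sub
      ((integrable_lse hC hw hs).comp_snd (field C a))).congr ?_
    filter_upwards [hswap] with p hp
    simp [hp]
  have key : ∀ᵐ y ∂field C a, ENNReal.ofReal (Real.exp |revealed C w a s y|) ≤
      ENNReal.ofReal (Real.exp (a / 2)) *
        ∫⁻ z, ENNReal.ofReal (Real.exp |lse (tilt w z) y|) ∂field C s := by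
    filter_upwards [ae_integral_lse_add hC hw ha hs, Measure.ae_ae_of_ae_prod hswap,
      hint.prod_right_ae] with y h1 h2 h3
    have h4 : revealed C w a s y = ∫ z, lse (tilt w z) y ∂field C s -
        (free C w (a + s) - free C w s) := by
      rw [revealed, ← h1, integral_congr_ae h2, integral_add (integrable_lse hC hw hs) h3, free,
        free]
      ring
    have h5 := free_add_sub_mem hC hw hs ha
    rw [add_comm s a] at h5
    -- The subtracted constant `free C w (a + s) - free C w s` lies in [0, a/2].
    have h6 : |revealed C w a s y| ≤ a / 2 + ∫ z, |lse (tilt w z) y| ∂field C s := by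
      rw [h4]
      refine (abs_sub _ _).trans ?_
      rw [add_comm]
      refine add_le_add ?_ (abs_integral_le_integral_abs ..)
      rw [abs_of_nonneg (by linarith)]
      linarith
    calc ENNReal.ofReal (Real.exp |revealed C w a s y|)
        ≤ ENNReal.ofReal (Real.exp (a / 2 + ∫ z, |lse (tilt w z) y| ∂field C s)) :=
          ENNReal.ofReal_le_ofReal (Real.exp_le_exp.2 h6)
      _ = ENNReal.ofReal (Real.exp (a / 2)) *
          ENNReal.ofReal (Real.exp (∫ z, |lse (tilt w z) y| ∂field C s)) := by
          rw [Real.exp_add, ENNReal.ofReal_mul (Real.exp_pos _).le]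
      _ ≤ _ := by gcongr; exact ofReal_exp_integral_le h3.abs
  have hmeas : Measurable fun p : (ℕ → ℝ) × (ℕ → ℝ) =>
      ENNReal.ofReal (Real.exp |lse (tilt w p.2) p.1|) := by
    have ht : Measurable fun p : (ℕ → ℝ) × (ℕ → ℝ) => tilt w p.2 :=
      measurable_tilt.comp (measurable_const.prodMk measurable_snd)
    exact ((continuous_abs.measurable.comp
      (measurable_lse.comp (ht.prodMk measurable_fst))).exp).ennreal_ofReal
  refine (lintegral_mono_ae key).trans ?_
  rw [lintegral_const_mul _ hmeas.lintegral_prod_right', lintegral_lintegral_swap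
    hmeas.aemeasurable]
  have h7 : ∫⁻ z, ∫⁻ y, ENNReal.ofReal (Real.exp |lse (tilt w z) y|) ∂field C a ∂field C s ≤
      ENNReal.ofReal (2 * Real.exp (a / 2)) := by
    refine (lintegral_mono_ae (g := fun _ => ENNReal.ofReal (2 * Real.exp (a / 2))) ?_).trans
      (by simp)
    filter_upwards [ae_good hC hw hs] with z hz
    exact lintegral_exp_abs_lse_le hC (isWeight_tilt hw (hz.summable_exp hw.nonneg)) ha
  refine (mul_le_mul_right h7 _).trans_eq ?_
  rw [← ENNReal.ofReal_mul (Real.exp_pos _).le]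
  congr 1
  rw [mul_left_comm, ← Real.exp_add]
  ring_nf

/-- Exponential moments of the centered log-sum-exp: it is a sum of `n` conditionally centered
increments with bounded exponential moments. -/
lemma lintegral_exp_lse_sub_le (hC : IsCorr C) (ha : 0 ≤ a) {t : ℝ} (ht : |t| ≤ 1) (n : ℕ)
    (hw : IsWeight w) :
    ∫⁻ y, ENNReal.ofReal (Real.exp (t * (lse w y - free C w (n * a)))) ∂field C (n * a) ≤
      ENNReal.ofReal (Real.exp (2 * Real.exp a * t ^ 2 * n)) := by
  induction n generalizing w with
  | zero =>
    have h0 : free C w 0 = 0 :=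
      le_antisymm (by simpa using free_le hC hw le_rfl) (free_nonneg hC hw le_rfl)
    have h1 : ∀ᵐ y ∂field C 0, lse w y = 0 := by
      -- The field of variance zero is concentrated at 0.
      have h : field C 0 = (field C 0).map (fun y i => 0 * y i) := by
        rw [field, gaussField_map_smul (posSemidef_smul hC.posSemidef le_rfl) 0]
        simp
      rw [h, ae_map_iff (Measurable.aemeasurable (by fun_prop))
        (measurableSet_eq_fun (measurable_lse_right w) measurable_const)]
      exact ae_of_all _ fun y => by simp [lse_zero hw]
    simp only [Nat.cast_zero, zero_mul, h0, sub_zero, mul_zero, Real.exp_zero]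
    rw [lintegral_congr_ae (g := fun _ => 1)]
    · simp
    · filter_upwards [h1] with y hy
      simp [hy]
  | succ n ih =>
    have hn : 0 ≤ n * a := mul_nonneg (Nat.cast_nonneg _) ha
    have e : ((n + 1 : ℕ) : ℝ) * a = a + n * a := by push_cast; ring
    have hm : Measurable fun y => ENNReal.ofReal
        (Real.exp (t * (lse w y - free C w (a + n * a)))) :=
      ((((measurable_lse_right w).sub_const _).const_mul t).exp).ennreal_ofReal
    rw [e, ← field_conv hC ha hn, lintegral_map hm measurable_add_field]
    refine (lintegral_prod _ (hm.comp measurable_add_field).aemeasurable).trans_le ?_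
    -- Given the first part y, what remains is the centered log-sum-exp of n steps under the weights
    -- `tilt w y`. The induction hypothesis applies to them because w is generalized.
    calc _ ≤ ∫⁻ y, ENNReal.ofReal (Real.exp (t * revealed C w a (n * a) y)) *
          ENNReal.ofReal (Real.exp (2 * Real.exp a * t ^ 2 * n)) ∂field C a := by
          refine lintegral_mono_ae ?_
          filter_upwards [ae_lse_add hC hw ha hn] with y ⟨hy, hyz⟩
          refine le_trans (le_of_eq ?_) (mul_le_mul_right (ih hy) _)
          rw [← lintegral_const_mul _ ((((measurable_lse_right _).sub_const _).const_mul
            t).exp).ennreal_ofReal]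
          refine lintegral_congr_ae ?_
          filter_upwards [hyz] with z hz
          dsimp only [Function.comp_apply]
          rw [hz, ← ENNReal.ofReal_mul (Real.exp_pos _).le, ← Real.exp_add, revealed]
          congr 2
          ring
      _ = (∫⁻ y, ENNReal.ofReal (Real.exp (t * revealed C w a (n * a) y)) ∂field C a) *
          ENNReal.ofReal (Real.exp (2 * Real.exp a * t ^ 2 * n)) :=
          lintegral_mul_const' _ _ ENNReal.ofReal_ne_top
      _ ≤ ENNReal.ofReal (Real.exp (2 * Real.exp a * t ^ 2)) *
          ENNReal.ofReal (Real.exp (2 * Real.exp a * t ^ 2 * n)) := by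
          gcongr
          exact lintegral_exp_mul_le (integrable_revealed hC hw ha hn)
            (integral_revealed hC hw ha hn) (by positivity)
            (lintegral_exp_abs_revealed_le hC hw ha hn) ht
      _ = _ := by
          rw [← ENNReal.ofReal_mul (Real.exp_pos _).le, ← Real.exp_add]
          congr 2
          push_cast
          ring

lemma measure_le_of_lintegral_exp {α : Type*} [MeasurableSpace α] {μ : Measure α} {f : α → ℝ}
    (hf : Measurable f) {K u : ℝ}
    (h : ∫⁻ x, ENNReal.ofReal (Real.exp (f x)) ∂μ ≤ ENNReal.ofReal (Real.exp K)) :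
    μ {x | u ≤ f x} ≤ ENNReal.ofReal (Real.exp (K - u)) := by
  have h1 := mul_meas_ge_le_lintegral (μ := μ) (f := fun x => ENNReal.ofReal (Real.exp (f x)))
    hf.exp.ennreal_ofReal (ENNReal.ofReal (Real.exp u))
  have h2 : {x | ENNReal.ofReal (Real.exp u) ≤ ENNReal.ofReal (Real.exp (f x))} =
      {x | u ≤ f x} := by
    ext x
    simp [ENNReal.ofReal_le_ofReal_iff (Real.exp_pos _).le]
  rw [h2] at h1
  have h3 := h1.trans h
  rw [Real.exp_sub, ENNReal.ofReal_div_of_pos (Real.exp_pos _),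
    ENNReal.le_div_iff_mul_le (by simp [Real.exp_pos]) (by simp), mul_comm]
  exact h3

/-- Concentration of the log-sum-exp around its mean. -/
lemma exists_concentration (ha : 0 ≤ a) {d : ℝ} (hd : 0 < d) :
    ∃ c > 0, ∀ (C : ℕ → ℕ → ℝ) (w : ℕ → ℝ), IsCorr C → IsWeight w → ∀ n : ℕ,
      field C (n * a) {y | d * n ≤ |lse w y - free C w (n * a)|} ≤
        ENNReal.ofReal (2 * Real.exp (-(c * n))) := by
  set A := 2 * Real.exp a with hA
  have hApos : 0 < A := by positivity
  -- Chernoff parameter: A t² ≤ t d / 2, so A t² n - t d n leaves the decay -(t d / 2) n.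
  set t := min 1 (d / (2 * A)) with ht
  have htpos : 0 < t := lt_min one_pos (by positivity)
  have ht1 : |t| ≤ 1 := by rw [abs_of_pos htpos]; exact min_le_left _ _
  have htA : A * t ≤ d / 2 := by
    calc A * t ≤ A * (d / (2 * A)) := by gcongr; exact min_le_right _ _
      _ = d / 2 := by field_simp
  refine ⟨t * d / 2, by positivity, fun C w hC hw n => ?_⟩
  have hbound : A * t ^ 2 * n - t * d * n ≤ -(t * d / 2 * n) := by
    have : A * t * (t * n) ≤ d / 2 * (t * n) := by gcongr
    nlinarith
  have h1 := measure_le_of_lintegral_exp (u := t * d * n) (by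
    exact ((measurable_lse_right w).sub_const _).const_mul t)
    (lintegral_exp_lse_sub_le hC ha ht1 n hw)
  have h2 := measure_le_of_lintegral_exp (u := t * d * n) (by
    exact ((measurable_lse_right w).sub_const _).const_mul (-t))
    (lintegral_exp_lse_sub_le hC ha (t := -t) (by rwa [abs_neg]) n hw)
  rw [neg_sq] at h2
  have hsub : {y | d * n ≤ |lse w y - free C w (n * a)|} ⊆
      {y | t * d * n ≤ t * (lse w y - free C w (n * a))} ∪
        {y | t * d * n ≤ -t * (lse w y - free C w (n * a))} := by
    intro y hy
    simp only [Set.mem_ofPred_eq, Set.mem_union] at hy ⊢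
    rcases le_abs.1 hy with h | h
    · left; rw [mul_assoc]; gcongr
    · right; rw [neg_mul, ← mul_neg, mul_assoc]; gcongr
  refine (measure_mono hsub).trans ((measure_union_le _ _).trans ((add_le_add h1 h2).trans ?_))
  rw [← ENNReal.ofReal_add (Real.exp_pos _).le (Real.exp_pos _).le, ← two_mul]
  exact ENNReal.ofReal_le_ofReal (by gcongr)

/-! ### Almost sure convergence of the averages of a stationary sequence -/

section Birkhoff

variable {α : Type*} [MeasurableSpace α] {μ : Measure α} {T : α → α} {f g : α → ℝ}

/-- The running maximum `max_{k ≤ n} ∑_{j < k} g (T^j x)`. -/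
def maxSum (T : α → α) (g : α → ℝ) : ℕ → α → ℝ
  | 0 => fun _ => 0
  | n + 1 => fun x => max 0 (g x + maxSum T g n (T x))

omit [MeasurableSpace α] in
lemma maxSum_nonneg (n : ℕ) (x : α) : 0 ≤ maxSum T g n x := by
  cases n with
  | zero => exact le_rfl
  | succ n => exact le_max_left _ _

omit [MeasurableSpace α] in
lemma maxSum_le_succ (n : ℕ) (x : α) : maxSum T g n x ≤ maxSum T g (n + 1) x := by
  induction n generalizing x with
  | zero => exact le_max_left _ _
  | succ n ih =>
    rw [maxSum, maxSum.eq_2 T g (n + 1)]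
    exact max_le_max le_rfl (add_le_add le_rfl (ih _))

omit [MeasurableSpace α] in
lemma birkhoffSum_le_maxSum (n : ℕ) (x : α) : birkhoffSum T g n x ≤ maxSum T g n x := by
  induction n generalizing x with
  | zero => simp [maxSum]
  | succ n ih =>
    rw [birkhoffSum_succ', maxSum]
    exact (add_le_add le_rfl (ih _)).trans (le_max_right _ _)

lemma integrable_maxSum (hT : MeasurePreserving T μ μ) (hg : Integrable g μ) (n : ℕ) :
    Integrable (maxSum T g n) μ := by
  induction n with
  | zero => exact integrable_zero _ _ _
  | succ n ih =>
    have h : Integrable (fun x => g x + maxSum T g n (T x)) μ :=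
      hg.add (hT.integrable_comp_of_integrable ih)
    exact (integrable_zero _ _ _).sup h

/-- The maximal ergodic theorem, when the sums become positive almost everywhere. -/
lemma integral_nonneg_of_birkhoffSum_pos (hT : MeasurePreserving T μ μ) (hg : Integrable g μ)
    (hgm : Measurable g) (hpos : ∀ᵐ x ∂μ, ∃ n, 0 < birkhoffSum T g n x) : 0 ≤ ∫ x, g x ∂μ := by
  have hmeas : ∀ n, Measurable (maxSum T g n) := by
    intro n
    induction n with
    | zero => exact measurable_const
    | succ n ih => exact measurable_const.max (hgm.add (ih.comp hT.measurable))
  set A : ℕ → Set α := fun n => {x | 0 < maxSum T g n x} with hA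
  have hAm : ∀ n, MeasurableSet (A n) := fun n => measurableSet_lt measurable_const (hmeas n)
  have hmono : Monotone A := monotone_nat_of_le_succ fun n x hx =>
    lt_of_lt_of_le (show 0 < maxSum T g n x from hx) (maxSum_le_succ n x)
  have hstep : ∀ n, 0 ≤ ∫ x in A (n + 1), g x ∂μ := by
    intro n
    have hi1 := integrable_maxSum hT hg (n + 1)
    have hi2 : Integrable (fun x => maxSum T g n (T x)) μ :=
      hT.integrable_comp_of_integrable (integrable_maxSum hT hg n)
    -- Garsia's argument: where the running maximum is positive, g is its value minus the previous
    -- maximum at `T x`. Integrated over the whole space, that difference is nonnegative by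
    -- invariance and monotonicity.
    have e1 : ∫ x in A (n + 1), g x ∂μ =
        ∫ x in A (n + 1), (maxSum T g (n + 1) x - maxSum T g n (T x)) ∂μ := by
      refine setIntegral_congr_fun (hAm _) fun x hx => ?_
      have hx : 0 < maxSum T g (n + 1) x := hx
      have h2 : maxSum T g (n + 1) x = g x + maxSum T g n (T x) := by
        rw [maxSum] at hx ⊢
        rcases lt_max_iff.1 hx with h | h
        · exact absurd h (lt_irrefl _)
        · exact max_eq_right h.le
      rw [h2, add_sub_cancel_right]
    rw [e1, integral_sub hi1.integrableOn hi2.integrableOn]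
    have h3 : ∫ x in A (n + 1), maxSum T g (n + 1) x ∂μ = ∫ x, maxSum T g (n + 1) x ∂μ := by
      refine setIntegral_eq_integral_of_forall_compl_eq_zero fun x hx => ?_
      exact le_antisymm (not_lt.1 hx) (maxSum_nonneg _ _)
    have h4 : ∫ x in A (n + 1), maxSum T g n (T x) ∂μ ≤ ∫ x, maxSum T g n (T x) ∂μ :=
      setIntegral_le_integral hi2 (ae_of_all _ fun x => maxSum_nonneg _ _)
    have h5 : ∫ x, maxSum T g n (T x) ∂μ = ∫ x, maxSum T g n x ∂μ := by
      conv_rhs => rw [← hT.map_eq]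
      rw [integral_map hT.measurable.aemeasurable (hmeas n).aestronglyMeasurable]
    have h6 : ∫ x, maxSum T g n x ∂μ ≤ ∫ x, maxSum T g (n + 1) x ∂μ :=
      integral_mono (integrable_maxSum hT hg n) hi1 (maxSum_le_succ n)
    linarith
  have hlim := tendsto_setIntegral_of_monotone hAm hmono hg.integrableOn
  have hU : ∫ x in ⋃ n, A n, g x ∂μ = ∫ x, g x ∂μ := by
    rw [← setIntegral_univ (μ := μ)]
    refine setIntegral_congr_set ?_
    filter_upwards [hpos] with x ⟨n, hn⟩
    refine propext ⟨fun _ => trivial, fun _ => ?_⟩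
    exact Set.mem_iUnion.2 ⟨n, hn.trans_le (birkhoffSum_le_maxSum n x)⟩
  rw [hU] at hlim
  exact ge_of_tendsto (hlim.comp (tendsto_add_atTop_nat 1)) (Eventually.of_forall hstep)

/-- The points whose averages are frequently below some level less than `a`. -/
def lowSet (T : α → α) (f : α → ℝ) (a : ℝ) : Set α :=
  {x | ∃ q : ℚ, (q : ℝ) < a ∧ ∃ᶠ n : ℕ in atTop, birkhoffSum T f n x ≤ q * n}

lemma measurable_birkhoffSum (hT : Measurable T) (hf : Measurable f) (n : ℕ) :
    Measurable (birkhoffSum T f n) :=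
  Finset.measurable_fun_sum _ fun k _ => hf.comp (hT.iterate k)

lemma measurableSet_lowSet (hT : Measurable T) (hf : Measurable f) (a : ℝ) :
    MeasurableSet (lowSet T f a) := by
  refine measurableSet_setOfPred.2 (Measurable.exists fun q => Measurable.and measurable_const ?_)
  simp_rw [frequently_atTop]
  refine Measurable.forall fun N => Measurable.exists fun n => Measurable.and measurable_const ?_
  exact measurableSet_setOfPred.1
    (measurableSet_le (measurable_birkhoffSum hT hf n) measurable_const)

omit [MeasurableSpace α] in
-- A shift changes the sum by f x and the time by one. The strict inequality q < a leaves room to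
-- absorb both in a slightly larger rational level.
lemma preimage_lowSet (a : ℝ) : T ⁻¹' lowSet T f a = lowSet T f a := by
  have hshift : ∀ p : ℕ → Prop, (∃ᶠ n in atTop, p (n + 1)) ↔ ∃ᶠ n in atTop, p n := by
    intro p
    conv_rhs => rw [← map_add_atTop_eq_nat 1, frequently_map]
  have key : ∀ {p q c : ℝ} {u v : ℕ → ℝ}, p < q → (∀ n, u n ≤ v n + c) →
      (∃ᶠ n : ℕ in atTop, v n ≤ p * n) → ∃ᶠ n : ℕ in atTop, u n ≤ q * n := by
    intro p q c u v hpq huv h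
    have h1 : ∀ᶠ n : ℕ in atTop, c ≤ (q - p) * n :=
      (tendsto_natCast_atTop_atTop.const_mul_atTop (sub_pos.2 hpq)).eventually_ge_atTop c
    refine (h.and_eventually h1).mono fun n hn => ?_
    linarith [huv n, hn.1, hn.2]
  ext x
  simp only [Set.mem_preimage, lowSet, Set.mem_ofPred_eq]
  constructor
  · rintro ⟨q, hq, h⟩
    obtain ⟨q', h1, h2⟩ := exists_rat_btwn hq
    refine ⟨q', h2, (hshift _).1 ?_⟩
    have := key (c := f x - q') (u := fun n => birkhoffSum T f (n + 1) x - q') h1 (fun n => by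
      rw [birkhoffSum_succ']; linarith) h
    refine this.mono fun n hn => ?_
    push_cast
    linarith
  · rintro ⟨q, hq, h⟩
    obtain ⟨q', h1, h2⟩ := exists_rat_btwn hq
    refine ⟨q', h2, ?_⟩
    refine key (c := q - f x) (v := fun n => birkhoffSum T f (n + 1) x - q) h1 (fun n => by
      rw [birkhoffSum_succ']; linarith) (((hshift _).2 h).mono fun n hn => ?_)
    push_cast at hn
    linarith

omit [MeasurableSpace α] in
lemma birkhoffSum_const_sub (c : ℝ) (n : ℕ) (x : α) :
    birkhoffSum T (fun x => c - f x) n x = n * c - birkhoffSum T f n x := by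
  simp [birkhoffSum, Finset.sum_sub_distrib]

omit [MeasurableSpace α] in
lemma exists_lt_of_mem_lowSet {a : ℝ} {x : α} (hx : x ∈ lowSet T f a) :
    ∃ n : ℕ, birkhoffSum T f n x < n * a := by
  obtain ⟨q, hq, h⟩ := hx
  obtain ⟨n, hn, hn0⟩ := (h.and_eventually (eventually_gt_atTop 0)).exists
  refine ⟨n, hn.trans_lt ?_⟩
  rw [mul_comm]
  have : (0 : ℝ) < n := by exact_mod_cast hn0
  gcongr

/-- The maximal ergodic theorem for a - f on the invariant set E, where some partial sum of a - f is
positive at every point. -/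
lemma setIntegral_le_of_subset_lowSet [IsFiniteMeasure μ] (hT : MeasurePreserving T μ μ)
    (hf : Integrable f μ) (hfm : Measurable f) {E : Set α} (hE : MeasurableSet E)
    (hTE : T ⁻¹' E = E) {a : ℝ} (hsub : E ⊆ lowSet T f a) :
    ∫ x in E, f x ∂μ ≤ μ.real E * a := by
  have hT' : MeasurePreserving T (μ.restrict E) (μ.restrict E) := by
    have := hT.restrict_preimage hE
    rwa [hTE] at this
  have h := integral_nonneg_of_birkhoffSum_pos hT' (g := fun x => a - f x)
    ((integrable_const a).sub hf.integrableOn) (measurable_const.sub hfm) (by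
      filter_upwards [ae_restrict_mem hE] with x hx
      obtain ⟨n, hn⟩ := exists_lt_of_mem_lowSet (hsub hx)
      exact ⟨n, by rw [birkhoffSum_const_sub]; linarith⟩)
  rw [integral_sub (integrable_const a) hf.integrableOn] at h
  simp at h
  linarith

omit [MeasurableSpace α] in
lemma birkhoffSum_neg' (n : ℕ) (x : α) :
    birkhoffSum T (fun x => -f x) n x = -birkhoffSum T f n x := by
  simp [birkhoffSum]

/-- On this invariant set the integral of f is at most a and at least b times its measure, which is
therefore zero. -/
lemma ae_notMem_lowSet_inter [IsFiniteMeasure μ] (hT : MeasurePreserving T μ μ)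
    (hf : Integrable f μ) (hfm : Measurable f) {a b : ℝ} (hab : a < b) :
    ∀ᵐ x ∂μ, x ∉ lowSet T f a ∩ lowSet T (fun x => -f x) (-b) := by
  set E := lowSet T f a ∩ lowSet T (fun x => -f x) (-b) with hE
  have hEm : MeasurableSet E := (measurableSet_lowSet hT.measurable hfm a).inter
    (measurableSet_lowSet hT.measurable hfm.neg (-b))
  have hTE : T ⁻¹' E = E := by
    rw [hE, Set.preimage_inter, preimage_lowSet, preimage_lowSet]
  have h1 := setIntegral_le_of_subset_lowSet hT hf hfm hEm hTE Set.inter_subset_left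
  have h2 := setIntegral_le_of_subset_lowSet hT hf.neg hfm.neg hEm hTE Set.inter_subset_right
  simp only [Pi.neg_apply] at h2
  rw [integral_neg] at h2
  have h3 : μ.real E = 0 := by
    have := measureReal_nonneg (μ := μ) (s := E)
    nlinarith
  rw [measureReal_eq_zero_iff] at h3
  exact measure_eq_zero_iff_ae_notMem.1 h3

/-- If the averages had lower limit -∞ on a set of positive measure, the integral of f over it would
be below every multiple of that measure. -/
lemma ae_exists_notMem_lowSet [IsFiniteMeasure μ] (hT : MeasurePreserving T μ μ)
    (hf : Integrable f μ) (hfm : Measurable f) :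
    ∀ᵐ x ∂μ, ∃ k : ℕ, x ∉ lowSet T f (-k) := by
  set E := ⋂ k : ℕ, lowSet T f (-k) with hE
  have hEm : MeasurableSet E :=
    MeasurableSet.iInter fun k => measurableSet_lowSet hT.measurable hfm _
  have hTE : T ⁻¹' E = E := by
    rw [hE, Set.preimage_iInter]
    exact Set.iInter_congr fun k => preimage_lowSet _
  have h3 : μ.real E = 0 := by
    by_contra hne
    have hpos : 0 < μ.real E := lt_of_le_of_ne measureReal_nonneg (Ne.symm hne)
    obtain ⟨k, hk⟩ := exists_nat_gt (-(∫ x in E, f x ∂μ) / μ.real E)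
    have h1 := setIntegral_le_of_subset_lowSet hT hf hfm hEm hTE (Set.iInter_subset _ k)
    rw [div_lt_iff₀ hpos] at hk
    linarith
  rw [measureReal_eq_zero_iff] at h3
  filter_upwards [measure_eq_zero_iff_ae_notMem.1 h3] with x hx
  simpa [hE] using hx

/-- The pointwise ergodic theorem: the averages converge almost everywhere. -/
lemma ae_exists_tendsto_birkhoffSum [IsFiniteMeasure μ] (hT : MeasurePreserving T μ μ)
    (hf : Integrable f μ) (hfm : Measurable f) :
    ∀ᵐ x ∂μ, ∃ c, Tendsto (fun n : ℕ => birkhoffSum T f n x / n) atTop (𝓝 c) := by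
  have h1 : ∀ᵐ x ∂μ, ∀ a b : ℚ, a < b →
      x ∉ lowSet T f a ∩ lowSet T (fun x => -f x) (-b) := by
    rw [ae_all_iff]; intro a
    rw [ae_all_iff]; intro b
    by_cases hab : a < b
    · filter_upwards [ae_notMem_lowSet_inter hT hf hfm (Rat.cast_lt.2 hab)] with x hx _ using hx
    · exact ae_of_all _ fun x h => absurd h hab
  have hlow : ∀ {f : α → ℝ} {x : α} {p a : ℝ}, p < a →
      (∃ᶠ n : ℕ in atTop, birkhoffSum T f n x / n < p) → x ∈ lowSet T f a := by
    intro f x p a hpa h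
    obtain ⟨q, hq1, hq2⟩ := exists_rat_btwn hpa
    refine ⟨q, hq2, (h.and_eventually (eventually_gt_atTop 0)).mono fun n hn => ?_⟩
    have hn0 : (0 : ℝ) < n := by exact_mod_cast hn.2
    exact (div_le_iff₀ hn0).1 (hn.1.le.trans hq1.le)
  have hbdd : ∀ {f : α → ℝ} {x : α} {k : ℕ}, x ∉ lowSet T f (-k) →
      ∀ᶠ n : ℕ in atTop, -(k + 1 : ℝ) ≤ birkhoffSum T f n x / n := by
    intro f x k hx
    by_contra h
    refine hx (hlow (p := -(k + 1 : ℝ)) (by linarith) ?_)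
    simpa [Filter.Frequently] using h
  filter_upwards [h1, ae_exists_notMem_lowSet hT hf hfm,
    ae_exists_notMem_lowSet hT hf.neg hfm.neg] with x h1 ⟨k, hk⟩ ⟨m, hm⟩
  refine tendsto_of_no_upcrossings (s := Set.range ((↑) : ℚ → ℝ)) Rat.denseRange_cast ?_ ?_ ?_
  · rintro _ ⟨a, rfl⟩ _ ⟨b, rfl⟩ hab ⟨h2, h3⟩
    obtain ⟨c, hc1, hc2⟩ := exists_rat_btwn hab
    obtain ⟨d, hd1, hd2⟩ := exists_rat_btwn hc2
    refine h1 c d (by exact_mod_cast hd1) ⟨hlow hc1 h2, hlow (neg_lt_neg hd2) (h3.mono ?_)⟩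
    intro n hn
    rw [birkhoffSum_neg', neg_div]
    exact neg_lt_neg hn
  · refine ⟨m + 1, ?_⟩
    rw [eventually_map]
    filter_upwards [hbdd hm] with n hn
    simp only [Pi.neg_def, birkhoffSum_neg', neg_div] at hn
    linarith
  · exact ⟨-(k + 1), hbdd hk⟩

/-- The averages of a stationary integrable sequence converge almost surely. -/
lemma ae_exists_tendsto_of_stationary [IsFiniteMeasure μ] {X : ℕ → α → ℝ}
    (hX : ∀ n, Measurable (X n)) (hi : Integrable (X 0) μ)
    (hstat : μ.map (fun x n => X (n + 1) x) = μ.map fun x n => X n x) :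
    ∀ᵐ x ∂μ, ∃ c, Tendsto (fun n : ℕ => (∑ k ∈ Finset.range n, X k x) / n) atTop (𝓝 c) := by
  have hXm : Measurable fun x n => X n x := measurable_pi_lambda _ hX
  have hSm : Measurable fun (u : ℕ → ℝ) n => u (n + 1) := by fun_prop
  -- The ergodic theorem is applied to the shift on the space of sequences, under the law of X.
  have hT : MeasurePreserving (fun (u : ℕ → ℝ) n => u (n + 1)) (μ.map fun x n => X n x)
      (μ.map fun x n => X n x) := by
    refine ⟨hSm, ?_⟩
    rw [Measure.map_map hSm hXm]
    exact hstat
  have hi' : Integrable (fun u : ℕ → ℝ => u 0) (μ.map fun x n => X n x) :=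
    (integrable_map_measure (measurable_pi_apply 0).aestronglyMeasurable hXm.aemeasurable).2 hi
  have h := ae_of_ae_map hXm.aemeasurable
    (ae_exists_tendsto_birkhoffSum hT hi' (measurable_pi_apply 0))
  have hit : ∀ (k : ℕ) (u : ℕ → ℝ) (m : ℕ),
      ((fun (u : ℕ → ℝ) n => u (n + 1))^[k] u) m = u (m + k) := by
    intro k
    induction k with
    | zero => simp
    | succ k ih =>
      intro u m
      rw [Function.iterate_succ_apply, ih]
      congr 1
  filter_upwards [h] with x ⟨c, hc⟩
  refine ⟨c, hc.congr fun n => ?_⟩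
  simp [birkhoffSum, hit]

end Birkhoff

/-! ### The free energy at small variance -/

lemma hasSum_cosh_sub_one (x : ℝ) :
    HasSum (fun n : ℕ => x ^ (2 * (n + 1)) / ((2 * (n + 1)).factorial : ℝ)) (Real.cosh x - 1) := by
  have h := (hasSum_nat_add_iff' 1).2 (Real.hasSum_cosh x)
  simpa using h

/-- Term by term in the power series, since u^{2n} ≤ u² for n ≥ 1. This dominates the second order
quotient by its value at u = 1. -/
lemma cosh_mul_sub_one_le {u : ℝ} (hu : |u| ≤ 1) (x : ℝ) :
    Real.cosh (u * x) - 1 ≤ u ^ 2 * (Real.cosh x - 1) := by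
  refine hasSum_le (fun n => ?_) (hasSum_cosh_sub_one (u * x))
    ((hasSum_cosh_sub_one x).mul_left (u ^ 2))
  rw [← mul_div_assoc, mul_pow]
  refine div_le_div_of_nonneg_right (mul_le_mul_of_nonneg_right ?_ ?_) (Nat.cast_nonneg _)
  · rw [pow_mul]
    exact pow_le_of_le_one (sq_nonneg u) ((sq_le_one_iff_abs_le_one u).2 hu) (by omega)
  · rw [pow_mul]
    exact pow_nonneg (sq_nonneg x) _

lemma tendsto_cosh_sub_one_div_sq (x : ℝ) :
    Tendsto (fun u : ℝ => (Real.cosh (u * x) - 1) / u ^ 2) (𝓝[≠] 0) (𝓝 (x ^ 2 / 2)) := by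
  have h : HasDerivAt (fun u : ℝ => Real.sinh (u * (x / 2))) (x / 2) 0 := by
    have := (((hasDerivAt_id (0 : ℝ)).mul_const (x / 2))).sinh
    simpa using this
  have h2 := (h.tendsto_slope_zero.pow 2).const_mul 2
  have e : 2 * (x / 2) ^ 2 = x ^ 2 / 2 := by ring
  rw [e] at h2
  refine h2.congr fun u => ?_
  have h3 : Real.cosh (u * x) = 1 + 2 * Real.sinh (u * (x / 2)) ^ 2 := by
    rw [show u * x = 2 * (u * (x / 2)) by ring, Real.cosh_two_mul, Real.cosh_sq]
    ring
  simp only [zero_add, zero_mul, Real.sinh_zero, sub_zero, smul_eq_mul, h3]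
  ring

lemma IsWeight.summable_prod {w : ℕ → ℝ} (hw : IsWeight w) :
    HasSum (fun p : ℕ × ℕ => w p.1 * w p.2) 1 := by
  have hs : Summable fun p : ℕ × ℕ => w p.1 * w p.2 :=
    hw.hasSum.summable.mul_of_nonneg hw.hasSum.summable hw.nonneg hw.nonneg
  have h := hw.hasSum.summable.tsum_mul_tsum hw.hasSum.summable hs
  rw [hw.hasSum.tsum_eq, mul_one] at h
  rw [h]
  exact hs.hasSum

lemma total_nonneg (w y : ℕ → ℝ) : 0 ≤ total w y := ENNReal.toReal_nonneg

/-- The product `Z(y) Z(-y)` of partition functions in terms of the differences `y_i - y_j`. -/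
lemma IsWeight.hasSum_cosh {w y : ℕ → ℝ} (hw : IsWeight w) (hy : Good w y) :
    HasSum (fun p : ℕ × ℕ => w p.1 * w p.2 * Real.cosh (y p.1 - y p.2))
      (total w y * total w fun i => -y i) := by
  have h1 := hy.summable_exp hw.nonneg
  have h2 := hy.neg.summable_exp hw.nonneg
  have hnn : ∀ (z : ℕ → ℝ) i, 0 ≤ w i * Real.exp (z i) := fun z i =>
    mul_nonneg (hw.nonneg i) (Real.exp_pos _).le
  have hs := h1.mul_of_nonneg h2 (hnn y) (hnn fun i => -y i)
  have h3 := h1.tsum_mul_tsum h2 hs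
  have h4 : HasSum (fun p : ℕ × ℕ => w p.1 * Real.exp (y p.1) * (w p.2 * Real.exp (-y p.2)))
      (total w y * total w fun i => -y i) := by
    rw [total_eq hw.nonneg, total_eq hw.nonneg, h3]
    exact hs.hasSum
  have h5 := (Equiv.prodComm ℕ ℕ).hasSum_iff.2 h4
  have h6 := (h4.add h5).div_const 2
  rw [add_self_div_two] at h6
  refine h6.congr_fun fun p => ?_
  simp only [Function.comp, Equiv.prodComm_apply, Prod.fst_swap, Prod.snd_swap]
  rw [Real.cosh_eq, neg_sub, sub_eq_add_neg, sub_eq_add_neg, Real.exp_add, Real.exp_add]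
  ring

lemma IsWeight.hasSum_cosh_sub_one {w y : ℕ → ℝ} (hw : IsWeight w) (hy : Good w y) :
    HasSum (fun p : ℕ × ℕ => w p.1 * w p.2 * (Real.cosh (y p.1 - y p.2) - 1))
      ((total w y * total w fun i => -y i) - 1) :=
  ((hw.hasSum_cosh hy).sub hw.summable_prod).congr_fun fun p => by ring

lemma Good.mul {w y : ℕ → ℝ} (hw : IsWeight w) (hy : Good w y) {u : ℝ} (hu : |u| ≤ 1) :
    Good w fun i => u * y i :=
  hy.mono hw.nonneg fun i => by
    rw [abs_mul]
    exact mul_le_of_le_one_left (abs_nonneg _) hu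

/-- The symmetrized log-sum-exp `(log Z(uy) + log Z(-uy)) / 2`. -/
def symLse (w : ℕ → ℝ) (u : ℝ) (y : ℕ → ℝ) : ℝ :=
  (lse w (fun i => u * y i) + lse w (fun i => -(u * y i))) / 2

lemma symLse_eq {w y : ℕ → ℝ} (hw : IsWeight w) (hy : Good w y) {u : ℝ} (hu : |u| ≤ 1) :
    symLse w u y =
      Real.log ((total w fun i => u * y i) * total w fun i => -(u * y i)) / 2 := by
  have h := hy.mul hw hu
  rw [symLse, lse, lse, Real.log_mul (hw.total_pos (h.summable_exp hw.nonneg)).ne'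
    (hw.total_pos (h.neg.summable_exp hw.nonneg)).ne']

lemma one_le_total_mul {w y : ℕ → ℝ} (hw : IsWeight w) (hy : Good w y) :
    1 ≤ total w y * total w fun i => -y i := by
  have h := (hw.hasSum_cosh_sub_one hy).nonneg fun p =>
    mul_nonneg (mul_nonneg (hw.nonneg _) (hw.nonneg _)) (by linarith [Real.one_le_cosh (y p.1 - y p.2)])
  linarith

lemma total_mul_sub_one_le {w y : ℕ → ℝ} (hw : IsWeight w) (hy : Good w y) {u : ℝ}
    (hu : |u| ≤ 1) :
    ((total w fun i => u * y i) * total w fun i => -(u * y i)) - 1 ≤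
      u ^ 2 * ((total w y * total w fun i => -y i) - 1) := by
  refine hasSum_le (fun p => ?_) (hw.hasSum_cosh_sub_one (hy.mul hw hu))
    ((hw.hasSum_cosh_sub_one hy).mul_left (u ^ 2))
  rw [← mul_sub, mul_left_comm]
  exact mul_le_mul_of_nonneg_left (cosh_mul_sub_one_le hu _)
    (mul_nonneg (hw.nonneg _) (hw.nonneg _))

lemma tendsto_total_mul {w y : ℕ → ℝ} (hw : IsWeight w) (hy : Good w y) {u : ℕ → ℝ}
    (hu : ∀ n, |u n| ≤ 1) (hu0 : ∀ n, u n ≠ 0) (hlim : Tendsto u atTop (𝓝 0)) :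
    Tendsto (fun n => (((total w fun i => u n * y i) * total w fun i => -(u n * y i)) - 1) /
      u n ^ 2) atTop (𝓝 (∑' p : ℕ × ℕ, w p.1 * w p.2 * ((y p.1 - y p.2) ^ 2 / 2))) := by
  have hlim' : Tendsto u atTop (𝓝[≠] 0) :=
    tendsto_nhdsWithin_iff.2 ⟨hlim, Eventually.of_forall hu0⟩
  have h := tendsto_tsum_of_dominated_convergence (𝓕 := atTop)
    (f := fun n (p : ℕ × ℕ) => w p.1 * w p.2 * ((Real.cosh (u n * (y p.1 - y p.2)) - 1) / u n ^ 2))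
    (g := fun p : ℕ × ℕ => w p.1 * w p.2 * ((y p.1 - y p.2) ^ 2 / 2))
    (hw.hasSum_cosh_sub_one hy).summable
    (fun p => ((tendsto_cosh_sub_one_div_sq _).comp hlim').const_mul _)
    (Eventually.of_forall fun n p => by
      have h1 : 0 ≤ Real.cosh (u n * (y p.1 - y p.2)) - 1 := by
        linarith [Real.one_le_cosh (u n * (y p.1 - y p.2))]
      have h2 := mul_nonneg (hw.nonneg p.1) (hw.nonneg p.2)
      rw [Real.norm_of_nonneg (mul_nonneg h2 (div_nonneg h1 (sq_nonneg _)))]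
      refine mul_le_mul_of_nonneg_left ?_ h2
      rw [div_le_iff₀' (by have := hu0 n; positivity)]
      exact cosh_mul_sub_one_le (hu n) _)
  refine h.congr fun n => ?_
  have h1 := ((hw.hasSum_cosh_sub_one (hy.mul hw (hu n))).div_const (u n ^ 2)).tsum_eq
  rw [← h1]
  exact tsum_congr fun p => by rw [← mul_sub, mul_div_assoc]

/-- The product of the two partition functions is 1 + R with R of order u², and log(1 + R) lies
between R / (1 + R) and R. -/
lemma tendsto_symLse {w y : ℕ → ℝ} (hw : IsWeight w) (hy : Good w y) {u : ℕ → ℝ}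
    (hu : ∀ n, |u n| ≤ 1) (hu0 : ∀ n, u n ≠ 0) (hlim : Tendsto u atTop (𝓝 0)) :
    Tendsto (fun n => symLse w (u n) y / u n ^ 2) atTop
      (𝓝 ((∑' p : ℕ × ℕ, w p.1 * w p.2 * ((y p.1 - y p.2) ^ 2 / 2)) / 2)) := by
  set R : ℕ → ℝ := fun n => ((total w fun i => u n * y i) * total w fun i => -(u n * y i)) - 1
    with hR
  have hR0 : ∀ n, 0 ≤ R n := fun n => sub_nonneg.2 (one_le_total_mul hw (hy.mul hw (hu n)))
  have h1 := tendsto_total_mul hw hy hu hu0 hlim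
  have hRlim : Tendsto R atTop (𝓝 0) := by
    have := h1.mul (hlim.pow 2)
    simp only [ne_eq, OfNat.ofNat_ne_zero, not_false_eq_true, zero_pow, mul_zero] at this
    exact this.congr fun n => div_mul_cancel₀ _ (pow_ne_zero 2 (hu0 n))
  have h2 : Tendsto (fun n => R n / u n ^ 2 / (1 + R n)) atTop
      (𝓝 (∑' p : ℕ × ℕ, w p.1 * w p.2 * ((y p.1 - y p.2) ^ 2 / 2))) := by
    have := h1.div (hRlim.const_add 1) (by norm_num)
    rw [add_zero, div_one] at this
    exact this
  refine Tendsto.congr (fun n => ?_) ((tendsto_of_tendsto_of_tendsto_of_le_of_le h2 h1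
    (f := fun n => Real.log (1 + R n) / u n ^ 2) (fun n => ?_) (fun n => ?_)).div_const 2)
  · rw [symLse_eq hw hy (hu n), hR]
    simp only [add_sub_cancel]
    ring
  · have hpos : 0 < 1 + R n := by linarith [hR0 n]
    have h := Real.one_sub_inv_le_log_of_pos hpos
    have e : R n / u n ^ 2 / (1 + R n) = (1 - (1 + R n)⁻¹) / u n ^ 2 := by
      field_simp
      ring
    simp only [e]
    gcongr
  · have hpos : 0 < 1 + R n := by linarith [hR0 n]
    have h := Real.log_le_sub_one_of_pos hpos
    have : Real.log (1 + R n) ≤ R n := by linarith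
    simp only
    gcongr

lemma abs_symLse_div_le {w y : ℕ → ℝ} (hw : IsWeight w) (hy : Good w y) {u : ℝ} (hu : |u| ≤ 1)
    (hu0 : u ≠ 0) :
    |symLse w u y / u ^ 2| ≤ ((total w y * total w fun i => -y i) - 1) / 2 := by
  have hpos : 0 < u ^ 2 := by positivity
  have h1 := one_le_total_mul hw (hy.mul hw hu)
  have h2 := Real.log_nonneg h1
  rw [symLse_eq hw hy hu, abs_of_nonneg (by positivity), div_le_iff₀ hpos]
  have h3 := Real.log_le_sub_one_of_pos (zero_lt_one.trans_le h1)
  have h4 := total_mul_sub_one_le hw hy hu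
  linarith

variable {C : ℕ → ℕ → ℝ} {w : ℕ → ℝ} {s : ℝ}

lemma field_map_mul (hC : IsCorr C) (u : ℝ) :
    (field C 1).map (fun y i => u * y i) = field C (u ^ 2) := by
  have h := gaussField_map_smul (posSemidef_smul hC.posSemidef zero_le_one) u
  simpa [field] using h

lemma measurable_mul_field (u : ℝ) : Measurable fun (y : ℕ → ℝ) i => u * y i := by fun_prop

lemma integrable_lse_mul (hC : IsCorr C) (hw : IsWeight w) (u : ℝ) :
    Integrable (fun y => lse w fun i => u * y i) (field C 1) := by
  have h := integrable_lse hC hw (sq_nonneg u)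
  rw [← field_map_mul hC u] at h
  exact h.comp_measurable (measurable_mul_field u)

lemma free_sq (hC : IsCorr C) (u : ℝ) :
    free C w (u ^ 2) = ∫ y, lse w (fun i => u * y i) ∂field C 1 := by
  rw [free, ← field_map_mul hC u, integral_map (measurable_mul_field u).aemeasurable
    (measurable_lse_right w).aestronglyMeasurable]

/-- Averaging over u and -u removes the term of first order in u before the limit, so the quotient
by u² can be dominated. -/
lemma free_sq_eq_symLse (hC : IsCorr C) (hw : IsWeight w) (u : ℝ) :
    free C w (u ^ 2) = ∫ y, symLse w u y ∂field C 1 := by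
  have h1 := free_sq (w := w) hC u
  have h2 := free_sq (w := w) hC (-u)
  have h3 := integrable_lse_mul hC hw (-u)
  simp only [neg_mul] at h2 h3
  unfold symLse
  rw [integral_div, integral_add (integrable_lse_mul hC hw u) h3, ← h1, ← h2, neg_sq]
  ring

/-! ### The overlap defect as the derivative of the free energy at zero -/

/-- The mean overlap defect `∑_{i,j} w_i w_j (1 - C_{ij})`. -/
def defect (C : ℕ → ℕ → ℝ) (w : ℕ → ℝ) : ℝ≥0∞ :=
  ∑' p : ℕ × ℕ, ENNReal.ofReal (w p.1 * w p.2 * (1 - C p.1 p.2))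

lemma IsCorr.le_one (hC : IsCorr C) (i j : ℕ) : C i j ≤ 1 := by
  by_cases hij : i = j
  · rw [hij, hC.diag]
  have h := quadForm_nonneg hC.posSemidef {i, j} (fun k => if k = i then 1 else -1)
  simp only [Finset.sum_pair hij, if_true, if_neg (Ne.symm hij), hC.diag,
    symm_of_posSemidef hC.posSemidef j i] at h
  linarith

lemma IsCorr.neg_one_le (hC : IsCorr C) (i j : ℕ) : -1 ≤ C i j := by
  by_cases hij : i = j
  · rw [hij, hC.diag]; norm_num
  have h := quadForm_nonneg hC.posSemidef {i, j} (fun _ => 1)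
  simp only [Finset.sum_pair hij, hC.diag, symm_of_posSemidef hC.posSemidef j i] at h
  linarith

lemma defect_le (hC : IsCorr C) (hw : IsWeight w) : defect C w ≤ 2 := by
  calc defect C w ≤ ∑' p : ℕ × ℕ, ENNReal.ofReal (2 * (w p.1 * w p.2)) := by
        refine ENNReal.tsum_le_tsum fun p => ENNReal.ofReal_le_ofReal ?_
        have := mul_nonneg (hw.nonneg p.1) (hw.nonneg p.2)
        have := hC.neg_one_le p.1 p.2
        nlinarith
    _ = ENNReal.ofReal (2 * 1) := by
        have h1 := hw.summable_prod.mul_left 2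
        have h2 := ENNReal.ofReal_tsum_of_nonneg (f := fun p : ℕ × ℕ => 2 * (w p.1 * w p.2))
          (fun p => mul_nonneg zero_le_two (mul_nonneg (hw.nonneg p.1) (hw.nonneg p.2)))
          h1.summable
        rw [← h2, h1.tsum_eq]
    _ = 2 := by rw [mul_one]; exact ENNReal.ofReal_ofNat 2

lemma lintegral_sq_sub (hC : IsCorr C) (hw : IsWeight w) :
    ∫⁻ y, ∑' p : ℕ × ℕ, ENNReal.ofReal (w p.1 * w p.2 * ((y p.1 - y p.2) ^ 2 / 2)) ∂field C 1 =
      defect C w := by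
  rw [lintegral_tsum fun p => Measurable.aemeasurable (by fun_prop)]
  refine tsum_congr fun p => ?_
  have h0 := mul_nonneg (hw.nonneg p.1) (hw.nonneg p.2)
  have e : ∀ y : ℕ → ℝ, ENNReal.ofReal (w p.1 * w p.2 * ((y p.1 - y p.2) ^ 2 / 2)) =
      ENNReal.ofReal (w p.1 * w p.2 / 2) * ENNReal.ofReal ((y p.1 - y p.2) ^ 2) := fun y => by
    rw [← ENNReal.ofReal_mul (by positivity)]
    congr 1
    ring
  simp_rw [e]
  rw [lintegral_const_mul _ (by fun_prop), lintegral_sq_sub_gaussField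
    (posSemidef_smul hC.posSemidef zero_le_one), ← ENNReal.ofReal_mul (by positivity), hC.diag,
    hC.diag]
  congr 1
  ring

/-- This is the dominating function for the limit u → 0. The product Z(y)Z(-y) is bounded by Z(2y) +
Z(-2y), whose mean is explicit. -/
lemma integrable_total_mul (hC : IsCorr C) (hw : IsWeight w) :
    Integrable (fun y => ((total w y * total w fun i => -y i) - 1) / 2) (field C 1) := by
  have hm : Measurable (total w) := measurable_total.comp measurable_prodMk_left
  have hmn : Measurable fun y : ℕ → ℝ => total w fun i => -y i :=
    hm.comp (by fun_prop : Measurable fun (y : ℕ → ℝ) i => -y i)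
  refine (Integrable.sub ?_ (integrable_const 1)).div_const 2
  refine ⟨(hm.mul hmn).aestronglyMeasurable, ?_⟩
  rw [hasFiniteIntegral_iff_ofReal (ae_of_all _ fun y =>
    mul_nonneg (total_nonneg w y) (total_nonneg w _))]
  have hb : ∀ᵐ y ∂field C 1, ENNReal.ofReal (total w y * total w fun i => -y i) ≤
      ∑' i, ENNReal.ofReal (w i * Real.exp (2 * y i)) +
        ∑' i, ENNReal.ofReal (w i * Real.exp (-2 * y i)) := by
    filter_upwards [ae_good hC hw zero_le_one, ae_summable_exp hC hw zero_le_one 2,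
      ae_summable_exp hC hw zero_le_one (-2)] with y hy h1 h2
    rw [← ofReal_tsum_mul_exp hw.nonneg h1, ← ofReal_tsum_mul_exp hw.nonneg h2,
      ← ENNReal.ofReal_add (tsum_nonneg fun i => mul_nonneg (hw.nonneg i) (Real.exp_pos _).le)
      (tsum_nonneg fun i => mul_nonneg (hw.nonneg i) (Real.exp_pos _).le), ← h1.tsum_add h2]
    refine ENNReal.ofReal_le_ofReal ?_
    have h3 := hw.hasSum_cosh hy
    have h4 := h1.add h2
    have h5 : HasSum (fun p : ℕ × ℕ => w p.1 * w p.2 *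
        ((Real.exp (2 * y p.1) + Real.exp (-2 * y p.2)) / 2)) 
        ((∑' i, w i * Real.exp (2 * y i) + ∑' i, w i * Real.exp (-2 * y i)) / 2) := by
      have hA : Summable fun p : ℕ × ℕ => w p.1 * Real.exp (2 * y p.1) * w p.2 :=
        h1.mul_of_nonneg hw.hasSum.summable
          (fun i => mul_nonneg (hw.nonneg i) (Real.exp_pos _).le) hw.nonneg
      have hB : Summable fun p : ℕ × ℕ => w p.1 * (w p.2 * Real.exp (-2 * y p.2)) :=
        hw.hasSum.summable.mul_of_nonneg h2 hw.nonneg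
          (fun i => mul_nonneg (hw.nonneg i) (Real.exp_pos _).le)
      have hA' := h1.tsum_mul_tsum hw.hasSum.summable hA
      have hB' := hw.hasSum.summable.tsum_mul_tsum h2 hB
      rw [hw.hasSum.tsum_eq, mul_one] at hA'
      rw [hw.hasSum.tsum_eq, one_mul] at hB'
      rw [hA', hB']
      exact ((hA.hasSum.add hB.hasSum).div_const 2).congr_fun fun p => by ring
    -- Twice a product is at most the sum of the squares, for e^a e^{-b} and for e^b e^{-a}. The two
    -- halves are exchanged by swapping a and b, which matches the sum `h5` and its transpose.
    have hcosh : ∀ a b : ℝ, Real.cosh (a - b) ≤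
        (Real.exp (2 * a) + Real.exp (-2 * b)) / 2 + (Real.exp (2 * b) + Real.exp (-2 * a)) / 2 := by
      intro a b
      have e1 : Real.exp (2 * a) = Real.exp a ^ 2 := by rw [sq, ← Real.exp_add]; ring_nf
      have e2 : Real.exp (-2 * b) = Real.exp (-b) ^ 2 := by rw [sq, ← Real.exp_add]; ring_nf
      have e3 : Real.exp (2 * b) = Real.exp b ^ 2 := by rw [sq, ← Real.exp_add]; ring_nf
      have e4 : Real.exp (-2 * a) = Real.exp (-a) ^ 2 := by rw [sq, ← Real.exp_add]; ring_nf
      rw [Real.cosh_eq, neg_sub, sub_eq_add_neg, sub_eq_add_neg, Real.exp_add, Real.exp_add,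
        e1, e2, e3, e4]
      nlinarith [sq_nonneg (Real.exp a - Real.exp (-b)), sq_nonneg (Real.exp b - Real.exp (-a)),
        sq_nonneg (Real.exp a), sq_nonneg (Real.exp b), sq_nonneg (Real.exp (-a)),
        sq_nonneg (Real.exp (-b))]
    have h6 := (Equiv.prodComm ℕ ℕ).hasSum_iff.2 h5
    have h7 := hasSum_le (fun p => ?_) h3 (h5.add h6)
    · rw [h1.tsum_add h2]
      linarith
    · simp only [Function.comp, Equiv.prodComm_apply, Prod.fst_swap, Prod.snd_swap]
      have := mul_le_mul_of_nonneg_left (hcosh (y p.1) (y p.2))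
        (mul_nonneg (hw.nonneg p.1) (hw.nonneg p.2))
      linarith
  refine (lintegral_mono_ae hb).trans_lt ?_
  rw [lintegral_add_left (Measurable.tsum fun i => by fun_prop),
    lintegral_tsum_exp hC hw zero_le_one, lintegral_tsum_exp hC hw zero_le_one]
  exact ENNReal.add_lt_top.2 ⟨ENNReal.ofReal_lt_top, ENNReal.ofReal_lt_top⟩

lemma tendsto_free_div (hC : IsCorr C) (hw : IsWeight w) {x : ℝ} (hx : 0 < x) (hx1 : x ≤ 1) :
    Tendsto (fun n : ℕ => ((n : ℝ) + 1) / x * free C w (x / ((n : ℝ) + 1))) atTop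
      (𝓝 ((defect C w).toReal / 2)) := by
  -- The field scaled by u has variance x / (n + 1); the condition x ≤ 1 ensures |u| ≤ 1.
  set u : ℕ → ℝ := fun n => √(x / ((n : ℝ) + 1)) with hu
  have husq : ∀ n, u n ^ 2 = x / ((n : ℝ) + 1) := fun n => Real.sq_sqrt (by positivity)
  have hu0 : ∀ n, u n ≠ 0 := fun n => (Real.sqrt_pos.2 (by positivity)).ne'
  have hu1 : ∀ n, |u n| ≤ 1 := fun n => by
    rw [← sq_le_one_iff_abs_le_one, husq, div_le_one (by positivity)]
    have : (0 : ℝ) ≤ n := Nat.cast_nonneg n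
    linarith
  have hlim0 : Tendsto (fun n : ℕ => x / ((n : ℝ) + 1)) atTop (𝓝 0) := by
    simpa [div_eq_mul_inv] using (tendsto_one_div_add_atTop_nhds_zero_nat (𝕜 := ℝ)).const_mul x
  have hulim : Tendsto u atTop (𝓝 0) := by
    have := (Real.continuous_sqrt.tendsto 0).comp hlim0
    simpa [hu, Function.comp_def] using this
  set f : (ℕ → ℝ) → ℝ := fun y => (∑' p : ℕ × ℕ,
    ENNReal.ofReal (w p.1 * w p.2 * ((y p.1 - y p.2) ^ 2 / 2))).toReal / 2 with hf
  have hfm : Measurable fun y : ℕ → ℝ => ∑' p : ℕ × ℕ,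
    ENNReal.ofReal (w p.1 * w p.2 * ((y p.1 - y p.2) ^ 2 / 2)) :=
    Measurable.tsum fun p => by fun_prop
  have hfin : ∫⁻ y, ∑' p : ℕ × ℕ,
      ENNReal.ofReal (w p.1 * w p.2 * ((y p.1 - y p.2) ^ 2 / 2)) ∂field C 1 ≠ ∞ := by
    rw [lintegral_sq_sub hC hw]
    exact ((defect_le hC hw).trans_lt (by simp)).ne
  have hfint : ∫ y, f y ∂field C 1 = (defect C w).toReal / 2 := by
    rw [hf, integral_div, integral_toReal hfm.aemeasurable (ae_lt_top hfm hfin),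
      lintegral_sq_sub hC hw]
  rw [← hfint]
  have hsm : ∀ n, Measurable fun y => symLse w (u n) y / u n ^ 2 := fun n => by
    have h1 := (measurable_lse_right w).comp (measurable_mul_field (u n))
    have h2 := (measurable_lse_right w).comp
      (by fun_prop : Measurable fun (y : ℕ → ℝ) i => -(u n * y i))
    exact ((h1.add h2).div_const 2).div_const _
  have hlim := tendsto_integral_of_dominated_convergence (μ := field C 1)
    (F := fun n y => symLse w (u n) y / u n ^ 2) (f := f)
    (fun y => ((total w y * total w fun i => -y i) - 1) / 2)
    (fun n => (hsm n).aestronglyMeasurable)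
    (integrable_total_mul hC hw)
    (fun n => by
      filter_upwards [ae_good hC hw zero_le_one] with y hy
      exact abs_symLse_div_le hw hy (hu1 n) (hu0 n))
    (by
      filter_upwards [ae_good hC hw zero_le_one] with y hy
      have hnn : ∀ p : ℕ × ℕ, 0 ≤ w p.1 * w p.2 * ((y p.1 - y p.2) ^ 2 / 2) := fun p =>
        mul_nonneg (mul_nonneg (hw.nonneg _) (hw.nonneg _)) (by positivity)
      have e : f y = (∑' p : ℕ × ℕ, w p.1 * w p.2 * ((y p.1 - y p.2) ^ 2 / 2)) / 2 := by
        simp only [hf]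
        rw [ENNReal.tsum_toReal_eq fun _ => ENNReal.ofReal_ne_top]
        simp_rw [ENNReal.toReal_ofReal (hnn _)]
      rw [e]
      exact tendsto_symLse hw hy hu1 hu0 hulim)
  refine hlim.congr fun n => ?_
  rw [integral_div, ← free_sq_eq_symLse hC hw, husq]
  field_simp

/-! ### The reordering and the evolution of admissible configurations -/

section Order

variable {w : ℕ → ℝ}

/-- A positive weight is exceeded or equalled by finitely many terms of a summable sequence. A zero
weight is safe because only zeros follow it: a zero ahead of infinitely many positive weights would
have infinite rank. -/
lemma finite_precedes (h0 : ∀ i, 0 ≤ w i) (hs : Summable w)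
    (hz : ∀ i j, i ≤ j → w i = 0 → w j = 0) (i : ℕ) : {j | Precedes w j i}.Finite := by
  rcases (h0 i).eq_or_lt with hi | hi
  · refine (Set.finite_Iio i).subset fun j hj => ?_
    by_contra hji
    have hwj := hz i j (not_lt.1 hji) hi.symm
    rcases hj with h | ⟨-, h⟩
    · rw [hwj, ← hi] at h
      exact lt_irrefl _ h
    · exact hji h
  · have h := (hs.tendsto_cofinite_zero.eventually_lt_const hi)
    refine Set.Finite.subset (s := {j | ¬ w j < w i}) h fun j hj => ?_
    rcases hj with h | ⟨h, -⟩
    · exact not_lt.2 h.le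
    · exact not_lt.2 h.le

/-- The zeros form a final segment and ties are broken by labels. So a particle without weight never
moves, which is needed for its velocity. -/
lemma order_eq_self (h0 : ∀ i, 0 ≤ w i) (hs : Summable w)
    (hz : ∀ i j, i ≤ j → w i = 0 → w j = 0) {i : ℕ} (hi : w i = 0) : order w i = i := by
  obtain ⟨hinj, hr⟩ := rank_order (finite_precedes h0 hs hz)
  refine hinj ((hr i).trans ?_)
  have e : {k | Precedes w k i} = Set.Iio i := by
    ext k
    simp only [Set.mem_ofPred_eq, Precedes, Set.mem_Iio, hi]
    constructor
    · rintro (h | ⟨-, h⟩)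
      · by_contra hki
        rw [hz i k (not_lt.1 hki) hi] at h
        exact lt_irrefl _ h
      · exact h
    · intro h
      rcases (h0 k).eq_or_lt with h' | h'
      · exact Or.inr ⟨h', h⟩
      · exact Or.inl h'
  simp [e, Set.ncard_eq_toFinset_card']

end Order

/-- Admissible configurations: a decreasing probability weight and a correlation matrix. -/
structure IsAdmissible (ω : Config) : Prop where
  antitone : Antitone ω.1
  isWeight : IsWeight ω.1
  isCorr : IsCorr ω.2

/-- Schur product theorem: inserting A = L Lᵀ writes the quadratic form as a sum over k of quadratic
forms of B at the vectors x_i L_{ik}. -/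
lemma posSemidef_hadamard {A B : ℕ → ℕ → ℝ} (hA : (Matrix.of A).PosSemidef)
    (hB : (Matrix.of B).PosSemidef) : (Matrix.of fun i j => A i j * B i j).PosSemidef := by
  refine posSemidef_of_quadForm (fun i j => by
    rw [symm_of_posSemidef hA i j, symm_of_posSemidef hB i j]) 0 fun S _ x => ?_
  obtain ⟨N, hN⟩ : ∃ N, ∀ j ∈ S, j < N :=
    ⟨S.sup id + 1, fun j hj => Nat.lt_succ_of_le (Finset.le_sup (f := id) hj)⟩
  have e : ∑ i ∈ S, ∑ j ∈ S, x i * (A i j * B i j) * x j =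
      ∑ k ∈ Finset.range N, ∑ i ∈ S, ∑ j ∈ S,
        (x i * cholesky A i k) * B i j * (x j * cholesky A j k) := by
    rw [Finset.sum_comm (s := Finset.range N)]
    refine Finset.sum_congr rfl fun i hi => ?_
    rw [Finset.sum_comm (s := Finset.range N)]
    refine Finset.sum_congr rfl fun j _ => ?_
    rw [← sum_cholesky_mul hA (hN i hi), Finset.sum_mul, Finset.mul_sum, Finset.sum_mul]
    exact Finset.sum_congr rfl fun k _ => by ring
  rw [e]
  exact Finset.sum_nonneg fun k _ => quadForm_nonneg hB S fun i => x i * cholesky A i k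

lemma isCorr_entryPow {Q : ℕ → ℕ → ℝ} (hQ : IsCorr Q) (r : ℕ) : IsCorr (entryPow r Q) := by
  refine ⟨?_, fun i => by simp [entryPow, hQ.diag]⟩
  induction r with
  | zero =>
    refine posSemidef_of_quadForm (fun i j => by simp [entryPow]) 0 fun S _ x => ?_
    simp only [entryPow, pow_zero, mul_one]
    rw [← Finset.sum_mul_sum]
    exact mul_self_nonneg _
  | succ r ih =>
    have e : entryPow (r + 1) Q = fun i j => entryPow r Q i j * Q i j := by
      ext i j
      simp [entryPow, pow_succ]
    rw [e]
    exact posSemidef_hadamard ih hQ.posSemidef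

lemma IsAdmissible.eq_zero {ω : Config} (hω : IsAdmissible ω) {i j : ℕ} (hij : i ≤ j)
    (hi : ω.1 i = 0) : ω.1 j = 0 :=
  le_antisymm (hi ▸ hω.antitone hij) (hω.isWeight.nonneg j)

lemma tilt_eq_zero_iff {w y : ℕ → ℝ} (hw : IsWeight w)
    (hy : Summable fun i => w i * Real.exp (y i)) (i : ℕ) : tilt w y i = 0 ↔ w i = 0 := by
  simp [tilt, (hw.total_pos hy).ne', (Real.exp_pos _).ne']

section Evolve

variable {ω : Config} {κ : ℕ → ℝ} {ψ : ℝ → ℝ}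

lemma finite_precedes_newWeight (hω : IsAdmissible ω)
    (hy : Summable fun i => ω.1 i * Real.exp (ψ (κ i))) (i : ℕ) :
    {j | Precedes (newWeight ψ ω κ) j i}.Finite := by
  have ht := isWeight_tilt hω.isWeight hy
  refine finite_precedes ht.nonneg ht.hasSum.summable (fun i j hij h => ?_) i
  exact (tilt_eq_zero_iff hω.isWeight hy j).2
    (hω.eq_zero hij ((tilt_eq_zero_iff hω.isWeight hy i).1 h))

lemma bijective_reorder (hω : IsAdmissible ω)
    (hy : Summable fun i => ω.1 i * Real.exp (ψ (κ i))) :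
    Function.Bijective (reorder ψ ω κ) :=
  bijective_order (finite_precedes_newWeight hω hy)

lemma isAdmissible_evolve (hω : IsAdmissible ω)
    (hy : Summable fun i => ω.1 i * Real.exp (ψ (κ i))) : IsAdmissible (evolve ψ ω κ) where
  antitone := antitone_order (finite_precedes_newWeight hω hy)
  isWeight := (isWeight_tilt hω.isWeight hy).comp (bijective_reorder hω hy)
  isCorr := hω.isCorr.comp _

lemma reorder_eq_self (hω : IsAdmissible ω)
    (hy : Summable fun i => ω.1 i * Real.exp (ψ (κ i))) {i : ℕ} (hi : ω.1 i = 0) :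
    reorder ψ ω κ i = i := by
  have ht := isWeight_tilt hω.isWeight hy
  refine order_eq_self ht.nonneg ht.hasSum.summable (fun i j hij h => ?_)
    ((tilt_eq_zero_iff hω.isWeight hy i).2 hi)
  exact (tilt_eq_zero_iff hω.isWeight hy j).2
    (hω.eq_zero hij ((tilt_eq_zero_iff hω.isWeight hy i).1 h))

end Evolve

/-! ### Fields with all exponential moments -/

/-- The fields with all exponential moments under the weight `w`. -/
def goodFields {w : ℕ → ℝ} (hw : IsWeight w) : Submodule ℝ (ℕ → ℝ) where
  carrier := {y | ∀ b : ℕ, Good w fun i => b * y i}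
  zero_mem' b := by simpa using good_zero hw
  add_mem' := by
    intro y z hy hz b
    refine Summable.of_nonneg_of_le (fun i => mul_nonneg (hw.nonneg i) (Real.exp_pos _).le)
      (fun i => ?_) ((hy (2 * b)).add (hz (2 * b)))
    rw [← mul_add]
    refine mul_le_mul_of_nonneg_left ?_ (hw.nonneg i)
    -- The exponential of the sum is controlled by that of twice the larger term. Closure under sums
    -- thus costs a doubling of b, which is why all b are required.
    have h1 : |b * (y + z) i| ≤ b * |y i| + b * |z i| := by
      rw [Pi.add_apply, mul_add]
      refine (abs_add_le _ _).trans_eq ?_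
      rw [abs_mul, abs_mul, Nat.abs_cast]
    have h2 : ∀ v : ℝ, |((2 * b : ℕ) : ℝ) * v| = 2 * (b * |v|) := fun v => by
      rw [abs_mul, Nat.abs_cast]; push_cast; ring
    rw [h2, h2]
    rcases le_total (b * |y i|) (b * |z i|) with h | h
    · exact (Real.exp_le_exp.2 (by linarith)).trans (le_add_of_nonneg_left (Real.exp_pos _).le)
    · exact (Real.exp_le_exp.2 (by linarith)).trans (le_add_of_nonneg_right (Real.exp_pos _).le)
  smul_mem' := by
    intro c y hy b
    obtain ⟨n, hn⟩ := exists_nat_ge (b * |c|)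
    refine (hy n).mono hw.nonneg fun i => ?_
    rw [Pi.smul_apply, smul_eq_mul, ← mul_assoc, abs_mul, abs_mul, abs_mul, Nat.abs_cast,
      Nat.abs_cast]
    exact mul_le_mul_of_nonneg_right hn (abs_nonneg _)

lemma good_of_mem {w y : ℕ → ℝ} (hw : IsWeight w) (hy : y ∈ goodFields hw) : Good w y := by
  simpa using hy 1

/-- Up to normalization, the moment of |z| under the tilted weights is the moment of y + b|z| under
w, and y + b|z| is again in the space. -/
lemma mem_goodFields_tilt {w y z : ℕ → ℝ} (hw : IsWeight w) (hy : y ∈ goodFields hw)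
    (hz : z ∈ goodFields hw) (hw' : IsWeight (tilt w y)) : z ∈ goodFields hw' := by
  intro b
  have habs : (fun i => |z i|) ∈ goodFields hw := fun b => by
    simpa [Good, abs_mul] using hz b
  have h := (good_of_mem hw ((goodFields hw).add_mem hy
    ((goodFields hw).smul_mem (b : ℝ) habs))).summable_exp hw.nonneg
  refine (tilt_tilt_summable (y := y) (z := fun i => b * |z i|) h).congr fun i => ?_
  rw [abs_mul, Nat.abs_cast]

lemma mem_goodFields_comp {w y : ℕ → ℝ} (hw : IsWeight w) (hy : y ∈ goodFields hw) {f : ℕ → ℕ}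
    (hf : Function.Bijective f) : (fun i => y (f i)) ∈ goodFields (hw.comp hf) := fun b =>
  (Equiv.ofBijective f hf).summable_iff.2 (hy b)

/-! ### Measurability of the admissibility conditions -/

lemma measurableSet_isWeight : MeasurableSet {w : ℕ → ℝ | IsWeight w} := by
  have e : {w : ℕ → ℝ | IsWeight w} =
      {w | (∀ i, 0 ≤ w i) ∧ ∑' i, ENNReal.ofReal (w i) = 1} := by
    ext w
    simp only [Set.mem_ofPred_eq]
    constructor
    · intro h
      refine ⟨h.nonneg, ?_⟩
      rw [← ENNReal.ofReal_tsum_of_nonneg h.nonneg h.hasSum.summable, h.hasSum.tsum_eq,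
        ENNReal.ofReal_one]
    · rintro ⟨h0, h1⟩
      have hs := summable_of_tsum_ofReal_ne_top h0 (by rw [h1]; simp)
      refine ⟨h0, ?_⟩
      rw [← ENNReal.ofReal_tsum_of_nonneg h0 hs, ENNReal.ofReal_eq_one] at h1
      rw [← h1]
      exact hs.hasSum
  rw [e]
  refine measurableSet_setOfPred.2 (Measurable.and (Measurable.forall fun i => ?_) ?_)
  · exact measurableSet_setOfPred.1 (measurableSet_le measurable_const (measurable_pi_apply i))
  · exact measurableSet_setOfPred.1 (measurableSet_eq_fun
      (Measurable.tsum fun i => by fun_prop) measurable_const)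

lemma measurableSet_mem_goodFields :
    MeasurableSet {p : (ℕ → ℝ) × (ℕ → ℝ) | ∃ hw : IsWeight p.1, p.2 ∈ goodFields hw} := by
  have e : {p : (ℕ → ℝ) × (ℕ → ℝ) | ∃ hw : IsWeight p.1, p.2 ∈ goodFields hw} =
      {p | IsWeight p.1 ∧ ∀ b : ℕ,
        ∑' i, ENNReal.ofReal (p.1 i * Real.exp |b * p.2 i|) ≠ ∞} := by
    ext p
    simp only [Set.mem_ofPred_eq]
    constructor
    · rintro ⟨hw, h⟩
      refine ⟨hw, fun b => ?_⟩
      rw [← ENNReal.ofReal_tsum_of_nonneg (fun i => mul_nonneg (hw.nonneg i) (Real.exp_pos _).le)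
        (h b)]
      exact ENNReal.ofReal_ne_top
    · rintro ⟨hw, h⟩
      exact ⟨hw, fun b => summable_of_tsum_ofReal_ne_top
        (fun i => mul_nonneg (hw.nonneg i) (Real.exp_pos _).le) (h b)⟩
  rw [e]
  refine MeasurableSet.inter (measurable_fst measurableSet_isWeight) ?_
  refine measurableSet_setOfPred.2 (Measurable.forall fun b => ?_)
  refine measurableSet_setOfPred.1 ((measurableSet_singleton ∞).compl.preimage
    (Measurable.tsum fun i => ?_))
  have : Measurable fun p : (ℕ → ℝ) × (ℕ → ℝ) => |(b : ℝ) * p.2 i| :=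
    continuous_abs.measurable.comp (by fun_prop)
  exact ((by fun_prop : Measurable fun p : (ℕ → ℝ) × (ℕ → ℝ) => p.1 i).mul
    this.exp).ennreal_ofReal

lemma ae_mem_goodFields {C : ℕ → ℕ → ℝ} {w : ℕ → ℝ} {s : ℝ} (hC : IsCorr C) (hw : IsWeight w)
    (hs : 0 ≤ s) : ∀ᵐ y ∂field C s, y ∈ goodFields hw :=
  ae_all_iff.2 fun b : ℕ => ae_good_mul hC hw hs b

/-! ### The law of linear combinations of the fields in time -/

/-- The law of a sequence of independent noises. -/
abbrev noiseSeqLaw : Measure (ℕ → ℕ → ℝ) := Measure.infinitePi fun _ : ℕ => noiseLaw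

lemma measurable_smul_fieldOfNoise (C : ℕ → ℕ → ℝ) (b : ℝ) :
    Measurable fun (g : ℕ → ℝ) => b • fieldOfNoise C g :=
  (measurable_fieldOfNoise_right C).const_smul b

lemma map_smul_fieldOfNoise {C : ℕ → ℕ → ℝ} (hC : IsCorr C) (b : ℝ) :
    noiseLaw.map (fun g => b • fieldOfNoise C g) = field C (b ^ 2) := by
  have h := gaussField_map_smul hC.posSemidef b
  have hm : Measurable fun (y : ℕ → ℝ) i => b * y i := by fun_prop
  rw [gaussField, Measure.map_map hm (measurable_fieldOfNoise_right C)] at h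
  exact h

/-- For a fixed matrix the fields at different times are independent with the same covariance, so
the squares of the coefficients add up. All laws along time are reduced to this one-parameter
family. -/
lemma map_sum_fieldOfNoise {C : ℕ → ℕ → ℝ} (hC : IsCorr C) (c : ℕ → ℝ) (T : ℕ) :
    noiseSeqLaw.map (fun g => ∑ t ∈ Finset.range T, c t • fieldOfNoise C (g t)) =
      field C (∑ t ∈ Finset.range T, c t ^ 2) := by
  induction T with
  | zero =>
    simp only [Finset.range_zero, Finset.sum_empty]
    have h := map_smul_fieldOfNoise hC 0
    simp only [zero_smul, ne_eq, OfNat.ofNat_ne_zero, not_false_eq_true, zero_pow] at h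
    rw [← h, Measure.map_const, Measure.map_const, measure_univ, measure_univ]
  | succ T ih =>
    have hind : iIndepFun (fun (t : ℕ) (g : ℕ → ℕ → ℝ) => c t • fieldOfNoise C (g t))
        noiseSeqLaw :=
      iIndepFun_infinitePi (P := fun _ : ℕ => noiseLaw)
        (X := fun t g => c t • fieldOfNoise C g) fun t => measurable_smul_fieldOfNoise C _
    have hm : ∀ t, Measurable fun g : ℕ → ℕ → ℝ => c t • fieldOfNoise C (g t) := fun t =>
      (measurable_smul_fieldOfNoise C _).comp (measurable_pi_apply t)
    have h2 := hind.indepFun_finsetSum_of_notMem (s := Finset.range T) (i := T) hm (by simp)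
    have e1 : (∑ t ∈ Finset.range T, fun g : ℕ → ℕ → ℝ => c t • fieldOfNoise C (g t)) =
        fun g => ∑ t ∈ Finset.range T, c t • fieldOfNoise C (g t) := by
      ext g; simp
    rw [e1] at h2
    have hS : Measurable fun g : ℕ → ℕ → ℝ =>
        ∑ t ∈ Finset.range T, c t • fieldOfNoise C (g t) :=
      Finset.measurable_fun_sum _ fun t _ => hm t
    have h3 := (indepFun_iff_map_prod_eq_prod_map_map hS.aemeasurable (hm T).aemeasurable).1 h2
    have h4 : noiseSeqLaw.map (fun g => c T • fieldOfNoise C (g T)) = field C (c T ^ 2) := by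
      rw [← map_smul_fieldOfNoise hC, ← Measure.infinitePi_map_eval
        (μ := fun _ : ℕ => noiseLaw) T, Measure.map_map (measurable_smul_fieldOfNoise C _)
        (measurable_pi_apply T)]
      rfl
    rw [ih, h4] at h3
    rw [Finset.sum_range_succ, ← field_conv hC (Finset.sum_nonneg fun _ _ => sq_nonneg _)
      (sq_nonneg _), ← h3, Measure.map_map measurable_add_field (hS.prodMk (hm T))]
    congr 1
    ext g i
    simp [Finset.sum_range_succ]

/-- The configuration together with a linear combination of the first fields. -/
def combine (c : ℕ → ℝ) (T : ℕ) (x : Config × (ℕ → ℕ → ℝ)) : Config × (ℕ → ℝ) :=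
  (x.1, ∑ t ∈ Finset.range T, c t • x.2 t)

@[fun_prop]
lemma measurable_combine (c : ℕ → ℝ) (T : ℕ) : Measurable (combine c T) := by
  unfold combine
  fun_prop

section Laws

variable {P : Measure Config} [IsProbabilityMeasure P] {r : ℕ}

instance : IsProbabilityMeasure (forwardLaw P r) :=
  Measure.isProbabilityMeasure_map (measurable_forward r).aemeasurable

omit [IsProbabilityMeasure P] in
lemma forwardLaw_map_fst : (forwardLaw P r).map Prod.fst = P := by
  rw [forwardLaw, Measure.map_map measurable_fst (measurable_forward r)]
  exact measurePreserving_fst.map_eq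

omit [IsProbabilityMeasure P] in
lemma lintegral_forwardLaw_combine (hP : ∀ᵐ ω ∂P, IsAdmissible ω)
    {F : Config × (ℕ → ℝ) → ℝ≥0∞} (hF : Measurable F) (c : ℕ → ℝ)
    (T : ℕ) :
    ∫⁻ x, F (combine c T x) ∂forwardLaw P r =
      ∫⁻ ω, ∫⁻ y, F (ω, y) ∂field (entryPow r ω.2) (∑ t ∈ Finset.range T, c t ^ 2) ∂P := by
  have hm : Measurable fun x => F (combine c T x) := hF.comp (measurable_combine c T)
  rw [forwardLaw, lintegral_map hm (measurable_forward r)]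
  refine (lintegral_prod _ (hm.comp (measurable_forward r)).aemeasurable).trans
    (lintegral_congr_ae ?_)
  filter_upwards [hP] with ω hω
  rw [← map_sum_fieldOfNoise (isCorr_entryPow hω.isCorr r),
    lintegral_map (f := fun y => F (ω, y)) (hF.comp measurable_prodMk_left)]
  · rfl
  · exact Finset.measurable_fun_sum _ fun t _ =>
      (measurable_smul_fieldOfNoise _ _).comp (measurable_pi_apply t)

omit [IsProbabilityMeasure P] in
lemma ae_forwardLaw_combine (hP : ∀ᵐ ω ∂P, IsAdmissible ω)
    {p : Config × (ℕ → ℝ) → Prop} (hp : MeasurableSet {z | p z})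
    (c : ℕ → ℝ) (T : ℕ)
    (h : ∀ᵐ ω ∂P, ∀ᵐ y ∂field (entryPow r ω.2) (∑ t ∈ Finset.range T, c t ^ 2), p (ω, y)) :
    ∀ᵐ x ∂forwardLaw P r, p (combine c T x) := by
  have h1 := lintegral_forwardLaw_combine (r := r) hP
    (F := {z | p z}ᶜ.indicator 1) (measurable_one.indicator hp.compl) c T
  have h2 : ∫⁻ ω, ∫⁻ y, {z | p z}ᶜ.indicator 1 (ω, y)
      ∂field (entryPow r ω.2) (∑ t ∈ Finset.range T, c t ^ 2) ∂P = 0 := by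
    rw [← lintegral_zero (μ := P)]
    refine lintegral_congr_ae ?_
    filter_upwards [h] with ω hω
    rw [← lintegral_zero (μ := field (entryPow r ω.2) (∑ t ∈ Finset.range T, c t ^ 2))]
    refine lintegral_congr_ae ?_
    filter_upwards [hω] with y hy
    simp [hy]
  have hm : Measurable fun x : Config × (ℕ → ℕ → ℝ) =>
      {z | p z}ᶜ.indicator (1 : Config × (ℕ → ℝ) → ℝ≥0∞) (combine c T x) :=
    (measurable_one.indicator hp.compl).comp (measurable_combine c T)
  rw [h2, lintegral_eq_zero_iff hm] at h1
  filter_upwards [h1] with x hx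
  by_contra hn
  simp [Set.indicator, hn] at hx

lemma integral_forwardLaw_combine (hP : ∀ᵐ ω ∂P, IsAdmissible ω)
    {F : Config × (ℕ → ℝ) → ℝ} (hF : Measurable F) (c : ℕ → ℝ)
    (T : ℕ) (hi : Integrable (fun x => F (combine c T x)) (forwardLaw P r)) :
    ∫ x, F (combine c T x) ∂forwardLaw P r =
      ∫ ω, ∫ y, F (ω, y) ∂field (entryPow r ω.2) (∑ t ∈ Finset.range T, c t ^ 2) ∂P := by
  have hm : Measurable fun x => F (combine c T x) := hF.comp (measurable_combine c T)
  have hi' := (integrable_map_measure hm.aestronglyMeasurable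
    (measurable_forward r).aemeasurable).1 hi
  rw [forwardLaw, integral_map (measurable_forward r).aemeasurable hm.aestronglyMeasurable]
  refine (integral_prod _ hi').trans (integral_congr_ae ?_)
  filter_upwards [hP] with ω hω
  rw [← map_sum_fieldOfNoise (isCorr_entryPow hω.isCorr r), integral_map]
  · rfl
  · exact (Finset.measurable_fun_sum _ fun t _ =>
      (measurable_smul_fieldOfNoise _ _).comp (measurable_pi_apply t)).aemeasurable
  · exact (hF.comp measurable_prodMk_left).aestronglyMeasurable

end Laws

/-! ### The free energy of a configuration -/

/-- The free energy of a configuration, with the field of covariance `s Q^{*r}`. -/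
def freeEnergy (r : ℕ) (s : ℝ) (ω : Config) : ℝ :=
  ∫ g, lse ω.1 (√s • fieldOfNoise (entryPow r ω.2) g) ∂noiseLaw

lemma measurable_entryPow (r : ℕ) : Measurable (entryPow r) := by
  unfold entryPow
  fun_prop

lemma measurable_fieldOfNoise_config (r : ℕ) :
    Measurable fun p : Config × (ℕ → ℝ) => fieldOfNoise (entryPow r p.1.2) p.2 :=
  measurable_fieldOfNoise.comp (((measurable_entryPow r).comp
    (measurable_snd.comp measurable_fst)).prodMk measurable_snd)

lemma measurable_smul_fieldOfNoise_config (r : ℕ) (b : ℝ) :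
    Measurable fun p : Config × (ℕ → ℝ) => b • fieldOfNoise (entryPow r p.1.2) p.2 :=
  (measurable_fieldOfNoise_config r).const_smul b

lemma measurable_lse_fieldOfNoise (r : ℕ) (b : ℝ) :
    Measurable fun p : Config × (ℕ → ℝ) =>
      lse p.1.1 (b • fieldOfNoise (entryPow r p.1.2) p.2) :=
  measurable_lse.comp
    ((measurable_fst.comp measurable_fst).prodMk (measurable_smul_fieldOfNoise_config r b))

lemma measurable_freeEnergy (r : ℕ) (s : ℝ) : Measurable (freeEnergy r s) := by
  unfold freeEnergy
  exact measurable_integral_prod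
    (f := fun (ω : Config) g => lse ω.1 (√s • fieldOfNoise (entryPow r ω.2) g))
    (measurable_lse_fieldOfNoise r √s)

lemma freeEnergy_eq {ω : Config} (hω : IsAdmissible ω) (r : ℕ) {s : ℝ} (hs : 0 ≤ s) :
    freeEnergy r s ω = free (entryPow r ω.2) ω.1 s := by
  have h := map_smul_fieldOfNoise (isCorr_entryPow hω.isCorr r) √s
  rw [Real.sq_sqrt hs] at h
  rw [free, ← h, integral_map (measurable_smul_fieldOfNoise _ _).aemeasurable
    (measurable_lse_right _).aestronglyMeasurable]
  rfl

lemma freeEnergy_nonneg {ω : Config} (hω : IsAdmissible ω) (r : ℕ) {s : ℝ} (hs : 0 ≤ s) :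
    0 ≤ freeEnergy r s ω := by
  rw [freeEnergy_eq hω r hs]
  exact free_nonneg (isCorr_entryPow hω.isCorr r) hω.isWeight hs

lemma freeEnergy_le {ω : Config} (hω : IsAdmissible ω) (r : ℕ) {s : ℝ} (hs : 0 ≤ s) :
    freeEnergy r s ω ≤ s / 2 := by
  rw [freeEnergy_eq hω r hs]
  exact free_le (isCorr_entryPow hω.isCorr r) hω.isWeight hs

/-- The relabelling permutes weights and covariance together and is invisible to the free energy;
only the tilt remains. -/
lemma freeEnergy_evolve {ω : Config} (hω : IsAdmissible ω) (r : ℕ) {s : ℝ} (hs : 0 ≤ s) {l : ℝ}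
    {κ : ℕ → ℝ} (hκ : Good ω.1 (l • κ)) :
    freeEnergy r s (evolve (fun k => l * k) ω κ) =
      free (entryPow r ω.2) (tilt ω.1 (l • κ)) s := by
  have hκ' : Summable fun i => ω.1 i * Real.exp (l * κ i) := hκ.summable_exp hω.isWeight.nonneg
  rw [freeEnergy_eq (isAdmissible_evolve hω hκ') r hs]
  exact free_comp (w := tilt ω.1 (l • κ)) (isCorr_entryPow hω.isCorr r) hs (bijective_reorder hω hκ')

/-! ### Additivity and linearity of the mean free energy -/

section MeanFree

variable {P : Measure Config} [IsProbabilityMeasure P] {r : ℕ}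

/-- The mean free energy. -/
def meanFree (P : Measure Config) (r : ℕ) (s : ℝ) : ℝ := ∫ ω, freeEnergy r s ω ∂P

lemma integrable_freeEnergy (hP : ∀ᵐ ω ∂P, IsAdmissible ω) {s : ℝ} (hs : 0 ≤ s) :
    Integrable (freeEnergy r s) P := by
  refine Integrable.of_bound (measurable_freeEnergy r s).aestronglyMeasurable (s / 2) ?_
  filter_upwards [hP] with ω hω
  rw [Real.norm_of_nonneg (freeEnergy_nonneg hω r hs)]
  exact freeEnergy_le hω r hs

lemma measurable_lse_config : Measurable fun z : Config × (ℕ → ℝ) => lse z.1.1 z.2 :=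
  measurable_lse.comp ((measurable_fst.comp measurable_fst).prodMk measurable_snd)

lemma integrable_lse_combine (hP : ∀ᵐ ω ∂P, IsAdmissible ω) (c : ℕ → ℝ) (T : ℕ) :
    Integrable (fun x => lse (combine c T x).1.1 (combine c T x).2) (forwardLaw P r) := by
  refine integrable_of_lintegral_exp_abs
    (measurable_lse_config.comp (measurable_combine c T)).aestronglyMeasurable ?_
  have hm : Measurable fun z : Config × (ℕ → ℝ) =>
      ENNReal.ofReal (Real.exp |lse z.1.1 z.2|) :=
    (continuous_abs.measurable.comp measurable_lse_config).exp.ennreal_ofReal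
  rw [lintegral_forwardLaw_combine hP hm]
  refine ne_of_lt (lt_of_le_of_lt (lintegral_mono_ae (g := fun _ => ENNReal.ofReal
    (2 * Real.exp ((∑ t ∈ Finset.range T, c t ^ 2) / 2))) ?_) ?_)
  · filter_upwards [hP] with ω hω
    exact lintegral_exp_abs_lse_le (isCorr_entryPow hω.isCorr r) hω.isWeight
      (Finset.sum_nonneg fun _ _ => sq_nonneg _)
  · rw [lintegral_const, measure_univ, mul_one]
    exact ENNReal.ofReal_lt_top

lemma integral_lse_combine (hP : ∀ᵐ ω ∂P, IsAdmissible ω) (c : ℕ → ℝ) (T : ℕ) :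
    ∫ x, lse (combine c T x).1.1 (combine c T x).2 ∂forwardLaw P r =
      meanFree P r (∑ t ∈ Finset.range T, c t ^ 2) := by
  rw [integral_forwardLaw_combine hP measurable_lse_config c T (integrable_lse_combine hP c T),
    meanFree]
  refine integral_congr_ae ?_
  filter_upwards [hP] with ω hω
  rw [freeEnergy_eq hω r (Finset.sum_nonneg fun _ _ => sq_nonneg _), free]

lemma combine_one (l : ℝ) (x : Config × (ℕ → ℕ → ℝ)) :
    combine (fun _ => l) 1 x = (x.1, l • x.2 0) := by
  simp [combine]

/-- By `free_add`, the increment from l² to l² + s is the mean of the free energy at s of the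
tilted, that is evolved, configuration. Quasi-stationarity gives that configuration the law P. -/
lemma meanFree_add (hP : ∀ᵐ ω ∂P, IsAdmissible ω) {l : ℝ}
    (hl : IsQuasiStationary P (fun k => l * k) r) {s : ℝ} (hs : 0 ≤ s) :
    meanFree P r (l ^ 2 + s) = meanFree P r (l ^ 2) + meanFree P r s := by
  have hl2 := sq_nonneg l
  have hev : Measurable fun x : Config × (ℕ → ℕ → ℝ) => evolve (fun k => l * k) x.1 (x.2 0) :=
    (measurable_evolve (ψ := fun k => l * k) (by fun_prop)).comp
      (by fun_prop : Measurable fun x : Config × (ℕ → ℕ → ℝ) => (x.1, x.2 0))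
  have hev' : Measurable fun z : Config × (ℕ → ℝ) => evolve (fun k => k) z.1 z.2 :=
    measurable_evolve (ψ := fun k => k) (by fun_prop)
  -- Moving the factor l from the function to the field turns one evolution into a function of
  -- `combine (fun _ => l) 1`.
  have hconv : ∀ (ω : Config) (κ : ℕ → ℝ),
      evolve (fun k => l * k) ω κ = evolve (fun k => k) ω (l • κ) := fun ω κ => rfl
  have h1 : meanFree P r s = ∫ x, freeEnergy r s (evolve (fun k => l * k) x.1 (x.2 0))
      ∂forwardLaw P r := by
    conv_lhs => rw [meanFree, ← hl.map_eq]
    rw [integral_map hev.aemeasurable (measurable_freeEnergy r s).aestronglyMeasurable]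
  have hi : Integrable (fun x => freeEnergy r s (evolve (fun k => l * k) x.1 (x.2 0)))
      (forwardLaw P r) := by
    have := integrable_freeEnergy (r := r) hP hs
    rw [← hl.map_eq] at this
    exact this.comp_measurable hev
  have h2 := integral_forwardLaw_combine (r := r) hP
    (F := fun z => freeEnergy r s (evolve (fun k => k) z.1 z.2))
    ((measurable_freeEnergy r s).comp hev') (fun _ => l) 1
    (by simp only [combine_one]; exact hi)
  simp only [combine_one, ← hconv, Finset.range_one, Finset.sum_singleton] at h2
  rw [h1, h2, meanFree, meanFree, ← integral_add (integrable_freeEnergy hP hl2)]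
  · refine integral_congr_ae ?_
    filter_upwards [hP] with ω hω
    have hC := isCorr_entryPow hω.isCorr r
    rw [freeEnergy_eq hω r (add_nonneg hl2 hs), freeEnergy_eq hω r hl2,
      free_add hC hω.isWeight hl2 hs]
    congr 1
    refine integral_congr_ae ?_
    filter_upwards [ae_good hC hω.isWeight hl2] with y hy
    have := freeEnergy_evolve hω r hs (l := 1) (κ := y) (by rwa [one_smul])
    simp only [one_mul, one_smul] at this
    exact this.symm
  · have hi' := (integrable_map_measure (((measurable_freeEnergy r s).comp
      hev).aestronglyMeasurable) (measurable_forward r).aemeasurable).1 hi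
    refine hi'.integral_prod_left.congr ?_
    filter_upwards [hP] with ω hω
    have h := map_sum_fieldOfNoise (isCorr_entryPow hω.isCorr r) (fun _ => l) 1
    simp only [Finset.range_one, Finset.sum_singleton] at h
    rw [← h, integral_map]
    · rfl
    · exact ((measurable_smul_fieldOfNoise _ _).comp (measurable_pi_apply 0)).aemeasurable
    · exact (((measurable_freeEnergy r s).comp hev').comp
        measurable_prodMk_left).aestronglyMeasurable

/-- The mean overlap defect of the law. -/
def meanDefect (P : Measure Config) (r : ℕ) : ℝ :=
  ∫ ω, (defect (entryPow r ω.2) ω.1).toReal ∂P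

lemma tendsto_meanFree_div (hP : ∀ᵐ ω ∂P, IsAdmissible ω) {x : ℝ} (hx : 0 < x) (hx1 : x ≤ 1) :
    Tendsto (fun n : ℕ => ((n : ℝ) + 1) / x * meanFree P r (x / ((n : ℝ) + 1))) atTop
      (𝓝 (meanDefect P r / 2)) := by
  have hpos : ∀ n : ℕ, 0 < x / ((n : ℝ) + 1) := fun n => by positivity
  have h := tendsto_integral_of_dominated_convergence (μ := P)
    (F := fun (n : ℕ) ω => ((n : ℝ) + 1) / x * freeEnergy r (x / ((n : ℝ) + 1)) ω)
    (f := fun ω => (defect (entryPow r ω.2) ω.1).toReal / 2) (fun _ => 1 / 2)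
    (fun n => ((measurable_freeEnergy r _).const_mul _).aestronglyMeasurable)
    (integrable_const _)
    (fun n => by
      filter_upwards [hP] with ω hω
      rw [Real.norm_of_nonneg (mul_nonneg (by positivity)
        (freeEnergy_nonneg hω r (hpos n).le))]
      calc ((n : ℝ) + 1) / x * freeEnergy r (x / ((n : ℝ) + 1)) ω
          ≤ ((n : ℝ) + 1) / x * (x / ((n : ℝ) + 1) / 2) := by
            gcongr
            exact freeEnergy_le hω r (hpos n).le
        _ = 1 / 2 := by field_simp)
    (by
      filter_upwards [hP] with ω hω
      refine (tendsto_free_div (isCorr_entryPow hω.isCorr r) hω.isWeight hx hx1).congr fun n => ?_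
      rw [freeEnergy_eq hω r (hpos n).le])
  rw [integral_div] at h
  refine h.congr fun n => ?_
  rw [integral_const_mul, meanFree]

/-- Take the square root of l² + s with the sign of l. Only larger squares are needed, so l = 0
causes no trouble. -/
lemma exists_sq_eq {U : Set ℝ} (hU : IsOpen U) {l : ℝ} (hl : l ∈ U) :
    ∃ d > 0, ∀ s, 0 ≤ s → s < d → ∃ l' ∈ U, l' ^ 2 = l ^ 2 + s := by
  rcases le_total 0 l with h0 | h0
  · have hc : ContinuousAt (fun s : ℝ => √(l ^ 2 + s)) 0 := by fun_prop
    have h1 : ∀ᶠ s in 𝓝 (0 : ℝ), √(l ^ 2 + s) ∈ U :=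
      hc.eventually (by simpa [Real.sqrt_sq h0] using hU.mem_nhds hl)
    obtain ⟨d, hd, h⟩ := Metric.eventually_nhds_iff.1 h1
    refine ⟨d, hd, fun s hs hsd => ⟨_, h (y := s) (by simpa [abs_of_nonneg hs] using hsd), ?_⟩⟩
    rw [Real.sq_sqrt (by positivity)]
  · have hc : ContinuousAt (fun s : ℝ => -√(l ^ 2 + s)) 0 := by fun_prop
    have h1 : ∀ᶠ s in 𝓝 (0 : ℝ), -√(l ^ 2 + s) ∈ U :=
      hc.eventually (by simpa [Real.sqrt_sq_eq_abs, abs_of_nonpos h0] using hU.mem_nhds hl)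
    obtain ⟨d, hd, h⟩ := Metric.eventually_nhds_iff.1 h1
    refine ⟨d, hd, fun s hs hsd => ⟨_, h (y := s) (by simpa [abs_of_nonneg hs] using hsd), ?_⟩⟩
    rw [neg_sq, Real.sq_sqrt (by positivity)]

/-- Quasi-stationarity on an open set of parameters makes the mean free energy linear. -/
lemma meanFree_eq (hP : ∀ᵐ ω ∂P, IsAdmissible ω) {U : Set ℝ} (hU : IsOpen U)
    (hqs : ∀ l ∈ U, IsQuasiStationary P (fun k => l * k) r) {l : ℝ} (hl : l ∈ U) {x : ℝ}
    (hx : 0 ≤ x) : meanFree P r x = x * (meanDefect P r / 2) := by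
  obtain ⟨d, hd, hdU⟩ := exists_sq_eq hU hl
  -- M(l² + s + x) is computed in two ways: through the parameter l' with l'² = l² + s, and through
  -- l alone.
  have hadd : ∀ s, 0 ≤ s → s < d → ∀ x, 0 ≤ x →
      meanFree P r (x + s) = meanFree P r x + meanFree P r s := by
    intro s hs hsd x hx
    obtain ⟨l', hl', e⟩ := hdU s hs hsd
    have h1 := meanFree_add hP (hqs l' hl') hx
    have h2 := meanFree_add hP (hqs l hl) hs
    have h3 := meanFree_add hP (hqs l hl) (add_nonneg hx hs)
    rw [e, h2, show l ^ 2 + s + x = l ^ 2 + (x + s) by ring, h3] at h1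
    linarith
  have hzero : meanFree P r 0 = 0 := by
    have := hadd 0 le_rfl hd 0 le_rfl
    simpa using this
  have hmul : ∀ s, 0 ≤ s → s < d → ∀ n : ℕ, meanFree P r (n * s) = n * meanFree P r s := by
    intro s hs hsd n
    induction n with
    | zero => simp [hzero]
    | succ n ih =>
      rw [show ((n + 1 : ℕ) : ℝ) * s = n * s + s by push_cast; ring,
        hadd s hs hsd _ (by positivity), ih]
      push_cast
      ring
  have hsmall : ∀ x, 0 < x → ∀ᶠ n : ℕ in atTop, x / ((n : ℝ) + 1) < d := by
    intro x hx
    have h : Tendsto (fun n : ℕ => x / ((n : ℝ) + 1)) atTop (𝓝 0) := by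
      simpa [div_eq_mul_inv] using (tendsto_one_div_add_atTop_nhds_zero_nat (𝕜 := ℝ)).const_mul x
    exact h.eventually_lt_const hd
  have hscale : ∀ x, 0 < x → ∀ᶠ n : ℕ in atTop,
      meanFree P r x = ((n : ℝ) + 1) * meanFree P r (x / ((n : ℝ) + 1)) := by
    intro x hx
    filter_upwards [hsmall x hx] with n hn
    have h := hmul (x / ((n : ℝ) + 1)) (by positivity) hn (n + 1)
    push_cast at h
    rw [← h]
    congr 1
    field_simp
  -- The quotient M(x/(n+1)) / (x/(n+1)) is eventually the constant M(x)/x, and it tends to the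
  -- derivative at zero.
  have hle1 : ∀ x, 0 < x → x ≤ 1 → meanFree P r x = x * (meanDefect P r / 2) := by
    intro x hx hx1
    have h := (tendsto_meanFree_div (r := r) hP hx hx1).const_mul x
    refine tendsto_nhds_unique (tendsto_const_nhds.congr' ?_) h
    filter_upwards [hscale x hx] with n hn
    rw [hn]
    field_simp
  rcases hx.eq_or_lt with rfl | hx
  · simp [hzero]
  have hone : ∀ᶠ n : ℕ in atTop, x ≤ (n : ℝ) + 1 := by
    filter_upwards [tendsto_natCast_atTop_atTop.eventually_ge_atTop x] with n hn
    linarith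
  obtain ⟨n, hn1, hn2⟩ := ((hscale x hx).and hone).exists
  rw [hn1, hle1 _ (by positivity) ((div_le_one (by positivity)).2 hn2)]
  field_simp

end MeanFree

/-! ### The generating function -/

/-- The law of a quasi-stationary overlap structure is carried by the admissible configurations. -/
lemma IsROSt.ae_isAdmissible {P : Measure Config} (hP : IsROSt P) {ψ : ℝ → ℝ} (hψ : Measurable ψ)
    {r : ℕ} (hq : IsQuasiStationary P ψ r) : ∀ᵐ ω ∂P, IsAdmissible ω := by
  have := hP.isProbabilityMeasure
  have hmem : ∀ᵐ x ∂forwardLaw P r, x.1 ∈ overlapSpace := by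
    have h := hP.ae_mem
    rw [← forwardLaw_map_fst (P := P) (r := r)] at h
    exact ae_of_ae_map measurable_fst.aemeasurable h
  have hev : Measurable fun x : Config × (ℕ → ℕ → ℝ) => evolve ψ x.1 (x.2 0) :=
    (measurable_evolve hψ).comp (by fun_prop :
      Measurable fun x : Config × (ℕ → ℕ → ℝ) => (x.1, x.2 0))
  -- The space of overlap structures only requires mass at most one. The evolved weights have mass
  -- exactly one, and their law is that of ξ.
  have hw : ∀ᵐ ω ∂P, IsWeight ω.1 := by
    rw [← hq.map_eq]
    refine (ae_map_iff hev.aemeasurable (measurable_fst measurableSet_isWeight)).2 ?_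
    filter_upwards [hmem, hq.nonsingular] with x hx hns
    obtain ⟨hanti, hnn, -, -, -, -⟩ := hx
    have hs : Summable fun j => x.1.1 j * Real.exp (ψ (x.2 0 j)) :=
      summable_of_tsum_ofReal_ne_top (fun j => mul_nonneg (hnn j) (Real.exp_pos _).le) hns.2
    have hpos : 0 < (mass ψ x.1 (x.2 0)).toReal := ENNReal.toReal_pos hns.1 hns.2
    have hmass : (mass ψ x.1 (x.2 0)).toReal = ∑' j, x.1.1 j * Real.exp (ψ (x.2 0 j)) :=
      total_eq hnn _
    have hn0 : ∀ i, 0 ≤ newWeight ψ x.1 (x.2 0) i := fun i =>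
      div_nonneg (mul_nonneg (hnn i) (Real.exp_pos _).le) hpos.le
    have hsum : HasSum (newWeight ψ x.1 (x.2 0)) 1 := by
      have h := hs.hasSum.div_const (mass ψ x.1 (x.2 0)).toReal
      rw [← hmass, div_self hpos.ne'] at h
      exact h
    have hiff : ∀ i, newWeight ψ x.1 (x.2 0) i = 0 ↔ x.1.1 i = 0 := fun i => by
      simp [newWeight, hpos.ne', (Real.exp_pos _).ne']
    have hfin := finite_precedes hn0 hsum.summable fun i j hij h =>
      (hiff j).2 (le_antisymm (((hiff i).1 h) ▸ hanti hij) (hnn j))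
    exact IsWeight.comp ⟨hn0, hsum⟩ (bijective_order hfin)
  filter_upwards [hw, hP.ae_mem] with ω hω hmem
  obtain ⟨hanti, -, -, -, hpsd, hdiag⟩ := hmem
  exact ⟨hanti, hω, hpsd, hdiag⟩

variable {P : Measure Config} {r : ℕ}

lemma lse_combine_one (l : ℝ) (x : Config × (ℕ → ℕ → ℝ)) :
    lse (combine (fun _ => l) 1 x).1.1 (combine (fun _ => l) 1 x).2 =
      Real.log (mass (fun k => l * k) x.1 (x.2 0)).toReal := by
  rw [combine_one]
  rfl

lemma integrable_log_mass [IsProbabilityMeasure P] (hP : ∀ᵐ ω ∂P, IsAdmissible ω) (l : ℝ) :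
    Integrable (fun x => Real.log (mass (fun k => l * k) x.1 (x.2 0)).toReal) (forwardLaw P r) := by
  have h := integrable_lse_combine (r := r) hP (fun _ => l) 1
  simpa only [lse_combine_one] using h

lemma generating_eq [IsProbabilityMeasure P] (hP : ∀ᵐ ω ∂P, IsAdmissible ω) (l : ℝ) :
    generating P r l = meanFree P r (l ^ 2) := by
  have h := integral_lse_combine (r := r) hP (fun _ => l) 1
  simp only [lse_combine_one, Finset.range_one, Finset.sum_singleton] at h
  exact h

lemma lintegral_overlapMeasure (P : Measure Config) {f : ℝ → ℝ≥0∞} (hf : Measurable f) :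
    ∫⁻ q, f q ∂overlapMeasure P =
      ∫⁻ ω, ∑' p : ℕ × ℕ, ENNReal.ofReal (ω.1 p.1 * ω.1 p.2) * f (ω.2 p.1 p.2) ∂P := by
  have hm : ∀ p : ℕ × ℕ, Measurable fun ω : Config => ω.2 p.1 p.2 := fun p => by fun_prop
  have hd : ∀ p : ℕ × ℕ, Measurable fun ω : Config => ENNReal.ofReal (ω.1 p.1 * ω.1 p.2) :=
    fun p => by fun_prop
  rw [overlapMeasure, lintegral_sum_measure]
  refine Eq.trans (tsum_congr fun p => ?_) (lintegral_tsum fun p =>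
    ((hd p).mul (hf.comp (hm p))).aemeasurable).symm
  rw [lintegral_map hf (hm p)]
  exact lintegral_withDensity_eq_lintegral_mul _ (hd p) (hf.comp (hm p))

lemma measurable_defect (r : ℕ) :
    Measurable fun ω : Config => defect (entryPow r ω.2) ω.1 := by
  unfold defect entryPow
  exact Measurable.tsum fun p => by fun_prop

/-- Overlaps of a correlation matrix lie in [-1, 1], so the restriction to this interval loses
nothing. -/
lemma setIntegral_overlapMeasure (hP : ∀ᵐ ω ∂P, IsAdmissible ω) :
    ∫ q in Set.Icc (-1 : ℝ) 1, (1 - q ^ r : ℝ) ∂(overlapMeasure P) = meanDefect P r := by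
  have hnn : ∀ q ∈ Set.Icc (-1 : ℝ) 1, 0 ≤ 1 - q ^ r := fun q hq => by
    have : |q ^ r| ≤ 1 := by
      rw [abs_pow]
      exact pow_le_one₀ (abs_nonneg q) (abs_le.2 hq)
    linarith [le_abs_self (q ^ r)]
  have hm : Measurable fun q : ℝ => ENNReal.ofReal (1 - q ^ r) := by fun_prop
  rw [integral_eq_lintegral_of_nonneg_ae
    ((ae_restrict_iff' measurableSet_Icc).2 (ae_of_all _ hnn)) (by fun_prop),
    ← lintegral_indicator measurableSet_Icc,
    lintegral_overlapMeasure P (hm.indicator measurableSet_Icc), meanDefect,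
    integral_toReal (measurable_defect r).aemeasurable]
  · congr 1
    refine lintegral_congr_ae ?_
    filter_upwards [hP] with ω hω
    refine tsum_congr fun p => ?_
    have hq : ω.2 p.1 p.2 ∈ Set.Icc (-1 : ℝ) 1 := ⟨hω.isCorr.neg_one_le _ _, hω.isCorr.le_one _ _⟩
    rw [Set.indicator_of_mem hq,
      ← ENNReal.ofReal_mul (mul_nonneg (hω.isWeight.nonneg _) (hω.isWeight.nonneg _))]
    rfl
  · filter_upwards [hP] with ω hω
    exact (defect_le (isCorr_entryPow hω.isCorr r) hω.isWeight).trans_lt (by simp)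

lemma meanDefect_nonneg : 0 ≤ meanDefect P r := integral_nonneg fun _ => ENNReal.toReal_nonneg

/-! ### Stationarity of the forward dynamics -/

/-- The sequence `a, g 0, g 1, …`. -/
def prepend {E : Type*} (a : E) (g : ℕ → E) : ℕ → E
  | 0 => a
  | n + 1 => g n

lemma measurable_prepend {E : Type*} [MeasurableSpace E] :
    Measurable fun p : E × (ℕ → E) => prepend p.1 p.2 := by
  refine measurable_pi_lambda _ fun t => ?_
  cases t with
  | zero => exact measurable_fst
  | succ n => exact (measurable_pi_apply n).comp measurable_snd

lemma infinitePi_map_prepend {E : Type*} [MeasurableSpace E] (ν : Measure E)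
    [IsProbabilityMeasure ν] :
    (ν.prod (Measure.infinitePi fun _ : ℕ => ν)).map (fun p => prepend p.1 p.2) =
      Measure.infinitePi fun _ : ℕ => ν := by
  refine Measure.eq_infinitePi _ fun s t ht => ?_
  have hs' : ∀ i ∈ s.preimage Nat.succ Nat.succ_injective.injOn, MeasurableSet (t (i + 1)) :=
    fun i _ => ht _
  have hpi : MeasurableSet (Set.pi (s : Set ℕ) t) :=
    MeasurableSet.pi s.countable_toSet fun i _ => ht i
  have hprod : ∏ i ∈ s, ν (t i) = (if 0 ∈ s then ν (t 0) else 1) *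
      ∏ i ∈ s.preimage Nat.succ Nat.succ_injective.injOn, ν (t (i + 1)) := by
    have e : s.erase 0 =
        (s.preimage Nat.succ Nat.succ_injective.injOn).map ⟨Nat.succ, Nat.succ_injective⟩ := by
      ext i
      cases i <;> simp
    have e2 : ∏ i ∈ s.erase 0, ν (t i) =
        ∏ i ∈ s.preimage Nat.succ Nat.succ_injective.injOn, ν (t (i + 1)) := by
      rw [e, Finset.prod_map]
      rfl
    rw [← e2]
    split_ifs with h
    · exact (Finset.mul_prod_erase s (fun i => ν (t i)) h).symm
    · rw [Finset.erase_eq_of_notMem h, one_mul]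
  have hpre : (fun p : E × (ℕ → E) => prepend p.1 p.2) ⁻¹' Set.pi (s : Set ℕ) t =
      (if 0 ∈ s then t 0 else Set.univ) ×ˢ
        Set.pi (s.preimage Nat.succ Nat.succ_injective.injOn : Finset ℕ) fun i => t (i + 1) := by
    ext p
    simp only [Set.mem_preimage, Set.mem_pi, Set.mem_prod, SetLike.mem_coe,
      Finset.mem_preimage]
    constructor
    · intro h
      refine ⟨?_, fun i hi => h (i + 1) hi⟩
      split_ifs with h0
      · exact h 0 h0
      · trivial
    · rintro ⟨h0, h1⟩ i hi
      cases i with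
      | zero => simpa [hi, prepend] using h0
      | succ n => exact h1 n hi
  rw [Measure.map_apply measurable_prepend hpi, hpre, Measure.prod_prod,
    Measure.infinitePi_pi _ hs', hprod]
  congr 1
  split_ifs <;> simp

/-- A configuration with the fields at the times `0, 1, …`. -/
abbrev Forward : Type := Config × (ℕ → ℕ → ℝ)

/-- Evolve with the field at time `T`, and relabel all fields. -/
def stepAt (ψ : ℝ → ℝ) (T : ℕ) (y : Forward) : Forward :=
  (evolve ψ y.1 (y.2 T), fun t n => y.2 t (reorder ψ y.1 (y.2 T) n))

/-- Forget the first field. -/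
def drop (y : Forward) : Forward := (y.1, fun t => y.2 (t + 1))

/-- Evolve with the first field and forget it. -/
def step (ψ : ℝ → ℝ) (y : Forward) : Forward := drop (stepAt ψ 0 y)

lemma measurable_drop : Measurable drop := by
  unfold drop
  fun_prop

section Step

variable {ψ : ℝ → ℝ}

lemma measurable_stepAt (hψ : Measurable ψ) (T : ℕ) : Measurable (stepAt ψ T) := by
  have h0 : Measurable fun y : Forward => ((y.1, y.2 T) : Config × (ℕ → ℝ)) := by fun_prop
  refine Measurable.prodMk ((measurable_evolve hψ).comp h0)
    (measurable_pi_lambda _ fun t => measurable_pi_lambda _ fun n => ?_)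
  have h : Measurable fun p : (ℕ → ℝ) × ℕ => p.1 p.2 :=
    measurable_from_prod_countable_left fun i => measurable_pi_apply i
  exact h.comp (Measurable.prodMk (by fun_prop) ((measurable_reorder hψ n).comp h0))

lemma measurable_step (hψ : Measurable ψ) : Measurable (step ψ) :=
  measurable_drop.comp (measurable_stepAt hψ 0)

lemma measurable_fields (C : ℕ → ℕ → ℝ) :
    Measurable fun (g : ℕ → ℕ → ℝ) t => fieldOfNoise C (g t) :=
  measurable_pi_lambda _ fun t => (measurable_fieldOfNoise_right C).comp (measurable_pi_apply t)

lemma map_fields (C : ℕ → ℕ → ℝ) :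
    noiseSeqLaw.map (fun g t => fieldOfNoise C (g t)) =
      Measure.infinitePi fun _ : ℕ => gaussField C :=
  Measure.infinitePi_map_pi (fun _ : ℕ => noiseLaw) fun _ => measurable_fieldOfNoise_right C

instance (C : ℕ → ℕ → ℝ) : IsProbabilityMeasure (gaussField C) :=
  Measure.isProbabilityMeasure_map (measurable_fieldOfNoise_right C).aemeasurable

lemma map_fields_comp {C : ℕ → ℕ → ℝ} (hC : (Matrix.of C).PosSemidef) (f : ℕ → ℕ) :
    noiseSeqLaw.map (fun g t n => fieldOfNoise C (g t) (f n)) =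
      noiseSeqLaw.map (fun g t => fieldOfNoise (fun i j => C (f i) (f j)) (g t)) := by
  have hm : Measurable fun (y : ℕ → ℝ) n => y (f n) := by fun_prop
  have h := Measure.infinitePi_map_pi (fun _ : ℕ => gaussField C) (fun _ => hm)
  rw [gaussField_map_comp hC f, ← map_fields, ← map_fields, Measure.map_map (by fun_prop)
    (measurable_fields C)] at h
  exact h

lemma lintegral_forwardLaw (P : Measure Config) [IsProbabilityMeasure P] (r : ℕ)
    {F : Forward → ℝ≥0∞} (hF : Measurable F) :
    ∫⁻ y, F y ∂forwardLaw P r = ∫⁻ ω, ∫⁻ g, F (ω, fun t => fieldOfNoise (entryPow r ω.2) (g t))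
      ∂noiseSeqLaw ∂P := by
  rw [forwardLaw, lintegral_map hF (measurable_forward r)]
  exact lintegral_prod _ (hF.comp (measurable_forward r)).aemeasurable

lemma lintegral_forwardLaw_prepend (P : Measure Config) [IsProbabilityMeasure P] (r : ℕ)
    {F : Forward → ℝ≥0∞} (hF : Measurable F) :
    ∫⁻ y, F y ∂forwardLaw P r = ∫⁻ ω, ∫⁻ a, ∫⁻ g, F (ω, prepend (fieldOfNoise (entryPow r ω.2) a)
      fun t => fieldOfNoise (entryPow r ω.2) (g t)) ∂noiseSeqLaw ∂noiseLaw ∂P := by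
  rw [lintegral_forwardLaw P r hF]
  refine lintegral_congr fun ω => ?_
  have hm : Measurable fun g : ℕ → ℕ → ℝ =>
      F (ω, fun t => fieldOfNoise (entryPow r ω.2) (g t)) :=
    hF.comp (measurable_prodMk_left.comp (measurable_fields _))
  have e : ∀ p : (ℕ → ℝ) × (ℕ → ℕ → ℝ),
      (fun t => fieldOfNoise (entryPow r ω.2) (prepend p.1 p.2 t)) =
        prepend (fieldOfNoise (entryPow r ω.2) p.1)
          fun t => fieldOfNoise (entryPow r ω.2) (p.2 t) := by
    intro p
    funext t
    cases t <;> rfl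
  have h := congrArg (fun m => ∫⁻ g, F (ω, fun t => fieldOfNoise (entryPow r ω.2) (g t)) ∂m)
    (infinitePi_map_prepend noiseLaw)
  simp only at h
  rw [lintegral_map hm measurable_prepend] at h
  simp only [e] at h
  refine h.symm.trans (lintegral_prod _ (Measurable.aemeasurable ?_))
  have := hm.comp measurable_prepend
  simpa only [Function.comp_def, e] using this

/-- The forward law is stationary. -/
lemma forwardLaw_map_step {P : Measure Config} [IsProbabilityMeasure P] {r : ℕ}
    (hP : ∀ᵐ ω ∂P, IsAdmissible ω) (hψ : Measurable ψ) (hq : IsQuasiStationary P ψ r) :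
    (forwardLaw P r).map (step ψ) = forwardLaw P r := by
  refine Measure.ext_of_lintegral _ fun f hf => ?_
  rw [lintegral_map hf (measurable_step hψ)]
  refine (lintegral_forwardLaw_prepend P r (hf.comp (measurable_step hψ))).trans ?_
  have hG : Measurable fun ω : Config =>
      ∫⁻ g, f (ω, fun t => fieldOfNoise (entryPow r ω.2) (g t)) ∂noiseSeqLaw :=
    (hf.comp (measurable_forward r)).lintegral_prod_right'
  have hev : Measurable fun y : Forward => evolve ψ y.1 (y.2 0) :=
    (measurable_evolve hψ).comp (by fun_prop : Measurable fun y : Forward => (y.1, y.2 0))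
  rw [lintegral_forwardLaw P r hf]
  conv_rhs => rw [← hq.map_eq]
  rw [lintegral_map hG hev]
  refine Eq.trans ?_ (lintegral_forwardLaw_prepend P r (hG.comp hev)).symm
  refine lintegral_congr_ae ?_
  filter_upwards [hP] with ω hω
  refine lintegral_congr fun a => ?_
  have hC := (isCorr_entryPow hω.isCorr r).posSemidef
  have h1 := lintegral_const (μ := noiseSeqLaw) (∫⁻ g, f (evolve ψ ω (fieldOfNoise
    (entryPow r ω.2) a), fun t => fieldOfNoise (entryPow r (evolve ψ ω (fieldOfNoise
    (entryPow r ω.2) a)).2) (g t)) ∂noiseSeqLaw)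
  rw [measure_univ, mul_one] at h1
  refine Eq.trans ?_ h1.symm
  set κ := fieldOfNoise (entryPow r ω.2) a
  -- With ω and the first field fixed, the reordering is a deterministic map. The later fields,
  -- relabelled by it, are independent with the covariance of the evolved configuration.
  have h := map_fields_comp hC (reorder ψ ω κ)
  have hf' : Measurable fun k : ℕ → ℕ → ℝ => f (evolve ψ ω κ, k) := hf.comp measurable_prodMk_left
  have h' := congrArg (fun m => ∫⁻ k, f (evolve ψ ω κ, k) ∂m) h
  rw [lintegral_map hf' (measurable_fields _), lintegral_map hf'] at h'
  · exact h'
  · refine measurable_pi_lambda _ fun t => measurable_pi_lambda _ fun n => ?_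
    exact (measurable_pi_apply _).comp ((measurable_fieldOfNoise_right _).comp
      (measurable_pi_apply t))

end Step

/-! ### The natural extension of a measure preserving map -/

/-- Run the stationary process backwards: the kernel K, the conditional law of a point given its
image under S, defines a Markov chain whose n-th coordinate plays the state at time -n. Each pair (z
n, z (n + 1)) then has the law of (S a, a). -/
lemma exists_natural_extension {Y : Type*} [MeasurableSpace Y] [StandardBorelSpace Y] [Nonempty Y]
    {ν : Measure Y} [IsProbabilityMeasure ν] {S : Y → Y} (hS : Measurable S)
    (hν : ν.map S = ν) :
    ∃ ρ : Measure (ℕ → Y), IsProbabilityMeasure ρ ∧ (∀ n, ρ.map (fun z => z n) = ν) ∧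
      ∀ᵐ z ∂ρ, ∀ n, S (z (n + 1)) = z n := by
  set K := condDistrib (id : Y → Y) S ν
  have hK : ν ⊗ₘ K = ν.map fun a => (S a, a) := by
    have h := compProd_map_condDistrib (mβ := inferInstance) (X := S) (μ := ν) (Y := (id : Y → Y)) aemeasurable_id
    rwa [hν] at h
  let κ : (n : ℕ) → Kernel ((i : Finset.Iic n) → (fun _ : ℕ => Y) i) Y := fun n =>
    K.comap (fun p => p ⟨n, by simp⟩) (measurable_pi_apply _)
  have hκ : ∀ n, IsMarkovKernel (κ n) := fun n => Kernel.IsMarkovKernel.comap _ _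
  set ρ := Kernel.trajMeasure (X := fun _ => Y) ν κ
  -- The transition kernel only reads the last coordinate, so the law of a consecutive pair is its
  -- first marginal composed with K.
  have hpair : ∀ n, ρ.map (fun z => z n) ⊗ₘ K = ρ.map fun z => (z n, z (n + 1)) := by
    intro n
    have h := Kernel.map_frestrictLe_trajMeasure_compProd_eq_map_trajMeasure
      (X := fun _ => Y) (μ₀ := ν) (κ := κ) (a := n)
    refine Measure.ext_of_lintegral _ fun f hf => ?_
    have hf2 : Measurable fun p : ((i : Finset.Iic n) → (fun _ : ℕ => Y) i) × Y =>
        f (p.1 ⟨n, by simp⟩, p.2) := by fun_prop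
    have h2 := congrArg (fun m => ∫⁻ p, f (p.1 ⟨n, by simp⟩, p.2) ∂m) h
    rw [Measure.lintegral_compProd hf2, lintegral_map hf2 (by fun_prop),
      lintegral_map (by exact hf2.lintegral_kernel_prod_right') (by fun_prop)] at h2
    rw [Measure.lintegral_compProd hf, lintegral_map hf (by fun_prop),
      lintegral_map (by exact hf.lintegral_kernel_prod_right') (by fun_prop)]
    exact h2
  have hzero : ρ.map (fun z => z 0) = ν := by
    have h : ρ.map (Preorder.frestrictLe 0) =
        ν.map (MeasurableEquiv.piUnique fun _ : Finset.Iic 0 => Y).symm := by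
      simp only [ρ, Kernel.trajMeasure]
      rw [Measure.map_comp _ _ (by fun_prop), Kernel.traj_map_frestrictLe,
        Kernel.partialTraj_self]
      exact Measure.id_comp
    have h2 := congrArg (Measure.map fun p => p ⟨0, by simp⟩) h
    rw [Measure.map_map (by fun_prop) (by fun_prop),
      Measure.map_map (by fun_prop) (by fun_prop)] at h2
    refine h2.trans ?_
    convert Measure.map_id using 2
    funext a
    have h3 := (MeasurableEquiv.piUnique fun _ : Finset.Iic 0 => Y).apply_symm_apply a
    refine Eq.trans ?_ h3
    have h4 : (⟨0, by simp⟩ : Finset.Iic 0) = default := Subsingleton.elim _ _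
    change (MeasurableEquiv.piUnique fun _ : Finset.Iic 0 => Y).symm a ⟨0, by simp⟩ =
      (MeasurableEquiv.piUnique fun _ : Finset.Iic 0 => Y).symm a default
    rw [h4]
  have hmarg : ∀ n, ρ.map (fun z => z n) = ν := by
    intro n
    induction n with
    | zero => exact hzero
    | succ n ih =>
      have h := hpair n
      rw [ih, hK] at h
      have h2 := congrArg (Measure.map Prod.snd) h
      rw [Measure.map_map measurable_snd (by fun_prop),
        Measure.map_map measurable_snd (by fun_prop)] at h2
      exact h2.symm.trans (Measure.map_id)
  refine ⟨ρ, inferInstance, hmarg, ae_all_iff.2 fun n => ?_⟩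
  have h := hpair n
  rw [hmarg n, hK] at h
  have hset : MeasurableSet {p : Y × Y | S p.2 = p.1} :=
    measurableSet_eq_fun (hS.comp measurable_snd) measurable_fst
  have h2 : ∀ᵐ p ∂ρ.map fun z => (z n, z (n + 1)), S p.2 = p.1 := by
    rw [← h]
    exact (ae_map_iff (by fun_prop) hset).2 (ae_of_all _ fun _ => rfl)
  exact ae_of_ae_map (by fun_prop) h2

/-! ### The two-sided extension -/

/-- The path seen from time `-T` on. -/
def past (T : ℕ) (x : Path) : Forward := (x.1, fun t => x.2 ((t : ℤ) - T))

/-- The path with the given views from the times `-T`. -/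
def assemble (z : ℕ → Forward) : Path :=
  ((z 0).1, fun t => (z t.natAbs).2 (t + t.natAbs).toNat)

lemma measurable_past (T : ℕ) : Measurable (past T) := by
  unfold past
  fun_prop

lemma measurable_assemble : Measurable assemble := by
  unfold assemble
  fun_prop

lemma assemble_past (x : Path) : assemble (fun T => past T x) = x := by
  refine Prod.ext rfl (funext fun t => ?_)
  exact congrArg x.2 (by omega)

lemma drop_past (T : ℕ) (x : Path) : drop (past (T + 1) x) = past T x := by
  refine Prod.ext rfl (funext fun t => ?_)
  exact congrArg x.2 (by push_cast; ring)

lemma iterate_drop_past (T k : ℕ) (x : Path) : drop^[k] (past (T + k) x) = past T x := by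
  induction k with
  | zero => rfl
  | succ k ih => rw [Function.iterate_succ_apply, ← add_assoc, drop_past, ih]

/-- The view from -T determines the later views by dropping fields. So the laws of the single views
determine all finite joint laws of views, and the path is assembled from them. -/
lemma measure_path_ext {μ μ' : Measure Path} [IsProbabilityMeasure μ] [IsProbabilityMeasure μ']
    (h : ∀ T, μ.map (past T) = μ'.map (past T)) : μ = μ' := by
  have hseq : Measurable fun (x : Path) T => past T x := measurable_pi_lambda _ measurable_past
  have hrec : ∀ m : Measure Path, (m.map fun x T => past T x).map assemble = m := fun m => by
    rw [Measure.map_map measurable_assemble hseq]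
    convert Measure.map_id using 2
    exact funext assemble_past
  have hI : ∀ (m : Measure Path) (I : Finset ℕ),
      (m.map fun x T => past T x).map I.restrict =
        (m.map (past (I.sup id))).map fun y (i : I) => drop^[I.sup id - i] y := by
    intro m I
    rw [Measure.map_map (Finset.measurable_restrict I) hseq, Measure.map_map _ (measurable_past _)]
    · congr 1
      funext x i
      have hi : (i : ℕ) ≤ I.sup id := Finset.le_sup (f := id) i.2
      have := iterate_drop_past i (I.sup id - i) x
      rw [Nat.add_sub_cancel' hi] at this
      exact this.symm
    · exact measurable_pi_lambda _ fun i => measurable_drop.iterate _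
  rw [← hrec μ, ← hrec μ']
  congr 1
  have : IsProbabilityMeasure (μ'.map fun x T => past T x) :=
    Measure.isProbabilityMeasure_map hseq.aemeasurable
  have hp : ∀ I : Finset ℕ, IsFiniteMeasure ((μ'.map fun x T => past T x).map I.restrict) :=
    fun I => inferInstance
  refine IsProjectiveLimit.unique (P := fun I : Finset ℕ =>
    (μ'.map fun x T => past T x).map I.restrict) (fun I => ?_) fun I => rfl
  exact (hI μ I).trans ((congrArg (Measure.map _) (h _)).trans (hI μ' I).symm)

section Extension

variable {P : Measure Config} {r : ℕ} {ψ : ℝ → ℝ}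

lemma past_succ_shiftEvolve (T : ℕ) (x : Path) :
    past (T + 1) (shiftEvolve ψ x) = stepAt ψ T (past T x) := by
  have h0 : (past T x).2 T = x.2 0 := by simp [past]
  refine Prod.ext ?_ (funext fun t => funext fun n => ?_)
  · simp only [stepAt, h0]
    rfl
  · simp only [stepAt, h0]
    exact congrFun (congrArg x.2 (by push_cast; ring)) _

lemma past_zero_shiftEvolve (x : Path) : past 0 (shiftEvolve ψ x) = step ψ (past 0 x) := by
  rw [step, ← past_succ_shiftEvolve, drop_past]

lemma past_zero_eq : past 0 = fun x : Path => (x.1, fun t : ℕ => x.2 (t : ℤ)) := by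
  funext x
  simp [past]

/-- The view from time `-T`, from the configuration at time `-T` and the following fields. -/
def replay (ψ : ℝ → ℝ) : ℕ → Forward → Forward
  | 0, y => y
  | T + 1, y => stepAt ψ T (replay ψ T y)

lemma measurable_replay (hψ : Measurable ψ) (T : ℕ) : Measurable (replay ψ T) := by
  induction T with
  | zero => exact measurable_id
  | succ T ih => exact (measurable_stepAt hψ T).comp ih

/-- Consistency: views from -(T+1) and -T describe the same path as soon as the states at these two
times are related by `step`. -/
lemma drop_replay_succ (T : ℕ) (y : Forward) :
    drop (replay ψ (T + 1) y) = replay ψ T (step ψ y) := by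
  induction T with
  | zero => rfl
  | succ T ih =>
    change drop (stepAt ψ (T + 1) (replay ψ (T + 1) y)) = stepAt ψ T (replay ψ T (step ψ y))
    rw [← ih]
    rfl

/-- The reason for uniqueness: by invariance, an extension looks from time -T on like the forward
law replayed for T steps, with all fields carried into the current labels. -/
lemma IsExtension.map_past {μ : Measure Path} (hψ : Measurable ψ) (h : IsExtension P ψ r μ)
    (T : ℕ) : μ.map (past T) = (forwardLaw P r).map (replay ψ T) := by
  induction T with
  | zero =>
    rw [past_zero_eq, h.forward]
    exact Measure.map_id.symm
  | succ T ih =>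
    conv_lhs => rw [← h.invariant.map_eq]
    rw [Measure.map_map (measurable_past _) (measurable_shiftEvolve hψ)]
    have e : past (T + 1) ∘ shiftEvolve ψ = stepAt ψ T ∘ past T :=
      funext fun x => past_succ_shiftEvolve T x
    rw [e, ← Measure.map_map (measurable_stepAt hψ T) (measurable_past T), ih,
      Measure.map_map (measurable_stepAt hψ T) (measurable_replay hψ T)]
    rfl

lemma past_assemble {w : ℕ → Forward} (hw : ∀ T, drop (w (T + 1)) = w T) (T : ℕ) :
    past T (assemble w) = w T := by
  have h1 : ∀ T, (w T).1 = (w 0).1 := by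
    intro T
    induction T with
    | zero => rfl
    | succ T ih => rw [← ih, ← hw T]; rfl
  have h2 : ∀ k T s, (w (T + k)).2 (s + k) = (w T).2 s := by
    intro k
    induction k with
    | zero => intro T s; rfl
    | succ k ih => intro T s; rw [← ih T s, ← hw (T + k)]; rfl
  -- A field depends only on its time, that is on the index minus the depth of the view.
  have h3 : ∀ a b a' b' : ℕ, a + b' = a' + b → (w a).2 b = (w a').2 b' := by
    intro a b a' b' h
    rcases le_total a a' with hle | hle
    · obtain ⟨k, rfl⟩ := Nat.exists_eq_add_of_le hle
      rw [show b' = b + k by omega, h2]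
    · obtain ⟨k, rfl⟩ := Nat.exists_eq_add_of_le hle
      rw [show b = b' + k by omega, h2]
  refine Prod.ext (h1 T).symm (funext fun s => ?_)
  simp only [past, assemble]
  apply h3
  omega

/-- The extension of the forward law to all times. -/
lemma existsUnique_isExtension [IsProbabilityMeasure P] (hP : ∀ᵐ ω ∂P, IsAdmissible ω)
    (hψ : Measurable ψ) (hq : IsQuasiStationary P ψ r) : ∃! μ, IsExtension P ψ r μ := by
  obtain ⟨ρ, hρ, hmarg, hcons⟩ := exists_natural_extension (measurable_step hψ)
    (forwardLaw_map_step hP hψ hq)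
  have hw : Measurable fun (z : ℕ → Forward) T => replay ψ T (z T) :=
    measurable_pi_lambda _ fun T => (measurable_replay hψ T).comp (measurable_pi_apply T)
  have hm : Measurable fun z : ℕ → Forward => assemble fun T => replay ψ T (z T) :=
    measurable_assemble.comp hw
  -- The coordinate z T is the state at time -T in the labels of that time; `replay` carries it and
  -- its fields to the labels of time 0.
  set μ := ρ.map fun z => assemble fun T => replay ψ T (z T) with hμ
  have hμp : IsProbabilityMeasure μ := Measure.isProbabilityMeasure_map hm.aemeasurable
  have hpast : ∀ T, μ.map (past T) = (forwardLaw P r).map (replay ψ T) := by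
    intro T
    rw [hμ, Measure.map_map (measurable_past T) hm, ← hmarg T,
      Measure.map_map (measurable_replay hψ T) (measurable_pi_apply T)]
    refine Measure.map_congr ?_
    filter_upwards [hcons] with z hz
    exact past_assemble (w := fun T => replay ψ T (z T))
      (fun T => by rw [drop_replay_succ, hz]) T
  refine ⟨μ, ⟨hμp, ⟨measurable_shiftEvolve hψ, ?_⟩, ?_⟩, fun μ' h' => ?_⟩
  · have : IsProbabilityMeasure (μ.map (shiftEvolve ψ)) :=
      Measure.isProbabilityMeasure_map (measurable_shiftEvolve hψ).aemeasurable
    refine measure_path_ext fun T => ?_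
    rw [Measure.map_map (measurable_past _) (measurable_shiftEvolve hψ)]
    cases T with
    | zero =>
      have e : past 0 ∘ shiftEvolve ψ = step ψ ∘ past 0 := funext past_zero_shiftEvolve
      rw [e, ← Measure.map_map (measurable_step hψ) (measurable_past 0), hpast]
      have hid : (forwardLaw P r).map (replay ψ 0) = forwardLaw P r := Measure.map_id
      rw [hid, forwardLaw_map_step hP hψ hq]
    | succ T =>
      have e : past (T + 1) ∘ shiftEvolve ψ = stepAt ψ T ∘ past T :=
        funext fun x => past_succ_shiftEvolve T x
      rw [e, ← Measure.map_map (measurable_stepAt hψ T) (measurable_past T), hpast, hpast,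
        Measure.map_map (measurable_stepAt hψ T) (measurable_replay hψ T)]
      rfl
  · rw [← past_zero_eq, hpast]
    exact Measure.map_id
  · have := h'.isProbabilityMeasure
    refine measure_path_ext fun T => ?_
    rw [hpast, h'.map_past hψ]

end Extension

/-! ### The weights along the two-sided path -/

lemma tilt_tilt {w y z : ℕ → ℝ} (hw : IsWeight w) (hy : Summable fun i => w i * Real.exp (y i))
    (hyz : Summable fun i => w i * Real.exp (y i + z i)) :
    tilt (tilt w y) z = tilt w (y + z) := by
  have hpos := hw.total_pos hy
  have htz := tilt_tilt_summable hyz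
  have hpos' := (isWeight_tilt hw hy).total_pos htz
  have hmul : total w (y + z) = total w y * total (tilt w y) z := by
    have h := lse_add hw hy hyz
    unfold lse at h
    rw [← Real.log_mul hpos.ne' hpos'.ne'] at h
    exact Real.log_injOn_pos (hw.total_pos (y := y + z) hyz) (mul_pos hpos hpos') h
  funext i
  simp only [tilt, hmul, Pi.add_apply, Real.exp_add]
  rw [div_mul_eq_mul_div, div_div, mul_assoc]

lemma tilt_comp (w y : ℕ → ℝ) {f : ℕ → ℕ} (hf : Function.Bijective f) :
    tilt (fun i => w (f i)) (fun i => y (f i)) = fun i => tilt w y (f i) := by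
  funext i
  simp only [tilt, total_comp w y hf]

lemma tilt_zero {w : ℕ → ℝ} (hw : IsWeight w) : tilt w 0 = w := by
  have h : total w 0 = 1 := by
    rw [total_eq hw.nonneg]
    simp [hw.hasSum.tsum_eq]
  funext i
  simp [tilt, h]

/-- The sum of the fields over the times `a, …, a + n - 1`. -/
def window (a : ℤ) (n : ℕ) (x : Path) : ℕ → ℝ := ∑ j ∈ Finset.range n, x.2 (a + j)

lemma window_succ (a : ℤ) (n : ℕ) (x : Path) :
    window a (n + 1) x = window a n x + x.2 (a + n) := Finset.sum_range_succ _ _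

lemma window_zero (a : ℤ) (x : Path) : window a 0 x = 0 := rfl

lemma window_add (a : ℤ) (m n : ℕ) (x : Path) :
    window a (m + n) x = window a m x + window (a + m) n x := by
  unfold window
  rw [Finset.sum_range_add]
  congr 1
  refine Finset.sum_congr rfl fun j _ => ?_
  push_cast
  rw [add_assoc]

/-- The log-sum-exp of the sum of the fields over a window of time, with the current weights. -/
def energy (b : ℝ) (a : ℤ) (n : ℕ) (x : Path) : ℝ := lse x.1.1 (b • window a n x)

/-- The paths with an admissible configuration, and fields with all exponential moments. -/
structure IsNice (x : Path) : Prop where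
  isAdmissible : IsAdmissible x.1
  mem : ∀ t, x.2 t ∈ goodFields isAdmissible.isWeight

section Nice

variable {x : Path} {l : ℝ}

lemma IsNice.window_mem (hx : IsNice x) (a : ℤ) (n : ℕ) :
    window a n x ∈ goodFields hx.isAdmissible.isWeight :=
  Submodule.sum_mem _ fun _ _ => hx.mem _

lemma IsNice.smul_window_mem (hx : IsNice x) (b : ℝ) (a : ℤ) (n : ℕ) :
    b • window a n x ∈ goodFields hx.isAdmissible.isWeight :=
  Submodule.smul_mem _ _ (hx.window_mem a n)

lemma summable_of_mem {w y : ℕ → ℝ} (hw : IsWeight w) (hy : y ∈ goodFields hw) :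
    Summable fun i => w i * Real.exp (y i) :=
  (good_of_mem hw hy).summable_exp hw.nonneg

/-- One step of the evolution preserves the exponential moments. -/
lemma mem_goodFields_evolve {ω : Config} {κ y : ℕ → ℝ} (hω : IsAdmissible ω)
    (hκ : κ ∈ goodFields hω.isWeight) (hy : y ∈ goodFields hω.isWeight)
    (hω' : IsAdmissible (evolve (fun k => l * k) ω κ)) :
    (fun n => y (reorder (fun k => l * k) ω κ n)) ∈ goodFields hω'.isWeight := by
  have hl : l • κ ∈ goodFields hω.isWeight := Submodule.smul_mem _ _ hκ
  have hs : Summable fun i => ω.1 i * Real.exp (l * κ i) := summable_of_mem hω.isWeight hl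
  exact mem_goodFields_comp (isWeight_tilt hω.isWeight hs)
    (mem_goodFields_tilt hω.isWeight hl hy _) (bijective_reorder hω hs)

lemma isAdmissible_evolve_of_mem {ω : Config} {κ : ℕ → ℝ} (hω : IsAdmissible ω)
    (hκ : κ ∈ goodFields hω.isWeight) : IsAdmissible (evolve (fun k => l * k) ω κ) :=
  isAdmissible_evolve hω (summable_of_mem hω.isWeight (Submodule.smul_mem _ l hκ))

lemma IsNice.shiftEvolve (hx : IsNice x) : IsNice (shiftEvolve (fun k => l * k) x) where
  isAdmissible := isAdmissible_evolve_of_mem hx.isAdmissible (hx.mem 0)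
  mem t := mem_goodFields_evolve hx.isAdmissible (hx.mem 0) (hx.mem (t + 1))
    (isAdmissible_evolve_of_mem hx.isAdmissible (hx.mem 0))

lemma IsNice.iterate (hx : IsNice x) (T : ℕ) :
    IsNice ((ROSt.shiftEvolve fun k => l * k)^[T] x) := by
  induction T with
  | zero => exact hx
  | succ T ih => rw [Function.iterate_succ_apply']; exact ih.shiftEvolve

/-- After `T` steps, the weights are tilted by the sum of the first `T` fields, and everything is
relabelled by a permutation. -/
lemma IsNice.exists_relabel (hx : IsNice x) (T : ℕ) : ∃ σ : ℕ → ℕ, Function.Bijective σ ∧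
    ((ROSt.shiftEvolve fun k => l * k)^[T] x).1.1 =
      (fun i => tilt x.1.1 (l • window 0 T x) (σ i)) ∧
    (∀ t, ((ROSt.shiftEvolve fun k => l * k)^[T] x).2 t = fun i => x.2 (t + T) (σ i)) ∧
    ∀ i, x.1.1 i = 0 → σ i = i := by
  have hw := hx.isAdmissible.isWeight
  induction T with
  | zero =>
    refine ⟨id, Function.bijective_id, ?_, fun t => by simp, fun _ _ => rfl⟩
    rw [window_zero, smul_zero, tilt_zero hw]
    rfl
  | succ T ih =>
    obtain ⟨σ, hσ, h1, h2, h3⟩ := ih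
    set z := (ROSt.shiftEvolve fun k => l * k)^[T] x with hz
    have hzn : IsNice z := hx.iterate T
    have hs : Summable fun i => z.1.1 i * Real.exp (l * z.2 0 i) :=
      summable_of_mem hzn.isAdmissible.isWeight (Submodule.smul_mem _ l (hzn.mem 0))
    have hsT := summable_of_mem hw (hx.smul_window_mem l 0 T)
    have hsT' := summable_of_mem hw (Submodule.add_mem _ (hx.smul_window_mem l 0 T)
      (Submodule.smul_mem _ l (hx.mem T)))
    rw [Function.iterate_succ_apply', ← hz]
    refine ⟨σ ∘ reorder (fun k => l * k) z.1 (z.2 0),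
      hσ.comp (bijective_reorder hzn.isAdmissible hs), ?_, fun t => ?_, fun i hi => ?_⟩
    · have e1 : (ROSt.shiftEvolve (fun k => l * k) z).1.1 = fun i =>
          tilt z.1.1 (fun i => l * z.2 0 i) (reorder (fun k => l * k) z.1 (z.2 0) i) := rfl
      have e2 : tilt z.1.1 (fun i => l * z.2 0 i) =
          fun i => tilt (tilt x.1.1 (l • window 0 T x)) (l • x.2 T) (σ i) := by
        rw [h1, h2 0, zero_add]
        exact tilt_comp (tilt x.1.1 (l • window 0 T x)) (l • x.2 T) hσ
      rw [e1, e2, tilt_tilt hw hsT hsT', ← smul_add, window_succ, zero_add]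
      rfl
    · change (fun n => z.2 (t + 1) (reorder (fun k => l * k) z.1 (z.2 0) n)) = _
      rw [h2]
      funext i
      have e : t + 1 + (T : ℤ) = t + ((T + 1 : ℕ) : ℤ) := by push_cast; ring
      rw [e]
      rfl
    · have hzi : z.1.1 i = 0 := by
        rw [h1]
        simp only [h3 i hi]
        exact (tilt_eq_zero_iff hw hsT i).2 hi
      have hr : reorder (fun k => l * k) z.1 (z.2 0) i = i :=
        reorder_eq_self hzn.isAdmissible hs hzi
      rw [Function.comp_apply, hr, h3 i hi]

/-- After T steps the weights are tilted by l times the first T fields, and the common relabelling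
cancels. The cocycle identity turns the log-sum-exp under the tilted weights into a difference. -/
lemma IsNice.energy_iterate (hx : IsNice x) (b : ℝ) (a : ℤ) (n T : ℕ) :
    energy b a n ((ROSt.shiftEvolve fun k => l * k)^[T] x) =
      lse x.1.1 (l • window 0 T x + b • window (a + T) n x) - energy l 0 T x := by
  obtain ⟨σ, hσ, h1, h2, -⟩ := hx.exists_relabel (l := l) T
  have hw := hx.isAdmissible.isWeight
  have hsT := summable_of_mem hw (hx.smul_window_mem l 0 T)
  have hsT' := summable_of_mem hw (Submodule.add_mem _ (hx.smul_window_mem l 0 T)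
      (hx.smul_window_mem b (a + T) n))
  have e : b • window a n ((ROSt.shiftEvolve fun k => l * k)^[T] x) =
      fun i => (b • window (a + T) n x) (σ i) := by
    funext i
    simp only [window, Pi.smul_apply, Finset.sum_apply, h2]
    congr 1
    refine Finset.sum_congr rfl fun j _ => ?_
    rw [add_right_comm]
  have h := lse_add hw hsT hsT'
  rw [energy, e, h1, lse_comp _ _ hσ, energy]
  rw [← sub_eq_iff_eq_add'] at h
  exact h.symm

lemma IsNice.energy_zero (hx : IsNice x) (b : ℝ) (a : ℤ) : energy b a 0 x = 0 := by
  rw [energy, window_zero, smul_zero]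
  exact lse_zero hx.isAdmissible.isWeight

/-- The energy of the window which ends now, after `T` steps. -/
lemma IsNice.energy_past_iterate (hx : IsNice x) (b : ℝ) (T : ℕ) :
    energy b (-T) T ((ROSt.shiftEvolve fun k => l * k)^[T] x) =
      energy (l + b) 0 T x - energy l 0 T x := by
  rw [hx.energy_iterate, neg_add_cancel, ← add_smul]
  rfl

lemma IsNice.energy_future_iterate (hx : IsNice x) (n T : ℕ) :
    energy l 0 n ((ROSt.shiftEvolve fun k => l * k)^[T] x) =
      energy l 0 (T + n) x - energy l 0 T x := by
  have e : window 0 (T + n) x = window 0 T x + window (0 + T) n x := window_add 0 T n x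
  rw [hx.energy_iterate, ← smul_add, ← e]
  rfl

/-- The coefficient -l on the last n fields undoes exactly the last n tilts. -/
lemma IsNice.energy_reverse_iterate (hx : IsNice x) (n T : ℕ) :
    energy (-l) (-n) n ((ROSt.shiftEvolve fun k => l * k)^[T + n] x) =
      energy l 0 T x - energy l 0 (T + n) x := by
  rw [hx.energy_iterate]
  have e : (-n : ℤ) + ((T + n : ℕ) : ℤ) = 0 + T := by push_cast; ring
  rw [e, window_add, neg_smul, smul_add, add_neg_cancel_right]
  rfl

end Nice

/-! ### Laws along the two-sided path -/

lemma tsum_ofReal_exp_ne_top {c : ℝ} (hc : 0 < c) (K : ℝ) :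
    ∑' n : ℕ, ENNReal.ofReal (K * Real.exp (-(c * n))) ≠ ∞ := by
  have h : Summable fun n : ℕ => K * Real.exp (-(c * n)) := by
    refine Summable.mul_left K ((Real.summable_exp_nat_mul_iff (a := -c)).2 (by linarith)|>.congr
      fun n => ?_)
    congr 1
    ring
  exact h.tsum_ofReal_ne_top

lemma measure_forwardLaw_combine_le {P : Measure Config} [IsProbabilityMeasure P] {r : ℕ}
    (hP : ∀ᵐ ω ∂P, IsAdmissible ω) {A : Set (Config × (ℕ → ℝ))} (hA : MeasurableSet A)
    (c : ℕ → ℝ) (T : ℕ) {K : ℝ≥0∞}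
    (h : ∀ ω, IsAdmissible ω →
      field (entryPow r ω.2) (∑ t ∈ Finset.range T, c t ^ 2) {y | (ω, y) ∈ A} ≤ K) :
    forwardLaw P r (combine c T ⁻¹' A) ≤ K := by
  have h1 := lintegral_forwardLaw_combine (r := r) hP
    (F := A.indicator 1) (measurable_one.indicator hA) c T
  have e1 : ∫⁻ x, A.indicator 1 (combine c T x) ∂forwardLaw P r =
      forwardLaw P r (combine c T ⁻¹' A) :=
    lintegral_indicator_one (measurable_combine c T hA)
  rw [← e1, h1]
  calc ∫⁻ ω, ∫⁻ y, A.indicator 1 (ω, y)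
        ∂field (entryPow r ω.2) (∑ t ∈ Finset.range T, c t ^ 2) ∂P
      ≤ ∫⁻ _, K ∂P := by
        refine lintegral_mono_ae ?_
        filter_upwards [hP] with ω hω
        exact le_of_eq_of_le (lintegral_indicator_one (measurable_prodMk_left hA)) (h ω hω)
    _ = K := by simp

lemma measurable_window (a : ℤ) (n : ℕ) : Measurable (window a n) := by
  unfold window
  fun_prop

lemma measurable_energy (b : ℝ) (a : ℤ) (n : ℕ) : Measurable (energy b a n) :=
  measurable_lse.comp ((measurable_fst.comp measurable_fst).prodMk
    ((measurable_window a n).const_smul b))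

lemma combine_past (b : ℝ) (n : ℕ) (x : Path) :
    combine (fun _ => b) n (past 0 x) = (x.1, b • window 0 n x) := by
  simp [combine, past, window, Finset.smul_sum]

lemma ae_mem_forwardLaw {P : Measure Config} [IsProbabilityMeasure P] {r : ℕ}
    (hP : ∀ᵐ ω ∂P, IsAdmissible ω) (t : ℕ) :
    ∀ᵐ y ∂forwardLaw P r, ∃ hw : IsWeight y.1.1, y.2 t ∈ goodFields hw := by
  -- The coefficients `Pi.single t 1` isolate the field at time t.
  have h := ae_forwardLaw_combine (r := r) hP
    (p := fun z => ∃ hw : IsWeight z.1.1, z.2 ∈ goodFields hw)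
    (measurableSet_mem_goodFields.preimage
      ((measurable_fst.comp measurable_fst).prodMk measurable_snd)) (Pi.single t 1) (t + 1) (by
    filter_upwards [hP] with ω hω
    filter_upwards [ae_mem_goodFields (isCorr_entryPow hω.isCorr r) hω.isWeight
      (Finset.sum_nonneg fun _ _ => sq_nonneg _)] with y hy using ⟨hω.isWeight, hy⟩)
  filter_upwards [h] with y hy
  have e : ∑ s ∈ Finset.range (t + 1), (Pi.single t 1 : ℕ → ℝ) s • y.2 s = y.2 t := by
    rw [Finset.sum_eq_single t]
    · simp
    · intro s _ hs
      simp [hs]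
    · simp
  simpa only [combine, e] using hy

section Extension

variable {P : Measure Config} {r : ℕ} {l : ℝ} {μ : Measure Path}

lemma IsExtension.map_past_zero {ψ : ℝ → ℝ} (hμ : IsExtension P ψ r μ) :
    μ.map (past 0) = forwardLaw P r := by
  rw [past_zero_eq]
  exact hμ.forward

lemma IsExtension.ae_past {ψ : ℝ → ℝ} (hμ : IsExtension P ψ r μ) {p : Forward → Prop}
    (h : ∀ᵐ y ∂forwardLaw P r, p y) : ∀ᵐ x ∂μ, p (past 0 x) := by
  rw [← hμ.map_past_zero] at h
  exact ae_of_ae_map (measurable_past 0).aemeasurable h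

lemma IsExtension.ae_of_iterate {ψ : ℝ → ℝ} (hμ : IsExtension P ψ r μ) {p : Path → Prop}
    (hp : MeasurableSet {x | p x}) (T : ℕ) (h : ∀ᵐ x ∂μ, p ((shiftEvolve ψ)^[T] x)) :
    ∀ᵐ x ∂μ, p x := by
  have hT := hμ.invariant.iterate T
  rw [← hT.map_eq]
  exact (ae_map_iff hT.measurable.aemeasurable hp).2 h

/-- Invariance transfers events about the past to time T, where the last T fields are the first T
fields of the original path and concentration is available. -/
lemma IsExtension.measure_le_of_iterate {ψ : ℝ → ℝ} (hμ : IsExtension P ψ r μ) {A B : Set Path}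
    (hA : MeasurableSet A) (T : ℕ) (h : ∀ᵐ x ∂μ, (shiftEvolve ψ)^[T] x ∈ A → x ∈ B) :
    μ A ≤ μ B := by
  rw [← (hμ.invariant.iterate T).measure_preimage hA.nullMeasurableSet]
  exact measure_mono_ae h

variable [IsProbabilityMeasure P]

omit [IsProbabilityMeasure P] in
lemma IsExtension.ae_fst {ψ : ℝ → ℝ} (hμ : IsExtension P ψ r μ) {p : Config → Prop}
    (h : ∀ᵐ ω ∂P, p ω) : ∀ᵐ x ∂μ, p x.1 := by
  rw [← forwardLaw_map_fst (P := P) (r := r)] at h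
  exact hμ.ae_past (ae_of_ae_map measurable_fst.aemeasurable h)

lemma IsExtension.ae_isNice (hμ : IsExtension P (fun k => l * k) r μ)
    (hP : ∀ᵐ ω ∂P, IsAdmissible ω) : ∀ᵐ x ∂μ, IsNice x := by
  have hadm := hμ.ae_fst hP
  have hpos : ∀ t : ℕ, ∀ᵐ x ∂μ, ∃ hw : IsWeight x.1.1, x.2 t ∈ goodFields hw := fun t => by
    filter_upwards [hμ.ae_past (ae_mem_forwardLaw hP t)] with x hx
    simpa [past] using hx
  have hms : ∀ t : ℤ, MeasurableSet {x : Path | ∃ hw : IsWeight x.1.1, x.2 t ∈ goodFields hw} :=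
    fun t => measurableSet_mem_goodFields.preimage (f := fun x : Path => (x.1.1, x.2 t))
      (by fun_prop)
  -- Negative times are reached by invariance: after one step, the field at -(t+1) is the relabelled
  -- field at -t, and the tilt keeps its moments.
  have hneg : ∀ t : ℕ, ∀ᵐ x ∂μ, ∃ hw : IsWeight x.1.1, x.2 (-t) ∈ goodFields hw := by
    intro t
    induction t with
    | zero => simpa using hpos 0
    | succ t ih =>
      refine hμ.ae_of_iterate (hms _) 1 ?_
      filter_upwards [hadm, hpos 0, ih] with x hx h0 ht
      obtain ⟨_, h0⟩ := h0
      obtain ⟨_, ht⟩ := ht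
      have hadm' := isAdmissible_evolve_of_mem (l := l) hx h0
      refine ⟨hadm'.isWeight, ?_⟩
      have h := mem_goodFields_evolve hx h0 ht hadm'
      have e : (-((t + 1 : ℕ) : ℤ)) + 1 = -t := by push_cast; ring
      change (fun n => x.2 (-((t + 1 : ℕ) : ℤ) + 1) (reorder _ x.1 (x.2 0) n)) ∈ _
      rw [e]
      exact h
  filter_upwards [hadm, ae_all_iff.2 hpos, ae_all_iff.2 hneg] with x hx h1 h2
  refine ⟨hx, fun t => ?_⟩
  rcases Int.eq_nat_or_neg t with ⟨n, rfl | rfl⟩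
  · exact (h1 n).2
  · exact (h2 n).2

/-- Concentration of the energy along the path around the free energy of the configuration. -/
lemma IsExtension.exists_concentration {ψ : ℝ → ℝ} (hμ : IsExtension P ψ r μ)
    (hP : ∀ᵐ ω ∂P, IsAdmissible ω) (b : ℝ) {d : ℝ} (hd : 0 < d) :
    ∃ c > 0, ∀ n : ℕ, μ {x | d * n ≤ |energy b 0 n x - freeEnergy r (n * b ^ 2) x.1|} ≤
      ENNReal.ofReal (2 * Real.exp (-(c * n))) := by
  -- Each step contributes variance b². The constant c does not depend on the configuration, so the
  -- bound passes to the average over P.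
  obtain ⟨c, hc, h⟩ := ROSt.exists_concentration (sq_nonneg b) hd
  refine ⟨c, hc, fun n => ?_⟩
  have hA : MeasurableSet {z : Config × (ℕ → ℝ) |
      d * n ≤ |lse z.1.1 z.2 - freeEnergy r (n * b ^ 2) z.1|} :=
    measurableSet_le measurable_const (continuous_abs.measurable.comp
      (measurable_lse_config.sub ((measurable_freeEnergy r _).comp measurable_fst)))
  have h1 := measure_forwardLaw_combine_le (r := r) hP hA (fun _ => b) n
    (K := ENNReal.ofReal (2 * Real.exp (-(c * n)))) fun ω hω => by
      have h2 := h (entryPow r ω.2) ω.1 (isCorr_entryPow hω.isCorr r) hω.isWeight n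
      rw [← freeEnergy_eq hω r (by positivity)] at h2
      simpa using h2
  rw [← hμ.map_past_zero, Measure.map_apply (measurable_past 0)
    (measurable_combine _ _ hA)] at h1
  have e : past 0 ⁻¹' (combine (fun _ => b) n ⁻¹' {z : Config × (ℕ → ℝ) |
      d * n ≤ |lse z.1.1 z.2 - freeEnergy r (n * b ^ 2) z.1|}) =
      {x | d * n ≤ |energy b 0 n x - freeEnergy r (n * b ^ 2) x.1|} := by
    ext x
    simp only [Set.mem_preimage, combine_past]
    rfl
  rwa [e] at h1

lemma IsExtension.ae_eventually_lt {ψ : ℝ → ℝ} (hμ : IsExtension P ψ r μ)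
    (hP : ∀ᵐ ω ∂P, IsAdmissible ω) (b : ℝ) {d : ℝ} (hd : 0 < d) :
    ∀ᵐ x ∂μ, ∀ᶠ n : ℕ in atTop, |energy b 0 n x - freeEnergy r (n * b ^ 2) x.1| < d * n := by
  obtain ⟨c, hc, h⟩ := hμ.exists_concentration hP b hd
  have h1 := ae_eventually_notMem (ne_top_of_le_ne_top (tsum_ofReal_exp_ne_top hc 2)
    (ENNReal.tsum_le_tsum h))
  filter_upwards [h1] with x hx
  filter_upwards [hx] with n hn
  simpa using hn

/-- The energy and the free energy have the same linear growth. -/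
lemma IsExtension.ae_tendsto_sub {ψ : ℝ → ℝ} (hμ : IsExtension P ψ r μ)
    (hP : ∀ᵐ ω ∂P, IsAdmissible ω) (b : ℝ) :
    ∀ᵐ x ∂μ, Tendsto (fun n : ℕ => energy b 0 n x / n - freeEnergy r (n * b ^ 2) x.1 / n) atTop
      (𝓝 0) := by
  have h : ∀ᵐ x ∂μ, ∀ m : ℕ, ∀ᶠ n : ℕ in atTop,
      |energy b 0 n x - freeEnergy r (n * b ^ 2) x.1| < 1 / ((m : ℝ) + 1) * n :=
    ae_all_iff.2 fun m => hμ.ae_eventually_lt hP b (by positivity)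
  filter_upwards [h] with x hx
  refine Metric.tendsto_atTop'.2 fun e he => ?_
  obtain ⟨m, hm⟩ := exists_nat_one_div_lt he
  obtain ⟨N, hN⟩ := eventually_atTop.1 ((hx m).and (eventually_gt_atTop 0))
  refine ⟨N, fun n hn => ?_⟩
  obtain ⟨h1, h2⟩ := hN n hn.le
  have h0 : (0 : ℝ) < n := by exact_mod_cast h2
  rw [Real.dist_eq, sub_zero, ← sub_div, abs_div, abs_of_pos h0, div_lt_iff₀ h0]
  exact h1.trans (by gcongr)

end Extension

/-! ### The growth of the energy -/

/-- The asymptotic free energy per step of a configuration. -/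
def freeRate (r : ℕ) (l : ℝ) (ω : Config) : ℝ :=
  limsup (fun n : ℕ => max 0 (min (l ^ 2 / 2) (freeEnergy r (n * l ^ 2) ω / n))) atTop

lemma measurable_freeRate (r : ℕ) (l : ℝ) : Measurable (freeRate r l) :=
  Measurable.limsup fun _ =>
    measurable_const.max (measurable_const.min ((measurable_freeEnergy r _).div_const _))

/-- Because of the truncation the bound holds for every ω, admissible or not, as the test functions
in the definition of ergodicity require. -/
lemma abs_freeRate_le (r : ℕ) (l : ℝ) (ω : Config) : |freeRate r l ω| ≤ l ^ 2 / 2 := by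
  have h0 : ∀ n : ℕ, 0 ≤ max 0 (min (l ^ 2 / 2) (freeEnergy r (n * l ^ 2) ω / n)) :=
    fun n => le_max_left _ _
  have h1 : ∀ n : ℕ, max 0 (min (l ^ 2 / 2) (freeEnergy r (n * l ^ 2) ω / n)) ≤ l ^ 2 / 2 :=
    fun n => max_le (by positivity) (min_le_left _ _)
  rw [abs_of_nonneg]
  · exact limsup_le_of_le (isCoboundedUnder_le_of_le atTop (x := 0) h0) (Eventually.of_forall h1)
  · exact le_limsup_of_le (isBoundedUnder_of ⟨_, h1⟩)
      fun b hb => (h0 _).trans hb.exists.choose_spec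

lemma freeEnergy_div_mem {ω : Config} (hω : IsAdmissible ω) (r : ℕ) (l : ℝ) (n : ℕ) :
    freeEnergy r (n * l ^ 2) ω / n ∈ Set.Icc 0 (l ^ 2 / 2) := by
  refine ⟨div_nonneg (freeEnergy_nonneg hω r (by positivity)) (Nat.cast_nonneg n), ?_⟩
  rcases n.eq_zero_or_pos with rfl | hn
  · simp
    positivity
  · rw [div_le_iff₀ (by exact_mod_cast hn)]
    refine (freeEnergy_le hω r (by positivity)).trans_eq (by ring)

lemma tendsto_freeRate {ω : Config} (hω : IsAdmissible ω) {r : ℕ} {l L : ℝ}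
    (h : Tendsto (fun n : ℕ => freeEnergy r (n * l ^ 2) ω / n) atTop (𝓝 L)) :
    freeRate r l ω = L := by
  refine Tendsto.limsup_eq (h.congr fun n => ?_)
  obtain ⟨h0, h1⟩ := freeEnergy_div_mem hω r l n
  rw [min_eq_right h1, max_eq_right h0]

section Extension

variable {P : Measure Config} [IsProbabilityMeasure P] {r : ℕ} {l : ℝ} {μ : Measure Path}

lemma IsExtension.integrable_energy_one (hμ : IsExtension P (fun k => l * k) r μ)
    (hP : ∀ᵐ ω ∂P, IsAdmissible ω) : Integrable (energy l 0 1) μ := by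
  have h := integrable_lse_combine (r := r) hP (fun _ => l) 1
  rw [← hμ.map_past_zero] at h
  have h2 := h.comp_measurable (measurable_past 0)
  simp only [Function.comp_def, combine_past] at h2
  exact h2

lemma IsNice.energy_eq_birkhoffSum {x : Path} (hx : IsNice x) (n : ℕ) :
    energy l 0 n x = birkhoffSum (ROSt.shiftEvolve fun k => l * k) (energy l 0 1) n x := by
  induction n with
  | zero => rw [hx.energy_zero, birkhoffSum_zero]
  | succ n ih => rw [birkhoffSum_succ, ← ih, hx.energy_future_iterate, add_sub_cancel]

/-- The energy grows at the asymptotic free energy rate of the configuration. -/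
lemma IsExtension.ae_tendsto_freeRate (hμ : IsExtension P (fun k => l * k) r μ)
    (hP : ∀ᵐ ω ∂P, IsAdmissible ω) :
    ∀ᵐ x ∂μ, Tendsto (fun n : ℕ => freeEnergy r (n * l ^ 2) x.1 / n) atTop
        (𝓝 (freeRate r l x.1)) ∧
      Tendsto (fun n : ℕ => energy l 0 n x / n) atTop (𝓝 (freeRate r l x.1)) := by
  have := hμ.isProbabilityMeasure
  filter_upwards [hμ.ae_isNice hP, hμ.ae_tendsto_sub hP l,
    ae_exists_tendsto_birkhoffSum hμ.invariant (hμ.integrable_energy_one hP)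
      (measurable_energy l 0 1)] with x hx h1 ⟨L, h2⟩
  have h3 : Tendsto (fun n : ℕ => energy l 0 n x / n) atTop (𝓝 L) :=
    h2.congr fun n => by rw [hx.energy_eq_birkhoffSum]
  -- The ergodic limit L could depend on the whole path, but concentration makes it a limit of free
  -- energies, hence a function of the configuration.
  have h4 : Tendsto (fun n : ℕ => freeEnergy r (n * l ^ 2) x.1 / n) atTop (𝓝 L) := by
    have := h3.sub h1
    simpa using this
  rw [tendsto_freeRate hx.isAdmissible h4]
  exact ⟨h4, h3⟩

/-- Dropping the first step changes the energy by a fixed amount, which does not affect its rate of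
growth. -/
lemma IsExtension.ae_freeRate_evolve (hμ : IsExtension P (fun k => l * k) r μ)
    (hP : ∀ᵐ ω ∂P, IsAdmissible ω) :
    ∀ᵐ y ∂forwardLaw P r,
      freeRate r l (evolve (fun k => l * k) y.1 (y.2 0)) = freeRate r l y.1 := by
  have hev : Measurable fun y : Forward => evolve (fun k => l * k) y.1 (y.2 0) :=
    (measurable_evolve (ψ := fun k => l * k) (by fun_prop)).comp
      (by fun_prop : Measurable fun y : Forward => (y.1, y.2 0))
  have hset : MeasurableSet {y : Forward |
      freeRate r l (evolve (fun k => l * k) y.1 (y.2 0)) = freeRate r l y.1} :=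
    measurableSet_eq_fun ((measurable_freeRate r l).comp hev)
      ((measurable_freeRate r l).comp measurable_fst)
  rw [← hμ.map_past_zero]
  refine (ae_map_iff (measurable_past 0).aemeasurable hset).2 ?_
  have h := hμ.ae_tendsto_freeRate hP
  filter_upwards [hμ.ae_isNice hP, h, hμ.invariant.quasiMeasurePreserving.ae h] with x hx h1 h2
  have h3 : Tendsto (fun n : ℕ => energy l 0 n (shiftEvolve (fun k => l * k) x) / n) atTop
      (𝓝 (freeRate r l x.1)) := by
    have h4 : Tendsto (fun n : ℕ => energy l 0 (n + 1) x / ((n + 1 : ℕ) : ℝ)) atTop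
        (𝓝 (freeRate r l x.1)) := h1.2.comp (tendsto_add_atTop_nat 1)
    have h5 : Tendsto (fun n : ℕ => energy l 0 (n + 1) x / ((n + 1 : ℕ) : ℝ) *
        (1 + (n : ℝ)⁻¹) - energy l 0 1 x * (n : ℝ)⁻¹) atTop (𝓝 (freeRate r l x.1)) := by
      have h6 := tendsto_inv_atTop_nhds_zero_nat (𝕜 := ℝ)
      have := (h4.mul (h6.const_add 1)).sub (h6.const_mul (energy l 0 1 x))
      simpa using this
    refine h5.congr' ?_
    filter_upwards [eventually_gt_atTop 0] with n hn
    have e := hx.energy_future_iterate (l := l) n 1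
    rw [Function.iterate_one, add_comm 1 n] at e
    rw [e]
    push_cast
    have : (n : ℝ) ≠ 0 := by positivity
    field_simp
  have e : (past 0 x).2 0 = x.2 0 := by simp [past]
  rw [e]
  exact tendsto_nhds_unique h2.2 h3

/-- For an ergodic overlap structure, the energy has a deterministic rate of growth. -/
lemma IsExtension.ae_tendsto_energy (hμ : IsExtension P (fun k => l * k) r μ)
    (hP : ∀ᵐ ω ∂P, IsAdmissible ω) (herg : IsErgodic P (fun k => l * k) r) {m : ℝ}
    (hm : ∀ n : ℕ, 0 < n → meanFree P r (n * l ^ 2) / n = m) :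
    ∀ᵐ x ∂μ, Tendsto (fun n : ℕ => energy l 0 n x / n) atTop (𝓝 m) := by
  have := hμ.isProbabilityMeasure
  have hrate := hμ.ae_tendsto_freeRate hP
  have hcond : (forwardLaw P r)[fun x => freeRate r l (evolve (fun k => l * k) x.1 (x.2 0)) |
      MeasurableSpace.comap Prod.fst inferInstance] =ᵐ[forwardLaw P r]
        fun x => freeRate r l x.1 := by
    refine (condExp_congr_ae (hμ.ae_freeRate_evolve hP)).trans ?_
    have hle : MeasurableSpace.comap (Prod.fst : Forward → Config) inferInstance ≤
        (inferInstance : MeasurableSpace Forward) := measurable_fst.comap_le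
    have hsm : StronglyMeasurable[MeasurableSpace.comap (Prod.fst : Forward → Config)
        inferInstance] fun x : Forward => freeRate r l x.1 :=
      ((measurable_freeRate r l).comp (comap_measurable Prod.fst)).stronglyMeasurable
    rw [condExp_of_stronglyMeasurable hle hsm]
    exact Integrable.of_bound ((measurable_freeRate r l).comp
      measurable_fst).aestronglyMeasurable (l ^ 2 / 2)
      (ae_of_all _ fun x => abs_freeRate_le r l x.1)
  obtain ⟨c, hc⟩ := herg _ (measurable_freeRate r l) ⟨_, abs_freeRate_le r l⟩ hcond
  have hcμ := hμ.ae_fst hc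
  have hlim : Tendsto (fun n : ℕ => ∫ x, freeEnergy r (n * l ^ 2) x.1 / n ∂μ) atTop
      (𝓝 (∫ _, c ∂μ)) := by
    refine tendsto_integral_of_dominated_convergence (fun _ => l ^ 2 / 2)
      (fun n => (((measurable_freeEnergy r _).div_const _).comp
        measurable_fst).aestronglyMeasurable) (integrable_const _) (fun n => ?_) ?_
    · filter_upwards [hμ.ae_fst hP] with x hx
      obtain ⟨h0, h1⟩ := freeEnergy_div_mem hx r l n
      rwa [Real.norm_of_nonneg h0]
    · filter_upwards [hrate, hcμ] with x hx hxc
      rw [← hxc]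
      exact hx.1
  have hfst : μ.map Prod.fst = P := by
    rw [← forwardLaw_map_fst (P := P) (r := r), ← hμ.map_past_zero,
      Measure.map_map measurable_fst (measurable_past 0)]
    rfl
  -- The means of the free energies per step are m for every positive n, and they converge to c by
  -- dominated convergence.
  have hcm : c = m := by
    rw [integral_const, probReal_univ, one_smul] at hlim
    refine tendsto_nhds_unique hlim (tendsto_const_nhds.congr' ?_)
    filter_upwards [eventually_gt_atTop 0] with n hn
    rw [integral_div, ← hm n hn, meanFree]
    congr 1
    conv_lhs => rw [← hfst]
    exact integral_map measurable_fst.aemeasurable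
      (measurable_freeEnergy r _).aestronglyMeasurable
  filter_upwards [hrate, hcμ] with x hx hxc
  rw [← hcm, ← hxc]
  exact hx.2

/-- The energy of the past decreases at the same rate. -/
lemma IsExtension.ae_tendsto_energy_neg (hμ : IsExtension P (fun k => l * k) r μ)
    (hP : ∀ᵐ ω ∂P, IsAdmissible ω) {m : ℝ}
    (hm : ∀ᵐ x ∂μ, Tendsto (fun n : ℕ => energy l 0 n x / n) atTop (𝓝 m)) :
    ∀ᵐ x ∂μ, Tendsto (fun n : ℕ => energy (-l) (-n) n x / n) atTop (𝓝 (-m)) := by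
  have := hμ.isProbabilityMeasure
  have hnice := hμ.ae_isNice hP
  set X : ℕ → Path → ℝ := fun k x =>
    energy (-l) (-((k + 1 : ℕ) : ℤ)) (k + 1) x - energy (-l) (-(k : ℤ)) k x with hXdef
  have hXm : ∀ k, Measurable (X k) := fun k =>
    (measurable_energy _ _ _).sub (measurable_energy _ _ _)
  have hstep : ∀ x, IsNice x → ∀ n : ℕ, energy (-l) (-((n + 1 : ℕ) : ℤ)) (n + 1)
      (shiftEvolve (fun k => l * k) x) = energy (-l) (-(n : ℤ)) n x - energy l 0 1 x := by
    intro x hx n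
    have h := hx.energy_iterate (l := l) (-l) (-((n + 1 : ℕ) : ℤ)) (n + 1) 1
    rw [Function.iterate_one] at h
    rw [h, energy]
    congr 2
    have e : -((n + 1 : ℕ) : ℤ) + ((1 : ℕ) : ℤ) = -n := by push_cast; ring
    have e1 : window (-(n : ℤ)) (n + 1) x = window (-(n : ℤ)) n x + window 0 1 x := by
      rw [window_add, neg_add_cancel]
    rw [e, e1, smul_add, neg_smul, neg_smul]
    abel
  -- One step forward moves the k-th backward increment to position k + 1, so the increments form a
  -- stationary sequence and their averages converge almost surely.
  have hX1 : ∀ᵐ x ∂μ, ∀ k, X (k + 1) (shiftEvolve (fun k => l * k) x) = X k x := by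
    filter_upwards [hnice] with x hx k
    simp only [hXdef]
    rw [hstep x hx (k + 1), hstep x hx k]
    ring
  have hX0 : ∀ᵐ x ∂μ, X 0 (shiftEvolve (fun k => l * k) x) = -energy l 0 1 x := by
    filter_upwards [hnice] with x hx
    simp only [hXdef]
    have h1 := hstep x hx 0
    have h2 := hx.energy_zero (-l) (-((0 : ℕ) : ℤ))
    have h3 := (hx.shiftEvolve (l := l)).energy_zero (-l) (-((0 : ℕ) : ℤ))
    rw [h1, h2, h3]
    ring
  -- After one step, the first backward increment is minus the forward energy of that step, which is
  -- integrable.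
  have hXi : Integrable (X 0) μ := by
    refine (hμ.invariant.integrable_comp (hXm 0).aestronglyMeasurable).1 ?_
    exact (hμ.integrable_energy_one hP).neg.congr (hX0.mono fun x hx => hx.symm)
  have hseq : Measurable fun x n => X (n + 1) x := measurable_pi_lambda _ fun n => hXm (n + 1)
  have hstat : μ.map (fun x n => X (n + 1) x) = μ.map fun x n => X n x := by
    conv_lhs => rw [← hμ.invariant.map_eq]
    rw [Measure.map_map hseq hμ.invariant.measurable]
    refine Measure.map_congr ?_
    filter_upwards [hX1] with x hx
    funext n
    exact hx n
  have hconv := ae_exists_tendsto_of_stationary hXm hXi hstat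
  have hsum : ∀ x, IsNice x → ∀ n : ℕ,
      ∑ k ∈ Finset.range n, X k x = energy (-l) (-(n : ℤ)) n x := by
    intro x hx n
    rw [hXdef]
    rw [Finset.sum_range_sub (fun k : ℕ => energy (-l) (-(k : ℤ)) k x),
      hx.energy_zero (-l) (-((0 : ℕ) : ℤ)), sub_zero]
  have hconv' : ∀ᵐ x ∂μ, ∃ c, Tendsto (fun n : ℕ => energy (-l) (-n) n x / n) atTop (𝓝 c) := by
    filter_upwards [hconv, hnice] with x ⟨c, hc⟩ hx
    exact ⟨c, by simpa only [hsum x hx] using hc⟩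
  have hmeas : ∀ n : ℕ, Measurable fun x => energy (-l) (-n) n x / n := fun n =>
    (measurable_energy _ _ _).div_const _
  -- For each n the backward energy has the law of minus the forward energy. This gives convergence
  -- in measure to -m and identifies the almost sure limit.
  have hdist : TendstoInMeasure μ (fun (n : ℕ) x => energy (-l) (-n) n x / n) atTop
      fun _ => -m := by
    have h1 : TendstoInMeasure μ (fun (n : ℕ) x => energy l 0 n x / n) atTop fun _ => m :=
      tendstoInMeasure_of_tendsto_ae
        (fun n => ((measurable_energy _ _ _).div_const _).aestronglyMeasurable) hm
    intro e he
    refine tendsto_of_tendsto_of_tendsto_of_le_of_le tendsto_const_nhds (h1 e he)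
      (fun n => zero_le) fun n => ?_
    refine hμ.measure_le_of_iterate (T := n)
      (measurableSet_le measurable_const ((hmeas n).edist measurable_const)) ?_
    filter_upwards [hnice] with x hx h
    have e1 := hx.energy_reverse_iterate (l := l) n 0
    rw [zero_add, hx.energy_zero, zero_sub] at e1
    change e ≤ edist (energy (-l) (-n) n ((shiftEvolve fun k => l * k)^[n] x) / n) (-m) at h
    rw [e1, neg_div, edist_neg_neg] at h
    exact h
  choose! Z hZ using fun x (h : ∃ c, Tendsto (fun n : ℕ => energy (-l) (-n) n x / n) atTop
    (𝓝 c)) => h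
  have hZ' : ∀ᵐ x ∂μ, Tendsto (fun n : ℕ => energy (-l) (-n) n x / n) atTop (𝓝 (Z x)) :=
    hconv'.mono fun x hx => hZ x hx
  have huniq := tendstoInMeasure_ae_unique
    (tendstoInMeasure_of_tendsto_ae (fun n => (hmeas n).aestronglyMeasurable) hZ') hdist
  filter_upwards [hZ', huniq] with x h1 h2
  rwa [h2] at h1

end Extension

/-! ### The past velocities -/

lemma exists_forall_abs_sub_le {u : ℕ → ℝ} {m : ℝ}
    (h : Tendsto (fun n : ℕ => u n / n) atTop (𝓝 m)) {d : ℝ} (hd : 0 < d) :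
    ∃ K, ∀ n : ℕ, |u n - m * n| ≤ d * n + K := by
  obtain ⟨N, hN⟩ := Metric.tendsto_atTop.1 h d hd
  refine ⟨∑ n ∈ Finset.range (N + 1), |u n - m * n|, fun n => ?_⟩
  have h0 : 0 ≤ ∑ n ∈ Finset.range (N + 1), |u n - m * n| :=
    Finset.sum_nonneg fun _ _ => abs_nonneg _
  rcases Nat.lt_or_ge n (N + 1) with hn | hn
  · have h1 : |u n - m * n| ≤ ∑ n ∈ Finset.range (N + 1), |u n - m * n| :=
      Finset.single_le_sum (f := fun n : ℕ => |u n - m * n|) (fun _ _ => abs_nonneg _)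
        (Finset.mem_range.2 hn)
    have h2 : 0 ≤ d * n := by positivity
    linarith
  · have hpos : (0 : ℝ) < n := by exact_mod_cast (Nat.succ_pos N).trans_le hn
    have h1 := (hN n (by omega)).le
    rw [Real.dist_eq] at h1
    have e : u n - m * n = (u n / n - m) * n := by field_simp
    rw [e, abs_mul, abs_of_pos hpos]
    have := mul_le_mul_of_nonneg_right h1 hpos.le
    linarith

/-- The energy of the times from `T` to `T'`, seen from the time `T`; it is counted negatively when
`T'` precedes `T`. -/
def netEnergy (l : ℝ) (T T' : ℕ) (x : Path) : ℝ :=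
  if T ≤ T' then energy l 0 (T' - T) x else energy (-l) (-((T - T' : ℕ) : ℤ)) (T - T') x

lemma measurable_netEnergy (l : ℝ) (T T' : ℕ) : Measurable (netEnergy l T T') := by
  unfold netEnergy
  split_ifs
  · exact measurable_energy _ _ _
  · exact measurable_energy _ _ _

lemma IsNice.netEnergy_iterate {x : Path} (hx : IsNice x) (l : ℝ) (T T' : ℕ) :
    netEnergy l T T' ((ROSt.shiftEvolve fun k => l * k)^[T] x) =
      energy l 0 T' x - energy l 0 T x := by
  unfold netEnergy
  split_ifs with h
  · rw [hx.energy_future_iterate, Nat.add_sub_cancel' h]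
  · have h1 := hx.energy_reverse_iterate (l := l) (T - T') T'
    rwa [Nat.add_sub_cancel' (not_le.1 h).le] at h1

/-- The error is linear in |T' - T| with an arbitrarily small slope, and K does not depend on T and
T'; hence T' may grow with T. -/
lemma exists_forall_netEnergy_le {x : Path} {l m : ℝ}
    (h1 : Tendsto (fun n : ℕ => energy l 0 n x / n) atTop (𝓝 m))
    (h2 : Tendsto (fun n : ℕ => energy (-l) (-n) n x / n) atTop (𝓝 (-m))) {d : ℝ} (hd : 0 < d) :
    ∃ K, ∀ T T' : ℕ, netEnergy l T T' x ≤ m * ((T' : ℝ) - T) + d * |(T' : ℝ) - T| + K := by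
  obtain ⟨K1, hK1⟩ := exists_forall_abs_sub_le h1 hd
  obtain ⟨K2, hK2⟩ := exists_forall_abs_sub_le h2 hd
  refine ⟨max K1 K2, fun T T' => ?_⟩
  unfold netEnergy
  split_ifs with h
  · have h3 := (abs_le.1 (hK1 (T' - T))).2
    rw [Nat.cast_sub h] at h3
    rw [abs_of_nonneg (sub_nonneg.2 (Nat.cast_le.2 h))]
    linarith [le_max_left K1 K2]
  · have hle := (not_le.1 h).le
    have h3 := (abs_le.1 (hK2 (T - T'))).2
    have e : ((T - T' : ℕ) : ℝ) = T - T' := Nat.cast_sub hle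
    rw [e] at h3
    rw [abs_sub_comm, abs_of_nonneg (sub_nonneg.2 (Nat.cast_le.2 hle))]
    linarith [le_max_right K1 K2]

lemma window_past (T : ℕ) (x : Path) (i : ℕ) :
    window (-T) T x i = ∑ t ∈ Finset.Icc 1 T, x.2 (-(t : ℤ)) i := by
  rw [window, Finset.sum_apply]
  refine Finset.sum_nbij' (fun j => T - j) (fun t => T - t) ?_ ?_ ?_ ?_ ?_
  · intro j hj
    simp only [Finset.mem_range, Finset.mem_Icc] at *
    omega
  · intro j hj
    simp only [Finset.mem_range, Finset.mem_Icc] at *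
    omega
  · intro j hj
    simp only [Finset.mem_range] at *
    omega
  · intro j hj
    simp only [Finset.mem_Icc] at *
    omega
  · intro j hj
    simp only [Finset.mem_range] at hj
    have e : -(T : ℤ) + j = -((T - j : ℕ) : ℤ) := by omega
    rw [e]

/-- A particle cannot beat the total weight. -/
lemma IsNice.log_add_le_energy {x : Path} (hx : IsNice x) (b : ℝ) (a : ℤ) (n : ℕ) {i : ℕ}
    (hi : 0 < x.1.1 i) : Real.log (x.1.1 i) + b * window a n x i ≤ energy b a n x := by
  have hw := hx.isAdmissible.isWeight
  have hs := summable_of_mem hw (hx.smul_window_mem b a n)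
  have h1 : x.1.1 i * Real.exp ((b • window a n x) i) ≤ total x.1.1 (b • window a n x) := by
    rw [total_eq hw.nonneg]
    exact hs.le_tsum i fun j _ => mul_nonneg (hw.nonneg j) (Real.exp_pos _).le
  have h2 := Real.log_le_log (mul_pos hi (Real.exp_pos _)) h1
  rwa [Real.log_mul hi.ne' (Real.exp_pos _).ne', Real.log_exp] at h2

/-- Quadratic bounds on both sides of zero determine the slope. -/
lemma tendsto_of_forall_eventually_le {S : ℕ → ℝ} {a v M : ℝ}
    (h : ∀ᶠ n : ℕ in atTop,
      (∀ᶠ T : ℕ in atTop, a + 1 / ((n : ℝ) + 1) * S T ≤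
        (v * (1 / ((n : ℝ) + 1)) + M * (1 / ((n : ℝ) + 1)) ^ 2) * T) ∧
      ∀ᶠ T : ℕ in atTop, a + -(1 / ((n : ℝ) + 1)) * S T ≤
        (v * -(1 / ((n : ℝ) + 1)) + M * (-(1 / ((n : ℝ) + 1))) ^ 2) * T) :
    Tendsto (fun T : ℕ => (T : ℝ)⁻¹ * S T) atTop (𝓝 v) := by
  refine Metric.tendsto_atTop'.2 fun δ hδ => ?_
  have hsmall : ∀ᶠ n : ℕ in atTop, M * (1 / ((n : ℝ) + 1)) < δ / 2 := by
    have := (tendsto_one_div_add_atTop_nhds_zero_nat (𝕜 := ℝ)).const_mul M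
    rw [mul_zero] at this
    exact this.eventually_lt_const (by positivity)
  -- After division by the small coefficient ±e, the quadratic term is below δ/2; the constant a
  -- takes the other δ/2 for large T.
  obtain ⟨n, ⟨h1, h2⟩, h3⟩ := (h.and hsmall).exists
  set e : ℝ := 1 / ((n : ℝ) + 1) with he
  have hepos : 0 < e := by positivity
  have hbig : ∀ᶠ T : ℕ in atTop, -a < e * (δ / 2) * T :=
    (tendsto_natCast_atTop_atTop.const_mul_atTop (by positivity)).eventually_gt_atTop (-a)
  obtain ⟨N, hN⟩ := eventually_atTop.1 (((h1.and h2).and hbig).and (eventually_gt_atTop 0))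
  refine ⟨N, fun T hT => ?_⟩
  obtain ⟨⟨⟨g1, g2⟩, g3⟩, g4⟩ := hN T hT.le
  have hTpos : (0 : ℝ) < T := by exact_mod_cast g4
  have h4 : e * (M * e) * T ≤ e * (δ / 2) * T := by gcongr
  have k1 : S T < (v + δ) * T := by
    refine lt_of_mul_lt_mul_left (a := e) ?_ hepos.le
    nlinarith
  have k2 : (v - δ) * T < S T := by
    refine lt_of_mul_lt_mul_left (a := e) ?_ hepos.le
    nlinarith
  rw [Real.dist_eq, inv_mul_eq_div, abs_sub_lt_iff]
  constructor
  · rw [sub_lt_iff_lt_add', div_lt_iff₀ hTpos]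
    exact k1
  · rw [sub_lt_comm, lt_div_iff₀ hTpos]
    exact k2

/-! ### Upper bounds on the past energy, and the velocities -/

section Extension

variable {P : Measure Config} [IsProbabilityMeasure P] {r : ℕ} {l : ℝ} {μ : Measure Path}

/-- An upper bound on the energy of the past, when the field drives the evolution. -/
lemma IsExtension.ae_energy_past_le_of_ne_zero (hμ : IsExtension P (fun k => l * k) r μ)
    (hP : ∀ᵐ ω ∂P, IsAdmissible ω) (hl : l ≠ 0) {c : ℝ} (hc : 0 ≤ c)
    (h1 : ∀ᵐ x ∂μ, Tendsto (fun n : ℕ => energy l 0 n x / n) atTop (𝓝 (l ^ 2 / 2 * c)))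
    (h2 : ∀ᵐ x ∂μ, Tendsto (fun n : ℕ => energy (-l) (-n) n x / n) atTop
      (𝓝 (-(l ^ 2 / 2 * c)))) {e : ℝ} (he : e ≠ 0) (hle : l + e ≠ 0) :
    ∀ᵐ x ∂μ, ∀ᶠ T : ℕ in atTop,
      energy e (-T) T x ≤ (l * c * e + (c / 2 + 2) * e ^ 2) * T := by
  have hnice := hμ.ae_isNice hP
  set q : ℝ := (l + e) ^ 2 / l ^ 2 with hq
  have hqpos : 0 < q := by positivity
  set d : ℝ := e ^ 2 / (q + 2) with hd
  have hdpos : 0 < d := by positivity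
  set T' : ℕ → ℕ := fun T => ⌈q * T⌉₊ with hT'
  have hT'1 : ∀ T, q * T ≤ T' T := fun T => Nat.le_ceil _
  have hT'2 : ∀ T, (T' T : ℝ) ≤ q * T + 1 := fun T => (Nat.ceil_lt_add_one (by positivity)).le
  have hT'3 : ∀ T, (T' T : ℝ) ≤ (q + 1) * T := by
    intro T
    rcases T.eq_zero_or_pos with rfl | h
    · simp [hT']
    · have : (1 : ℝ) ≤ T := by exact_mod_cast h
      linarith [hT'2 T]
  obtain ⟨c1, hc1, hB1⟩ := hμ.exists_concentration hP (l + e) (half_pos hdpos)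
  have hd2 : 0 < d / 2 / (q + 1) := by positivity
  obtain ⟨c2, hc2, hB2⟩ := hμ.exists_concentration hP l hd2
  -- Seen from T steps earlier, the difference is `energy (l + e) 0 T - energy l 0 (T' T)`. Both
  -- energies concentrate around free energies of the same configuration, which are ordered by
  -- monotonicity in the variance. Comparing them directly avoids the unknown speed at which the
  -- free energy per step approaches its limit.
  have hbound : ∀ T : ℕ, μ {x | d * T ≤ energy e (-T) T x - netEnergy l T (T' T) x} ≤
      ENNReal.ofReal (2 * Real.exp (-(c1 * T))) +
        ENNReal.ofReal (2 * Real.exp (-(c2 * q * T))) := by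
    intro T
    have hmono : ENNReal.ofReal (2 * Real.exp (-(c2 * (T' T : ℕ)))) ≤
        ENNReal.ofReal (2 * Real.exp (-(c2 * q * T))) := by
      refine ENNReal.ofReal_le_ofReal ?_
      have h := mul_le_mul_of_nonneg_left (hT'1 T) hc2.le
      rw [← mul_assoc] at h
      gcongr
    refine le_trans ?_ (add_le_add (hB1 T) ((hB2 (T' T)).trans hmono))
    refine le_trans ?_ (measure_union_le _ _)
    refine hμ.measure_le_of_iterate (T := T) (measurableSet_le measurable_const
      ((measurable_energy _ _ _).sub (measurable_netEnergy _ _ _))) ?_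
    filter_upwards [hnice] with x hx hA
    have hA' : d * T ≤ energy e (-T) T ((shiftEvolve fun k => l * k)^[T] x) -
      netEnergy l T (T' T) ((shiftEvolve fun k => l * k)^[T] x) := hA
    rw [hx.energy_past_iterate, hx.netEnergy_iterate] at hA'
    by_contra hn
    have hn1 : ¬ d / 2 * T ≤ |energy (l + e) 0 T x - freeEnergy r (T * (l + e) ^ 2) x.1| :=
      fun h => hn (Or.inl h)
    have hn2 : ¬ d / 2 / (q + 1) * (T' T : ℕ) ≤
        |energy l 0 (T' T) x - freeEnergy r ((T' T : ℕ) * l ^ 2) x.1| := fun h => hn (Or.inr h)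
    rw [not_le, abs_lt] at hn1 hn2
    have hadm := hx.isAdmissible
    have hfree : freeEnergy r (T * (l + e) ^ 2) x.1 ≤ freeEnergy r ((T' T : ℕ) * l ^ 2) x.1 := by
      rw [freeEnergy_eq hadm r (by positivity), freeEnergy_eq hadm r (by positivity)]
      refine free_mono (isCorr_entryPow hadm.isCorr r) hadm.isWeight (by positivity) ?_
      have : (l + e) ^ 2 = q * l ^ 2 := by rw [hq]; field_simp
      rw [this]
      nlinarith [hT'1 T, sq_nonneg l]
    have h3 : d / 2 / (q + 1) * (T' T : ℕ) ≤ d / 2 * T := by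
      calc d / 2 / (q + 1) * (T' T : ℕ) ≤ d / 2 / (q + 1) * ((q + 1) * T) := by
            gcongr
            exact hT'3 T
        _ = d / 2 * T := by field_simp
    linarith [hn1.2, hn2.1]
  have hsum : ∑' T : ℕ, μ {x | d * T ≤ energy e (-T) T x - netEnergy l T (T' T) x} ≠ ∞ := by
    refine ne_top_of_le_ne_top ?_ (ENNReal.tsum_le_tsum hbound)
    rw [ENNReal.tsum_add]
    exact ENNReal.add_ne_top.2 ⟨tsum_ofReal_exp_ne_top hc1 2,
      tsum_ofReal_exp_ne_top (mul_pos hc2 hqpos) 2⟩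
  filter_upwards [h1, h2, ae_eventually_notMem hsum] with x hx1 hx2 hx3
  obtain ⟨K, hK⟩ := exists_forall_netEnergy_le hx1 hx2 hdpos
  have hm : 0 ≤ l ^ 2 / 2 * c := by positivity
  -- A second e² T absorbs K and the cost of rounding T' up. With c/2 from `h7`, this makes up the
  -- coefficient c/2 + 2.
  have hbig : ∀ᶠ T : ℕ in atTop, l ^ 2 / 2 * c + K ≤ e ^ 2 * T :=
    (tendsto_natCast_atTop_atTop.const_mul_atTop (by positivity)).eventually_ge_atTop _
  filter_upwards [hx3, hbig] with T hT hT2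
  have hT0 : (0 : ℝ) ≤ T := Nat.cast_nonneg T
  have h3 : energy e (-T) T x - netEnergy l T (T' T) x < d * T := not_le.1 hT
  have h4 := hK T (T' T)
  have h5 : |((T' T : ℕ) : ℝ) - T| ≤ (q + 1) * T := by
    rw [abs_le]
    have : 0 ≤ ((T' T : ℕ) : ℝ) := Nat.cast_nonneg _
    constructor
    · nlinarith
    · linarith [hT'3 T]
  have h6 : l ^ 2 / 2 * c * (((T' T : ℕ) : ℝ) - T) ≤ l ^ 2 / 2 * c * ((q - 1) * T + 1) := by
    refine mul_le_mul_of_nonneg_left ?_ hm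
    linarith [hT'2 T]
  have h7 : l ^ 2 / 2 * c * (q - 1) = l * c * e + c / 2 * e ^ 2 := by
    rw [hq]
    field_simp
    ring
  have h8 : d * (q + 2) = e ^ 2 := by rw [hd]; field_simp
  have h9 := mul_le_mul_of_nonneg_left h5 hdpos.le
  have h10 : l ^ 2 / 2 * c * ((q - 1) * T + 1) =
      (l * c * e + c / 2 * e ^ 2) * T + l ^ 2 / 2 * c := by rw [← h7]; ring
  have h11 : d * ((q + 1) * T) + d * T = e ^ 2 * T := by rw [← h8]; ring
  linarith

/-- An upper bound on the energy of the past, when the weights do not evolve. -/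
lemma IsExtension.ae_energy_past_le_of_eq_zero (hμ : IsExtension P (fun k => (0 : ℝ) * k) r μ)
    (hP : ∀ᵐ ω ∂P, IsAdmissible ω) {e : ℝ} (he : e ≠ 0) :
    ∀ᵐ x ∂μ, ∀ᶠ T : ℕ in atTop, energy e (-T) T x ≤ 2 * e ^ 2 * T := by
  obtain ⟨c, hc, hB⟩ := hμ.exists_concentration hP e (d := e ^ 2) (by positivity)
  have hbound : ∀ T : ℕ, μ {x | 2 * e ^ 2 * T ≤ energy e (-T) T x} ≤
      ENNReal.ofReal (2 * Real.exp (-(c * T))) := by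
    intro T
    refine le_trans ?_ (hB T)
    refine hμ.measure_le_of_iterate (T := T)
      (measurableSet_le measurable_const (measurable_energy _ _ _)) ?_
    filter_upwards [hμ.ae_isNice hP] with x hx hA
    have hA' : 2 * e ^ 2 * T ≤ energy e (-T) T ((shiftEvolve fun k => (0 : ℝ) * k)^[T] x) := hA
    have h0 : energy 0 0 T x = 0 := by
      rw [energy, zero_smul]
      exact lse_zero hx.isAdmissible.isWeight
    rw [hx.energy_past_iterate, h0, zero_add, sub_zero] at hA'
    -- The free energy is at most half of e² T, so an energy of 2 e² T deviates from it by more than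
    -- e² T.
    have h1 := freeEnergy_le hx.isAdmissible r (s := T * e ^ 2) (by positivity)
    change e ^ 2 * T ≤ |energy e 0 T x - freeEnergy r (T * e ^ 2) x.1|
    refine le_trans ?_ (le_abs_self _)
    nlinarith [show (0 : ℝ) ≤ e ^ 2 * T by positivity]
  filter_upwards [ae_eventually_notMem (ne_top_of_le_ne_top (tsum_ofReal_exp_ne_top hc 2)
    (ENNReal.tsum_le_tsum hbound))] with x hx
  filter_upwards [hx] with T hT
  exact (not_le.1 hT).le

/-- The gaussian tails of the past sums of the particles without weight. -/
lemma IsExtension.ae_abs_window_lt (hμ : IsExtension P (fun k => l * k) r μ)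
    (hP : ∀ᵐ ω ∂P, IsAdmissible ω) {d : ℝ} (hd : 0 < d) (i : ℕ) :
    ∀ᵐ x ∂μ, x.1.1 i = 0 → ∀ᶠ T : ℕ in atTop, |window (-T) T x i| < d * T := by
  have hfwd : ∀ T : ℕ, μ {x | d * T ≤ |window 0 T x i|} ≤
      ENNReal.ofReal (2 * Real.exp (-(d ^ 2 / 2 * T))) := by
    intro T
    have hA : MeasurableSet {z : Config × (ℕ → ℝ) | d * T ≤ |z.2 i|} :=
      measurableSet_le measurable_const (continuous_abs.measurable.comp (by fun_prop))
    have h1 := measure_forwardLaw_combine_le (r := r) hP hA (fun _ => 1) T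
      (K := ENNReal.ofReal (2 * Real.exp (-(d ^ 2 / 2 * T)))) fun ω hω => by
        have hC := isCorr_entryPow hω.isCorr r
        have hT0 : (0 : ℝ) ≤ T := Nat.cast_nonneg T
        have hs : (∑ t ∈ Finset.range T, (1 : ℝ) ^ 2) = T := by simp
        rw [hs]
        have hexp : ∀ b : ℝ, b ^ 2 = d ^ 2 →
            field (entryPow r ω.2) T {y | d ^ 2 * T ≤ b * y i} ≤
              ENNReal.ofReal (Real.exp (-(d ^ 2 / 2 * T))) := by
          intro b hb
          have h2 := lintegral_exp_gaussField (posSemidef_smul hC.posSemidef hT0) b i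
          have h3 := measure_le_of_lintegral_exp (u := d ^ 2 * T) (f := fun y : ℕ → ℝ => b * y i)
            (by fun_prop) h2.le
          refine h3.trans (ENNReal.ofReal_le_ofReal (Real.exp_le_exp.2 (le_of_eq ?_)))
          rw [hb, hC.diag]
          ring
        have hsub : {y : ℕ → ℝ | d * T ≤ |y i|} ⊆
            {y | d ^ 2 * T ≤ d * y i} ∪ {y | d ^ 2 * T ≤ -d * y i} := by
          intro y hy
          rcases le_abs.1 (show d * T ≤ |y i| from hy) with h | h
          · left
            change d ^ 2 * T ≤ d * y i
            nlinarith
          · right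
            change d ^ 2 * T ≤ -d * y i
            nlinarith
        refine (measure_mono hsub).trans ((measure_union_le _ _).trans
          ((add_le_add (hexp d rfl) (hexp (-d) (neg_sq d))).trans ?_))
        rw [← ENNReal.ofReal_add (Real.exp_pos _).le (Real.exp_pos _).le, ← two_mul]
    rw [← hμ.map_past_zero, Measure.map_apply (measurable_past 0)
      (measurable_combine _ _ hA)] at h1
    have e : past 0 ⁻¹' (combine (fun _ => 1) T ⁻¹' {z : Config × (ℕ → ℝ) | d * T ≤ |z.2 i|}) =
        {x | d * T ≤ |window 0 T x i|} := by
      ext x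
      simp only [Set.mem_preimage, combine_past, one_smul]
      rfl
    rwa [e] at h1
  have hwi : ∀ T : ℕ, Measurable fun x : Path => window (-T) T x i := fun T =>
    (measurable_pi_apply i).comp (measurable_window _ _)
  have hbound : ∀ T : ℕ, μ {x | x.1.1 i = 0 ∧ d * T ≤ |window (-T) T x i|} ≤
      ENNReal.ofReal (2 * Real.exp (-(d ^ 2 / 2 * T))) := by
    intro T
    refine le_trans ?_ (hfwd T)
    refine hμ.measure_le_of_iterate (T := T) (MeasurableSet.inter
      (measurableSet_eq_fun (by fun_prop) measurable_const)
      (measurableSet_le measurable_const (continuous_abs.measurable.comp (hwi T)))) ?_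
    filter_upwards [hμ.ae_isNice hP] with x hx hA
    obtain ⟨σ, hσ, h1, h2, h3⟩ := hx.exists_relabel (l := l) T
    obtain ⟨hA1, hA2⟩ := hA
    have hw := hx.isAdmissible.isWeight
    have hz : x.1.1 (σ i) = 0 := by
      rw [h1] at hA1
      exact (tilt_eq_zero_iff hw (summable_of_mem hw (hx.smul_window_mem l 0 T)) _).1 hA1
    -- The particle labelled i after T steps had no weight before them, so its label was fixed
    -- throughout. Hence its past sum is the forward sum at the same index, gaussian of variance T.
    have hi : σ i = i := hσ.1 (h3 _ hz)
    have e : window (-T) T ((shiftEvolve fun k => l * k)^[T] x) i = window 0 T x i := by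
      simp only [window, Finset.sum_apply, h2, hi]
      refine Finset.sum_congr rfl fun j _ => ?_
      rw [show -(T : ℤ) + j + T = 0 + j by ring]
    rwa [e] at hA2
  filter_upwards [ae_eventually_notMem (ne_top_of_le_ne_top
    (tsum_ofReal_exp_ne_top (half_pos (sq_pos_of_pos hd)) 2)
    (ENNReal.tsum_le_tsum hbound))] with x hx h0
  filter_upwards [hx] with T hT
  by_contra hn
  exact hT ⟨h0, not_lt.1 hn⟩

/-- For an ergodic quasi-stationary overlap structure, all particles have the same past velocity. -/
lemma IsExtension.ae_tendsto_pastAverage (hμ : IsExtension P (fun k => l * k) r μ)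
    (hP : ∀ᵐ ω ∂P, IsAdmissible ω) (herg : IsErgodic P (fun k => l * k) r) {c : ℝ} (hc : 0 ≤ c)
    (hmean : ∀ s, 0 ≤ s → meanFree P r s = s * (c / 2)) :
    ∀ᵐ x ∂μ, ∀ i : ℕ,
      Tendsto (fun T : ℕ => pastAverage (fun k => k) x i T) atTop (𝓝 (l * c)) := by
  have hfwd : ∀ᵐ x ∂μ, Tendsto (fun n : ℕ => energy l 0 n x / n) atTop (𝓝 (l ^ 2 / 2 * c)) :=
    hμ.ae_tendsto_energy hP herg fun n hn => by
      rw [hmean _ (by positivity)]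
      field_simp
  have hbwd := hμ.ae_tendsto_energy_neg hP hfwd
  -- The bound is required almost surely for the countably many e = ±1/(n+1) only; the exceptional
  -- case l + e = 0 is avoided for large n.
  have hupper : ∀ e : ℝ, e ≠ 0 → (l = 0 ∨ l + e ≠ 0) → ∀ᵐ x ∂μ, ∀ᶠ T : ℕ in atTop,
      energy e (-T) T x ≤ (l * c * e + (c / 2 + 2) * e ^ 2) * T := by
    intro e he hle
    rcases eq_or_ne l 0 with rfl | hl
    · filter_upwards [hμ.ae_energy_past_le_of_eq_zero hP he] with x hx
      filter_upwards [hx] with T hT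
      refine hT.trans ?_
      have : 0 ≤ c / 2 * e ^ 2 * T := by positivity
      linarith
    · exact hμ.ae_energy_past_le_of_ne_zero hP hl hc hfwd hbwd he (hle.resolve_left hl)
  have hne : ∀ n : ℕ, (1 : ℝ) / ((n : ℝ) + 1) ≠ 0 := fun n => by positivity
  have hev : ∀ᶠ n : ℕ in atTop, (l = 0 ∨ l + 1 / ((n : ℝ) + 1) ≠ 0) ∧
      (l = 0 ∨ l + -(1 / ((n : ℝ) + 1)) ≠ 0) := by
    rcases eq_or_ne l 0 with rfl | hl
    · simp
    · have h0 := (tendsto_one_div_add_atTop_nhds_zero_nat (𝕜 := ℝ)).eventually_lt_const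
        (abs_pos.2 hl)
      filter_upwards [h0] with n hn
      have hpos : (0 : ℝ) < 1 / ((n : ℝ) + 1) := by positivity
      refine ⟨Or.inr fun h => ?_, Or.inr fun h => ?_⟩
      · rw [eq_neg_of_add_eq_zero_left h, abs_neg, abs_of_pos hpos] at hn
        exact lt_irrefl _ hn
      · rw [eq_neg_of_add_eq_zero_left h, neg_neg, abs_of_pos hpos] at hn
        exact lt_irrefl _ hn
  have hu1 : ∀ᵐ x ∂μ, ∀ n : ℕ, (l = 0 ∨ l + 1 / ((n : ℝ) + 1) ≠ 0) → ∀ᶠ T : ℕ in atTop,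
      energy (1 / ((n : ℝ) + 1)) (-T) T x ≤
        (l * c * (1 / ((n : ℝ) + 1)) + (c / 2 + 2) * (1 / ((n : ℝ) + 1)) ^ 2) * T :=
    ae_all_iff.2 fun n => by
      by_cases h : l = 0 ∨ l + 1 / ((n : ℝ) + 1) ≠ 0
      · filter_upwards [hupper _ (hne n) h] with x hx _ using hx
      · exact ae_of_all _ fun _ h' => absurd h' h
  have hu2 : ∀ᵐ x ∂μ, ∀ n : ℕ, (l = 0 ∨ l + -(1 / ((n : ℝ) + 1)) ≠ 0) → ∀ᶠ T : ℕ in atTop,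
      energy (-(1 / ((n : ℝ) + 1))) (-T) T x ≤
        (l * c * -(1 / ((n : ℝ) + 1)) + (c / 2 + 2) * (-(1 / ((n : ℝ) + 1))) ^ 2) * T :=
    ae_all_iff.2 fun n => by
      by_cases h : l = 0 ∨ l + -(1 / ((n : ℝ) + 1)) ≠ 0
      · filter_upwards [hupper _ (neg_ne_zero.2 (hne n)) h] with x hx _ using hx
      · exact ae_of_all _ fun _ h' => absurd h' h
  have hzero : ∀ᵐ x ∂μ, ∀ i m : ℕ, x.1.1 i = 0 → ∀ᶠ T : ℕ in atTop,
      |window (-T) T x i| < 1 / ((m : ℝ) + 1) * T :=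
    ae_all_iff.2 fun i => ae_all_iff.2 fun m => hμ.ae_abs_window_lt hP (by positivity) i
  filter_upwards [hμ.ae_isNice hP, hu1, hu2, hzero, hbwd] with x hx h1 h2 h0 hb
  have havg : ∀ i T, pastAverage (fun k => k) x i T = (T : ℝ)⁻¹ * window (-T) T x i := by
    intro i T
    rw [window_past, pastAverage]
  simp only [havg]
  have hw := hx.isAdmissible.isWeight
  have hpos : ∀ i, 0 < x.1.1 i →
      Tendsto (fun T : ℕ => (T : ℝ)⁻¹ * window (-T) T x i) atTop (𝓝 (l * c)) := by
    intro i hi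
    refine tendsto_of_forall_eventually_le (a := Real.log (x.1.1 i)) (M := c / 2 + 2) ?_
    filter_upwards [hev] with n hn
    constructor
    · filter_upwards [h1 n hn.1] with T hT
      exact (hx.log_add_le_energy _ _ _ hi).trans hT
    · filter_upwards [h2 n hn.2] with T hT
      exact (hx.log_add_le_energy _ _ _ hi).trans hT
  intro i
  rcases (hw.nonneg i).eq_or_lt with hi | hi
  swap
  · exact hpos i hi
  -- Only the finitely many labels below i can carry weight, so the limits of their averages hold
  -- simultaneously. If lc were not zero, their common velocity would push the backward energy rate
  -- below its known value -l²c/2.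
  have hlc : l * c = 0 := by
    have hfin : ∀ j, i ≤ j → x.1.1 j = 0 := fun j hij => hx.isAdmissible.eq_zero hij hi.symm
    by_contra hne'
    obtain ⟨hl0, hc0⟩ := mul_ne_zero_iff.1 hne'
    have hcpos : 0 < c := lt_of_le_of_ne hc (Ne.symm hc0)
    have hl2 : 0 < l ^ 2 * c := by positivity
    have hexp : ∀ j, 0 < x.1.1 j → ∀ᶠ T : ℕ in atTop,
        -l * window (-T) T x j ≤ -(3 / 4 * (l ^ 2 * c)) * T := by
      intro j hj
      have h3 := (hpos j hj).const_mul (-l)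
      -- Any factor strictly between 1/2 and 1 would do: the particles give the rate -l²c, the
      -- backward energy -l²c/2.
      have h4 : -l * (l * c) < -(3 / 4 * (l ^ 2 * c)) := by nlinarith
      filter_upwards [h3.eventually_lt_const h4, eventually_gt_atTop 0] with T hT hT0
      have hT0' : (0 : ℝ) < T := by exact_mod_cast hT0
      have h5 := mul_le_mul_of_nonneg_right hT.le hT0'.le
      refine le_trans (le_of_eq ?_) h5
      field_simp
    have hexp' : ∀ᶠ T : ℕ in atTop, ∀ j ∈ Finset.range i, 0 < x.1.1 j →
        -l * window (-T) T x j ≤ -(3 / 4 * (l ^ 2 * c)) * T := by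
      refine (Filter.eventually_all_finset _).2 fun j _ => ?_
      by_cases hj : 0 < x.1.1 j
      · filter_upwards [hexp j hj] with T hT _ using hT
      · exact Eventually.of_forall fun _ h => absurd h hj
    have hle : ∀ᶠ T : ℕ in atTop, energy (-l) (-T) T x / T ≤ -(3 / 4 * (l ^ 2 * c)) := by
      filter_upwards [hexp', eventually_gt_atTop 0] with T hT hT0
      have hT0' : (0 : ℝ) < T := by exact_mod_cast hT0
      have hs := summable_of_mem hw (hx.smul_window_mem (-l) (-T) T)
      rw [div_le_iff₀ hT0', energy, lse, Real.log_le_iff_le_exp (hw.total_pos hs),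
        total_eq hw.nonneg]
      have hterm : ∀ j, x.1.1 j * Real.exp ((-l • window (-T) T x) j) ≤
          x.1.1 j * Real.exp (-(3 / 4 * (l ^ 2 * c)) * T) := by
        intro j
        rcases (hw.nonneg j).eq_or_lt with hj | hj
        · rw [← hj, zero_mul, zero_mul]
        · refine mul_le_mul_of_nonneg_left (Real.exp_le_exp.2 ?_) hj.le
          refine hT j (Finset.mem_range.2 ?_) hj
          by_contra hji
          exact hj.ne' (hfin j (not_lt.1 hji))
      have h6 := hw.hasSum.mul_right (Real.exp (-(3 / 4 * (l ^ 2 * c)) * T))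
      rw [one_mul] at h6
      exact hasSum_le hterm hs.hasSum h6
    have h7 := le_of_tendsto hb hle
    nlinarith
  rw [hlc]
  refine Metric.tendsto_atTop'.2 fun δ hδ => ?_
  obtain ⟨m, hm⟩ := exists_nat_one_div_lt hδ
  obtain ⟨N, hN⟩ := eventually_atTop.1 ((h0 i m hi.symm).and (eventually_gt_atTop 0))
  refine ⟨N, fun T hT => ?_⟩
  obtain ⟨g1, g2⟩ := hN T hT.le
  have hT0 : (0 : ℝ) < T := by exact_mod_cast g2
  rw [Real.dist_eq, sub_zero, inv_mul_eq_div, abs_div, abs_of_pos hT0, div_lt_iff₀ hT0]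
  exact g1.trans (by gcongr)

end Extension

end ROSt

end

theorem lemma2p5 (P : MeasureTheory.Measure ROSt.Config) (hP : ROSt.IsROSt P)
    (r : ℕ) (hr : 1 ≤ r) (U : Set ℝ) (hU : IsOpen U)
    (hqs : ∀ l ∈ U, ROSt.IsQuasiStationary P (fun k => l * k) r)
    (l : ℝ) (hl : l ∈ U) :
    (MeasureTheory.Integrable
        (fun x => Real.log (ROSt.mass (fun k => l * k) x.1 (x.2 0)).toReal)
        (ROSt.forwardLaw P r) ∧
      ROSt.generating P r l =
        l ^ 2 / 2 * ∫ q in Set.Icc (-1 : ℝ) 1, (1 - q ^ r : ℝ) ∂(ROSt.overlapMeasure P)) ∧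
    (∃! μ : MeasureTheory.Measure ROSt.Path, ROSt.IsExtension P (fun k => l * k) r μ) ∧
    (ROSt.IsErgodic P (fun k => l * k) r →
      ∀ μ : MeasureTheory.Measure ROSt.Path, ROSt.IsExtension P (fun k => l * k) r μ →
        ∀ᵐ x ∂μ, ∀ i : ℕ,
          Filter.Tendsto (fun T : ℕ => ROSt.pastAverage (fun k => k) x i T) Filter.atTop
            (nhds (l * ∫ q in Set.Icc (-1 : ℝ) 1, (1 - q ^ r : ℝ) ∂(ROSt.overlapMeasure P)))) := by
  have hprob := hP.isProbabilityMeasure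
  have hlin : Measurable fun k : ℝ => l * k := by fun_prop
  have hadm := hP.ae_isAdmissible hlin (hqs l hl)
  refine ⟨⟨ROSt.integrable_log_mass hadm l, ?_⟩,
    ROSt.existsUnique_isExtension hadm hlin (hqs l hl), ?_⟩
  · rw [ROSt.generating_eq hadm, ROSt.setIntegral_overlapMeasure hadm,
      ROSt.meanFree_eq hadm hU hqs hl (sq_nonneg l)]
    ring
  · intro herg μ hμ
    rw [ROSt.setIntegral_overlapMeasure hadm]
    exact hμ.ae_tendsto_pastAverage hadm herg ROSt.meanDefect_nonneg
      fun s hs => ROSt.meanFree_eq hadm hU hqs hl hs
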